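/- **Model (CONGEST).** Let $G=(V,E)$ be a connected undirected graph with $n$ nodes (with IDs $0,\dots,n-1$), $m$ edges and diameter $D$. Each node knows its ID, the IDs of its neighbours, $n$, $D$ and the walk length $\ell$; the source $s$ knows that it is the source. The network is synchronous; in each round a node may send one message along each incident edge. Local computation, including private random draws, is free. The running time is the number of rounds. **Algorithm Single-Random-Walk** (source $s$, length $\ell\ge 0$; positive integer parameters $\eta,\lambda,B$ depending only on $n,\ell,D$). *Phase 1* (omitted if $\ell<2\lambda$, when its walks would not be used). Each node $v$ starts $\eta\deg(v)$ tokens, each carrying the ID of $v$ and an independent desired length uniform in $\{\lambda,\dots,2\lambda-1\}$. In each iteration every unfinished token that arrived in the previous iteration is forwarded to a uniformly random neighbour; an iteration takes $B$ rounds, with one token per directed edge and round, and a token that could not be sent keeps its chosen neighbour and waits for the next iteration. A token whose walk has its desired length is stored where it is. After every $2\lambda$ iterations the nodes flood for $D$ rounds whether some token is unfinished; if so, another $2\lambda$ iterations follow. *Phase 2.* A token naming $s$ starts at $s$. While the length of the walk completed is at most $\ell-2\lambda$, the holder $v$ calls Sample-Destination: build a BFS tree rooted at $v$; sample uniformly,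 by a weighted convergecast on the tree, one of the stored unused short walks that started at $v$; announce the result by flooding; delete that short walk, and move the token to its endpoint. If no unused short walk of $v$ is left, $v$ first calls Get-More-Walks, which performs $\lfloor \ell/\lambda\rfloor$ new walks from $v$, sending only counts over the edges: all make $\lambda$ steps, and then, for $i=0,\dots,\lambda-1$, each walk not yet stopped stops with probability $1/(\lambda-i)$ and otherwise makes one more step. When the loop ends, the walk is completed to $\ell$ steps naively, by sending the token to random neighbours. The final holder $v$ outputs the ID of $s$, and its ID is flooded for $\min(\ell,D)$ rounds so that $s$ outputs the ID of $v$. **Theorem.** There are a choice of the parameters $\eta,\lambda,B$ as functions of $n,\ell,D$ and an exponent $a$ such that for every $K$ there is a constant $C$ for which the following holds for every such graph $G$, every source $s$ and every $\ell\le K m^2$: 1. Single-Random-Walk always halts with a correct result: exactly one node $v$ outputs the ID of $s$, the source outputs the ID of $v$, no node has any other output, and $v$ is distributed exactly as the endpoint of the $\ell$-step simple random walk on $G$ started at $s$; 2. every message sent has at most $C\log n$ bits; 3. with probability at least $1-\frac2n$, all nodes have halted after at most $C(\log n)^a\sqrt{\ell D}$ rounds; that is, the algorithm finishes in $\tilde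 O(\sqrt{\ell D})$ rounds. -/

import Mathlib

open scoped Classical in
/-- One step of the simple random walk on a finite graph: a uniformly random neighbour.
(At a vertex without neighbours the walk stays put.) -/
noncomputable def SimpleGraph.srwStep {V : Type} [Fintype V] (G : SimpleGraph V) (x : V) : PMF V :=
  if h : (G.neighborFinset x).Nonempty then PMF.uniformOfFinset (G.neighborFinset x) h
  else PMF.pure x

/-- The law of the endpoint of an `ℓ`-step simple random walk started at `s`. -/
noncomputable def SimpleGraph.srw {V : Type} [Fintype V] (G : SimpleGraph V) (s : V) : ℕ → PMF V
  | 0 => PMF.pure s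
  | ℓ + 1 => (G.srw s ℓ).bind G.srwStep

namespace Congest

/-! ## The CONGEST model -/

/-- A message is a finite sequence of natural numbers. -/
abbrev Msg := List ℕ

/-- Length of a message as a bit string, in the self-delimiting binary encoding that doubles every
bit, closes every entry by `01` and closes the message by `10`. -/
def msgBits (m : Msg) : ℕ := 2 + (m.map fun x => 2 * Nat.size x + 2).sum

/-- The program of one node of an `n`-node synchronous network, with result in `α`. The node either
* `ret a`: has halted with result `a` (it sends nothing any more), or
* `draw k f`: draws a private uniform element `i` of `{0, …, k}` (free local computation) and
  continues as `f i`, or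
* `comm out f`: takes part in one communication round, in which it sends `out u` (at most one
  message) to every neighbour `u`, and continues as `f inbox`, where `inbox u` is what arrived from
  `u`. -/
inductive Prog (n : ℕ) (α : Type) : Type
  | ret (a : α) : Prog n α
  | draw (k : ℕ) (f : Fin (k + 1) → Prog n α) : Prog n α
  | comm (out : Fin n → Option Msg) (f : (Fin n → Option Msg) → Prog n α) : Prog n α

/-- Sequential composition of node programs. -/
def Prog.bind {n : ℕ} {α β : Type} : Prog n α → (α → Prog n β) → Prog n β
  | .ret a, g => g a
  | .draw k f, g => .draw k fun i => (f i).bind g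
  | .comm out f, g => .comm out fun inbox => (f inbox).bind g

instance {n : ℕ} : Monad (Prog n) where
  pure := Prog.ret
  bind := Prog.bind

/-- Perform the local computation (random draws) up to the next communication round or halt. -/
noncomputable def Prog.settle {n : ℕ} {α : Type} : Prog n α → PMF (Prog n α)
  | .ret a => PMF.pure (.ret a)
  | .draw k f => (PMF.uniformOfFintype (Fin (k + 1))).bind fun i => (f i).settle
  | .comm out f => PMF.pure (.comm out f)

/-- What a (settled) program sends to node `v` in the current round. -/
def Prog.send {n : ℕ} {α : Type} : Prog n α → Fin n → Option Msg
  | .comm out _, v => out v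
  | _, _ => none

/-- How a (settled) program continues when it receives `inbox`. -/
def Prog.receive {n : ℕ} {α : Type} : Prog n α → (Fin n → Option Msg) → Prog n α
  | .comm _ f, inbox => f inbox
  | p, _ => p

/-- The result of a halted program. -/
def Prog.result {n : ℕ} {α : Type} : Prog n α → Option α
  | .ret a => some a
  | _ => none

/-- The joint law of independent samples from `p 0, …, p (n - 1)`. -/
noncomputable def independent {β : Type} : (n : ℕ) → (Fin n → PMF β) → PMF (Fin n → β)
  | 0, _ => PMF.pure fun i => i.elim0
  | n + 1, p => (p 0).bind fun b =>
      (independent n fun i => p i.succ).bind fun f => PMF.pure (Fin.cons b f)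

/-- Global configuration between two rounds: the (settled) programs of all nodes, and the length in
bits of the longest message that has been sent over an edge so far. -/
structure Config (n : ℕ) (α : Type) where
  prog : Fin n → Prog n α
  bits : ℕ

/-- All nodes have halted. -/
def Config.Halted {n : ℕ} {α : Type} (c : Config n α) : Prop :=
  ∀ v, ((c.prog v).result).isSome

/-- The results of all nodes (`none` for a node that is still running). -/
def Config.results {n : ℕ} {α : Type} (c : Config n α) (v : Fin n) : Option α :=
  (c.prog v).result

open scoped Classical in
/-- What node `v` receives in the current round: messages travel only along edges of `G`. -/
noncomputable def Config.inbox {n : ℕ} {α : Type} (G : SimpleGraph (Fin n)) (c : Config n α)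
    (v u : Fin n) : Option Msg :=
  if G.Adj u v then (c.prog u).send v else none

/-- One synchronous round. -/
noncomputable def Config.round {n : ℕ} {α : Type} (G : SimpleGraph (Fin n)) (c : Config n α) :
    PMF (Config n α) :=
  (independent n fun v => ((c.prog v).receive (c.inbox G v)).settle).map fun p =>
    { prog := p
      bits := max c.bits <| Finset.univ.sup fun v => Finset.univ.sup fun u =>
        ((c.inbox G v u).map msgBits).getD 0 }

/-- The law of the configuration after `t` rounds, if node `v` runs the program `prog v`. -/
noncomputable def exec {n : ℕ} {α : Type} (G : SimpleGraph (Fin n)) (prog : Fin n → Prog n α) :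
    ℕ → PMF (Config n α)
  | 0 => (independent n fun v => (prog v).settle).map fun p => { prog := p, bits := 0 }
  | t + 1 => (exec G prog t).bind (Config.round G)

/-! ## Building blocks of node programs -/

/-- One communication round. -/
def exchange {n : ℕ} (out : Fin n → Option Msg) : Prog n (Fin n → Option Msg) :=
  .comm out .ret

/-- A uniform element of `{0, …, k}`. -/
def uniform {n : ℕ} (k : ℕ) : Prog n ℕ :=
  .draw k fun i => .ret i.val

/-- A uniformly random entry of a list (`none` if the list is empty). -/
def pick {n : ℕ} {β : Type} : List β → Prog n (Option β)
  | [] => .ret none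
  | a :: l => .draw l.length fun i => .ret (some ((a :: l).get i))

/-- The messages received in a round with their senders, in the order of the sender's ID. -/
def arrivals {n : ℕ} (inbox : Fin n → Option Msg) : List (Fin n × Msg) :=
  (List.finRange n).filterMap fun u => (inbox u).map fun m => (u, m)

/-- What a node knows about a flooded message: the message, the round in which it arrived (the
distance to the initiator) and the neighbour from which it came; for an initiator `0` and `none`. -/
structure Heard (n : ℕ) where
  msg : Msg
  level : ℕ
  parent : Option (Fin n)

/-- `flood k 0 h`: flooding for `k` rounds. The initiators start with `h ≠ none`; in every round
each informed node sends the message to all neighbours, and an uninformed node that receives it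
stores it with the round number and one of the senders. From a single initiator this builds a
breadth-first search tree. -/
def flood {n : ℕ} : (k i : ℕ) → Option (Heard n) → Prog n (Option (Heard n))
  | 0, _, h => return h
  | k + 1, i, h => do
      let inbox ← exchange fun _ => h.map Heard.msg
      flood k (i + 1) (h <|> (arrivals inbox).head?.map fun a => ⟨a.2, i + 1, some a.1⟩)

/-! ## The algorithm Single-Random-Walk -/

/-- What a node knows at the beginning: its ID, the IDs of its neighbours, whether it is the source,
the desired walk length and the diameter of the network (besides the number `n` of nodes). -/
structure Input (n : ℕ) where
  id : Fin n
  nbrs : List (Fin n)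
  isSource : Bool
  len : ℕ
  diam : ℕ

/-- Parameters of the algorithm: in Phase 1 every node `v` starts `eta * deg v` short walks, a short
walk has length between `lam` and `2 * lam - 1`, and an iteration of Phase 1 is given `slots`
rounds. -/
structure Params where
  eta : ℕ
  lam : ℕ
  slots : ℕ

/-- A walk under construction in Phase 1: ID of its source, desired length, steps made so far. -/
structure Token where
  src : ℕ
  len : ℕ
  cnt : ℕ

/-- The message that forwards a token, with its counter incremented. -/
def Token.msg (t : Token) : Msg := [t.src, t.len, t.cnt + 1]

def Token.ofMsg : Msg → Option Token
  | [a, b, c] => some ⟨a, b, c⟩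
  | _ => none

/-- Memory of a node in Phase 1: the finished short walks that end here, as pairs
(ID of the source, length), and for every neighbour `u` the queue of tokens whose next step
goes to `u`. -/
structure Pool (n : ℕ) where
  stored : List (ℕ × ℕ)
  queue : Fin n → List Token

/-- A token at a node is stored if its walk is complete; otherwise its next step is chosen, a
uniformly random neighbour. -/
def place {n : ℕ} (I : Input n) (pool : Pool n) (t : Token) : Prog n (Pool n) :=
  if t.len ≤ t.cnt then
    return { pool with stored := pool.stored ++ [(t.src, t.len)] }
  else do
    match ← pick I.nbrs with
    | none => return pool
    | some u => return { pool with queue := Function.update pool.queue u (pool.queue u ++ [t]) }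

/-- Create `k` tokens with independent lengths `lam + r`, `r` uniform in `{0, …, lam - 1}`. -/
def launch {n : ℕ} (I : Input n) (P : Params) : ℕ → Pool n → Prog n (Pool n)
  | 0, pool => return pool
  | k + 1, pool => do
      let r ← uniform (P.lam - 1)
      let pool ← place I pool ⟨I.id.val, P.lam + r, 0⟩
      launch I P k pool

/-- For `b` rounds, send the queued tokens, one per edge and round, and collect what arrives. -/
def transmit {n : ℕ} : (b : ℕ) → (Fin n → List Token) → List Token →
    Prog n ((Fin n → List Token) × List Token)
  | 0, q, buf => return (q, buf)
  | b + 1, q, buf => do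
      let inbox ← exchange fun u => (q u).head?.map Token.msg
      transmit b (fun u => (q u).tail)
        (buf ++ (arrivals inbox).filterMap fun a => Token.ofMsg a.2)

/-- One iteration of Phase 1. Tokens that could not be sent within the available rounds keep their
place in the queue (and their chosen neighbour) for the next iteration. -/
def iteration {n : ℕ} (I : Input n) (P : Params) (pool : Pool n) : Prog n (Pool n) := do
  let (q, buf) ← transmit P.slots pool.queue []
  buf.foldlM (place I) { pool with queue := q }

def iterations {n : ℕ} (I : Input n) (P : Params) : ℕ → Pool n → Prog n (Pool n)
  | 0, pool => return pool
  | k + 1, pool => do iterations I P k (← iteration I P pool)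

/-- Blocks of `2 * lam` iterations, until a flooding shows that no node has an unfinished token. The
first argument bounds the number of blocks. -/
def blocks {n : ℕ} (I : Input n) (P : Params) : ℕ → Pool n → Prog n (Pool n)
  | 0, pool => return pool
  | k + 1, pool => do
      let pool ← iterations I P (2 * P.lam) pool
      let busy := (List.finRange n).any fun u => !(pool.queue u).isEmpty
      let h ← flood I.diam 0 (if busy then some ⟨[], 0, none⟩ else none)
      if h.isSome then blocks I P k pool else return pool

/-- Phase 1; the result is the list of the short walks that end at the node. The bound on the number
of blocks is never reached (if `slots > 0`): every block completes at least one of the fewer than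
`2 * lam * eta * n ^ 2` steps of the short walks. -/
def phaseOne {n : ℕ} (I : Input n) (P : Params) : Prog n (List (ℕ × ℕ)) := do
  let pool ← launch I P (P.eta * I.nbrs.length) ⟨[], fun _ => []⟩
  let pool ← blocks I P (2 * P.lam * P.eta * n ^ 2) pool
  return pool.stored

/-- Memory of a node in Phase 2: the unused short walks that end here, the token (the ID of the
source of the long walk) if the node holds it, and the length of the walk completed so far. -/
structure Memory where
  stored : List (ℕ × ℕ)
  token : Option ℕ
  walked : ℕ

/-- A sample out of `count` short walks, namely one with endpoint `owner` and length `len`. -/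
structure Sample where
  owner : ℕ
  len : ℕ
  count : ℕ

def Sample.msg (c : Sample) : Msg := [c.owner, c.len, c.count]

def Sample.ofMsg : Msg → Option Sample
  | [a, b, c] => some ⟨a, b, c⟩
  | _ => none

/-- Choose one of several samples with probability proportional to the counts, and add up the
counts. -/
def merge {n : ℕ} (cs : List Sample) : Prog n (Option Sample) := do
  let c ← pick (cs.flatMap fun c => List.replicate c.count c)
  return c.map fun c => { c with count := (cs.map Sample.count).sum }

/-- The levels `i, i - 1, …, 1` of the tree report, one per round, to their parents. -/
def upSweep {n : ℕ} (level : ℕ) (parent : Option (Fin n)) :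
    (i : ℕ) → List Sample → Prog n (List Sample)
  | 0, cs => return cs
  | i + 1, cs => do
      let c ← if level = i + 1 then merge cs else pure none
      let inbox ← exchange fun u => if parent = some u then c.map Sample.msg else none
      upSweep level parent i (cs ++ (arrivals inbox).filterMap fun a => Sample.ofMsg a.2)

/-- Sample-Destination, called by the node that holds the token. At every node it returns the ID of
the caller, whether an unused short walk of the caller was found, and the new memory: in that case
the walk was extended by the sampled short walk, which is deleted, and the token has moved to the
endpoint of that walk. -/
def sampleDestination {n : ℕ} (I : Input n) (mem : Memory) : Prog n (ℕ × Bool × Memory) := do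
  -- Sweep 1: breadth-first search tree rooted at the caller.
  let tree ← flood I.diam 0 (if mem.token.isSome then some ⟨[I.id.val], 0, none⟩ else none)
  let root := ((tree.map Heard.msg).getD []).headD 0
  let level := (tree.map Heard.level).getD 0
  let parent := tree.bind Heard.parent
  -- Sweep 2: the samples travel up the tree.
  let own := mem.stored.filter fun w => w.1 = root
  let d ← pick own
  let cs ← upSweep level parent I.diam
    (d.map fun w => (⟨I.id.val, w.2, own.length⟩ : Sample)).toList
  let top ← if mem.token.isSome then merge cs else pure none
  -- Sweep 3: the root announces the sample (the empty message if there is none).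
  let news := mem.token.map fun s => match top with
    | some c => (⟨[s, c.owner, c.len], 0, none⟩ : Heard n)
    | none => ⟨[], 0, none⟩
  let h ← flood I.diam 0 news
  match (h.map Heard.msg).getD [] with
  | [s, v, k] =>
      return (root, true,
        { stored := if v = I.id.val then mem.stored.erase (root, k) else mem.stored
          token := if v = I.id.val then some s else none
          walked := mem.walked + k })
  | _ => return (root, false, mem)

/-- Send each of `c` tokens to a random neighbour: how many go to which neighbour. -/
def scatter {n : ℕ} (I : Input n) : ℕ → Prog n (Fin n → ℕ)
  | 0 => return fun _ => 0
  | c + 1 => do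
      let u ← pick I.nbrs
      let f ← scatter I c
      return match u with
        | none => f
        | some u => Function.update f u (f u + 1)

/-- Each of the `c` (identical) tokens at the node makes one step; only the ID of their source and
their number are sent over an edge. Returns the number of tokens that arrive at the node. -/
def stepCounts {n : ℕ} (I : Input n) (root c : ℕ) : Prog n ℕ := do
  let f ← scatter I c
  let inbox ← exchange fun u => if f u = 0 then none else some [root, f u]
  return ((arrivals inbox).map fun a => a.2.getD 1 0).sum

def walkCounts {n : ℕ} (I : Input n) (root : ℕ) : ℕ → ℕ → Prog n ℕ
  | 0, c => return c
  | k + 1, c => do walkCounts I root k (← stepCounts I root c)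

/-- The number of successes in `c` independent trials with success probability `1 / (j + 1)`. -/
def thin {n : ℕ} (j : ℕ) : ℕ → Prog n ℕ
  | 0 => return 0
  | c + 1 => do
      let i ← uniform j
      let k ← thin j c
      return if i = 0 then k + 1 else k

/-- Reservoir sampling: `extend I root lam j` performs the iterations `i = lam - j, …, lam - 1`. In
iteration `i`, every token stops with probability `1 / (lam - i)`, so that its walk has length
`lam + i`, and makes another step otherwise. -/
def extend {n : ℕ} (I : Input n) (root lam : ℕ) :
    (j c : ℕ) → List (ℕ × ℕ) → Prog n (List (ℕ × ℕ))
  | 0, _, stored => return stored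
  | j + 1, c, stored => do
      let k ← thin j c
      let c ← stepCounts I root (c - k)
      extend I root lam j c (stored ++ List.replicate k (root, lam + (lam - (j + 1))))

/-- Get-More-Walks: `⌊ℓ / lam⌋` new short walks from the node `root` that holds the token. -/
def getMoreWalks {n : ℕ} (I : Input n) (P : Params) (root : ℕ) (mem : Memory) :
    Prog n Memory := do
  let c ← walkCounts I root P.lam (if mem.token.isSome then I.len / P.lam else 0)
  let stored ← extend I root P.lam P.lam c mem.stored
  return { mem with stored := stored }

/-- The loop of Phase 2, with (at most) `k` passes. -/
def stitch {n : ℕ} (I : Input n) (P : Params) : (k : ℕ) → Memory → Prog n Memory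
  | 0, mem => return mem
  | k + 1, mem =>
      if mem.walked + 2 * P.lam ≤ I.len then do
        let (root, found, mem) ← sampleDestination I mem
        if found then stitch I P k mem
        else do
          let mem ← getMoreWalks I P root mem
          let (_, _, mem) ← sampleDestination I mem
          stitch I P k mem
      else return mem

/-- `k` steps of the naive walk, in which the token itself is sent from node to node. -/
def naiveWalk {n : ℕ} (I : Input n) : (k : ℕ) → Option ℕ → Prog n (Option ℕ)
  | 0, token => return token
  | k + 1, token => do
      let u ← if token.isSome then pick I.nbrs else pure none
      let inbox ← exchange fun v => if u = some v then token.map fun s => [s] else none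
      naiveWalk I k ((arrivals inbox).head?.bind fun a => a.2.head?)

/-- Result of a node: the destination of the walk outputs the ID of the source (all other nodes
nothing), and the source outputs the ID of the destination (all other nodes nothing). -/
structure Output where
  source : Option ℕ
  destination : Option ℕ

/-- The algorithm Single-Random-Walk as the program of one node. Phase 1 is omitted if the walk is
so short that no short walk will be used. At the end the destination outputs the ID of the source,
and the destination's ID is flooded back to the source. -/
def singleRandomWalk {n : ℕ} (P : Params) (I : Input n) : Prog n Output := do
  -- Phase 1
  let stored ← if I.len < 2 * P.lam then pure [] else phaseOne I P
  -- Phase 2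
  let mem ← stitch I P I.len ⟨stored, if I.isSource then some I.id.val else none, 0⟩
  let token ← naiveWalk I (I.len - mem.walked) mem.token
  -- Report to the source
  let h ← flood (min I.len I.diam) 0 (token.map fun _ => ⟨[I.id.val], 0, none⟩)
  return { source := token
           destination := if I.isSource then h.bind fun h => h.msg.head? else none }

open scoped Classical in
/-- The input of node `v` for a walk of length `ℓ` from `s` on the network `G`. -/
noncomputable def input {n : ℕ} (G : SimpleGraph (Fin n)) (s : Fin n) (ℓ : ℕ) (v : Fin n) :
    Input n where
  id := v
  nbrs := (List.finRange n).filter fun u => G.Adj v u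
  isSource := v = s
  len := ℓ
  diam := G.diam

/-- The law of the configuration after `t` rounds of Single-Random-Walk on the network `G`, with
source `s` and length `ℓ`; the parameters are a function of `n`, `ℓ` and the diameter. -/
noncomputable def runSingleRandomWalk (par : ℕ → ℕ → ℕ → Params) {n : ℕ}
    (G : SimpleGraph (Fin n)) (s : Fin n) (ℓ : ℕ) (t : ℕ) : PMF (Config n Output) :=
  exec G (fun v => singleRandomWalk (par n ℓ G.diam) (input G s ℓ v)) t

/-- The correct results if `v` is the destination of the walk from `s`. -/
def correctResults {n : ℕ} (s v : Fin n) (u : Fin n) : Option Output :=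
  some { source := if u = v then some s.val else none
         destination := if u = s then some v.val else none }

end Congest

open scoped ENNReal

namespace Congest

variable {n : ℕ} {α β γ δ : Type}

section Independent

theorem independent_pure (f : Fin n → β) :
    independent n (fun v => PMF.pure (f v)) = PMF.pure f := by
  induction n with
  | zero =>
    simp only [independent]
    congr 1
    funext i
    exact i.elim0
  | succ n ih =>
    simp only [independent, PMF.pure_bind]
    rw [ih (fun i => f i.succ), PMF.pure_bind]
    congr 1
    exact Fin.cons_self_tail f

theorem independent_update_bind (ν : Fin n → PMF β) (v : Fin n) (q : PMF γ) (r : γ → PMF β)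
    (h : ν v = q.bind r) :
    independent n ν = q.bind fun a => independent n (Function.update ν v (r a)) := by
  induction n with
  | zero => exact v.elim0
  | succ n ih =>
    refine Fin.cases (fun h => ?_) (fun j h => ?_) v h
    · simp only [independent, h, PMF.bind_bind, Function.update_self]
      congr 1
    · simp only [independent]
      have h0 : ∀ a, Function.update ν j.succ (r a) 0 = ν 0 := fun a =>
        Function.update_of_ne (Fin.succ_ne_zero j).symm _ _
      simp only [h0]
      rw [PMF.bind_comm q]
      congr 1
      funext b
      rw [ih (fun i => ν i.succ) j h, PMF.bind_bind]
      congr 1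
      funext a
      congr 2
      funext i
      by_cases hi : i = j
      · subst hi; simp
      · rw [Function.update_of_ne hi, Function.update_of_ne (fun h => hi (Fin.succ_injective _ h))]

theorem mem_support_independent {ν : Fin n → PMF β} {f : Fin n → β}
    (h : f ∈ (independent n ν).support) (v : Fin n) : f v ∈ (ν v).support := by
  induction n with
  | zero => exact v.elim0
  | succ n ih =>
    simp only [independent, PMF.mem_support_bind_iff, PMF.mem_support_pure_iff] at h
    obtain ⟨b, hb, g, hg, rfl⟩ := h
    refine Fin.cases ?_ (fun j => ?_) v
    · simpa using hb
    · simpa using ih hg j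

theorem independent_map_apply (ν : Fin n → PMF β) (v : Fin n) :
    (independent n ν).map (fun f => f v) = ν v := by
  induction n with
  | zero => exact v.elim0
  | succ n ih =>
    refine Fin.cases ?_ (fun j => ?_) v
    · simp [independent, PMF.map_bind, PMF.pure_map]
    · simp only [independent, PMF.map_bind, PMF.pure_map, Fin.cons_succ]
      rw [PMF.bind_const]
      exact ih (fun i => ν i.succ) j

end Independent

section Local

/-- `Local p ν`: the program `p` is a local computation (it does not communicate), and `ν` is the
law of its result. -/
inductive Local : Prog n α → PMF α → Prop
  | ret (a : α) : Local (.ret a) (PMF.pure a)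
  | draw (k : ℕ) (f : Fin (k + 1) → Prog n α) (μ : Fin (k + 1) → PMF α)
      (h : ∀ i, Local (f i) (μ i)) :
      Local (.draw k f) ((PMF.uniformOfFintype (Fin (k + 1))).bind μ)

theorem Local.congr {p : Prog n α} {ν ν' : PMF α} (h : Local p ν) (e : ν = ν') : Local p ν' :=
  e ▸ h

theorem Local.pure (a : α) : Local (Pure.pure a : Prog n α) (PMF.pure a) := Local.ret a

theorem Local.bind {p : Prog n α} {ν : PMF α} {g : α → Prog n β} {ρ : α → PMF β}
    (h : Local p ν) (hg : ∀ a, Local (g a) (ρ a)) : Local (p >>= g) (ν.bind ρ) := by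
  change Local (p.bind g) _
  induction h with
  | ret a => simpa [Prog.bind] using hg a
  | draw k f μ h ih =>
    rw [PMF.bind_bind]
    exact Local.draw k _ _ ih

theorem Local.uniform (k : ℕ) : Local (Congest.uniform k : Prog n ℕ)
    ((PMF.uniformOfFintype (Fin (k + 1))).map Fin.val) :=
  Local.draw k _ _ fun i => Local.ret i.val

end Local

section Runs

variable (G : SimpleGraph (Fin n)) (b : ℕ)

open scoped Classical in
/-- What arrives at each node if node `u` sends `out u v` to `v`. -/
noncomputable def deliver (out : Fin n → Fin n → Option Msg) (v u : Fin n) : Option Msg :=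
  if G.Adj u v then out u v else none

/-- `Runs G b p μ`: if node `v` runs `p v`, then all nodes halt in the same round, messages have at
most `b` bits, and `μ` is the joint law of the number of rounds and of the results. -/
inductive Runs : (Fin n → Prog n α) → PMF (ℕ × (Fin n → α)) → Prop
  | ret (r : Fin n → α) : Runs (fun v => .ret (r v)) (PMF.pure (0, r))
  | draw {p : Fin n → Prog n α} (v : Fin n) (k : ℕ) (f : Fin (k + 1) → Prog n α)
      (hp : p v = .draw k f) (μ : Fin (k + 1) → PMF (ℕ × (Fin n → α)))
      (h : ∀ i, Runs (Function.update p v (f i)) (μ i)) :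
      Runs p ((PMF.uniformOfFintype (Fin (k + 1))).bind μ)
  | comm (out : Fin n → Fin n → Option Msg) (f : Fin n → (Fin n → Option Msg) → Prog n α)
      (hb : ∀ u v m, out u v = some m → msgBits m ≤ b) (μ : PMF (ℕ × (Fin n → α)))
      (h : Runs (fun v => f v (deliver G out v)) μ) :
      Runs (fun v => .comm (out v) (f v)) (μ.map fun x => (x.1 + 1, x.2))

variable {G b}

theorem Runs.congr {p : Fin n → Prog n α} {μ μ' : PMF (ℕ × (Fin n → α))} (h : Runs G b p μ)
    (e : μ = μ') : Runs G b p μ' := e ▸ h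

/-- The law of a sequential composition. -/
noncomputable def seqLaw (μ : PMF (ℕ × α)) (ν : α → PMF (ℕ × β)) : PMF (ℕ × β) :=
  μ.bind fun x => (ν x.2).map fun y => (x.1 + y.1, y.2)

theorem seqLaw_pure (t : ℕ) (a : α) (ν : α → PMF (ℕ × β)) :
    seqLaw (PMF.pure (t, a)) ν = (ν a).map fun y => (t + y.1, y.2) := by
  simp [seqLaw]

theorem Runs.bind {p : Fin n → Prog n α} {μ : PMF (ℕ × (Fin n → α))}
    {k : Fin n → α → Prog n β} {ν : (Fin n → α) → PMF (ℕ × (Fin n → β))} (h : Runs G b p μ)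
    (hk : ∀ x ∈ μ.support, Runs G b (fun v => k v (x.2 v)) (ν x.2)) :
    Runs G b (fun v => p v >>= k v) (seqLaw μ ν) := by
  change Runs G b (fun v => (p v).bind (k v)) _
  induction h with
  | ret r => 
    simp only [Prog.bind]
    refine (hk (0, r) (by simp)).congr ?_
    simp only [seqLaw, PMF.pure_bind, zero_add]
    exact (PMF.map_id _).symm
  | @draw p v c f hp μ h ih =>
    have := Runs.draw (G := G) (b := b) (p := fun w => (p w).bind (k w)) v c
      (fun i => (f i).bind (k v)) (by simp [hp, Prog.bind]) (fun i => seqLaw (μ i) ν) (fun i => ?_)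
    · refine this.congr ?_
      simp [seqLaw, PMF.bind_bind]
    · refine Eq.subst (motive := fun q => Runs G b q _) ?_ (ih i fun x hx => hk x ?_)
      · funext w
        by_cases hw : w = v
        · subst hw; simp
        · simp [Function.update_of_ne hw]
      · rw [PMF.mem_support_bind_iff]
        exact ⟨i, by simp, hx⟩
  | comm out f hb μ h ih =>
    simp only [Prog.bind]
    refine (Runs.comm out (fun v m => (f v m).bind (k v)) hb _ (ih fun x hx => ?_)).congr ?_
    · exact hk (x.1 + 1, x.2) (by
        rw [PMF.mem_support_map_iff]; exact ⟨x, hx, rfl⟩)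
    · simp only [seqLaw, PMF.map_bind, PMF.bind_map, PMF.map_comp, Function.comp_def]
      congr 1; funext x; congr 1; funext y
      simp only [Prod.mk.injEq, and_true]; omega

theorem Runs.exchange (out : Fin n → Fin n → Option Msg)
    (hb : ∀ u v m, out u v = some m → msgBits m ≤ b) :
    Runs G b (fun v => Congest.exchange (out v)) (PMF.pure (1, deliver G out)) := by
  refine (Runs.comm out (fun _ => .ret) hb _ (Runs.ret _)).congr ?_
  simp [PMF.pure_map]

/-- A local computation of a single node. -/
theorem Runs.node {p : Fin n → Prog n α} (v : Fin n) {l : Prog n β} {ν : PMF β} (hl : Local l ν)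
    {g : β → Prog n α} (hp : p v = l.bind g) {μ : β → PMF (ℕ × (Fin n → α))}
    (h : ∀ a ∈ ν.support, Runs G b (Function.update p v (g a)) (μ a)) : Runs G b p (ν.bind μ) := by
  induction hl generalizing p with
  | ret a =>
    have := h a (by simp)
    rw [PMF.pure_bind]
    rwa [show Function.update p v (g a) = p by rw [Function.update_eq_self_iff]; exact hp.symm] at this
  | draw k f ρ hf ih =>
    rw [PMF.bind_bind]
    refine Runs.draw v k (fun i => (f i).bind g) hp _ fun i => ih i (by simp) fun a ha => ?_
    rw [Function.update_idem]
    exact h a (by rw [PMF.mem_support_bind_iff]; exact ⟨i, by simp, ha⟩)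

theorem Runs.local {p : Fin n → Prog n α} {ν : Fin n → PMF α} (h : ∀ v, Local (p v) (ν v)) :
    Runs G b p ((independent n ν).map fun r => (0, r)) := by
  have key : ∀ (s : Finset (Fin n)) (p : Fin n → Prog n α) (ν : Fin n → PMF α),
      (∀ v, Local (p v) (ν v)) → (∀ v ∉ s, ∃ a, p v = .ret a) →
      Runs G b p ((independent n ν).map fun r => (0, r)) := by
    intro s
    induction s using Finset.induction_on with
    | empty =>
      intro p ν h hs
      choose r hr using fun v => hs v (by simp)
      obtain rfl : p = fun v => .ret (r v) := funext hr
      have : ν = fun v => PMF.pure (r v) := by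
        funext v
        have := h v
        generalize hν : ν v = x at this
        cases this
        rfl
      rw [this, independent_pure, PMF.pure_map]
      exact Runs.ret r
    | insert v s hv ih =>
      intro p ν h hs
      rw [independent_update_bind ν v (ν v) PMF.pure (PMF.bind_pure _).symm, PMF.map_bind]
      refine Runs.node v (h v) (g := .ret) ?_ fun a _ => ?_
      · have : ∀ q : Prog n α, q.bind .ret = q := by
          intro q
          induction q with
          | ret a => rfl
          | draw k f ih => simp [Prog.bind, ih]
          | comm out f ih => simp [Prog.bind, ih]
        exact (this _).symm
      · refine ih _ _ (fun w => ?_) (fun w hw => ?_)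
        · by_cases hw : w = v
          · subst hw; simpa using Local.ret a
          · simpa [Function.update_of_ne hw] using h w
        · by_cases hw' : w = v
          · subst hw'; exact ⟨a, by simp⟩
          · simpa [Function.update_of_ne hw'] using hs w (by simp [hw, hw'])
  exact key Finset.univ p ν h (by simp)

end Runs

section Soundness

variable {G : SimpleGraph (Fin n)} {b : ℕ}

/-- The law of the configuration after `t` rounds, from the (not yet settled) programs `p`, if the
longest message so far had `β` bits. -/
noncomputable def execFrom (G : SimpleGraph (Fin n)) (p : Fin n → Prog n α) (β : ℕ) :
    ℕ → PMF (Config n α)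
  | 0 => (independent n fun v => (p v).settle).map fun p => ⟨p, β⟩
  | t + 1 => (execFrom G p β t).bind (Config.round G)

theorem exec_eq_execFrom (p : Fin n → Prog n α) (t : ℕ) : exec G p t = execFrom G p 0 t := by
  induction t with
  | zero => rfl
  | succ t ih => simp only [exec, execFrom, ih]

theorem execFrom_draw {p : Fin n → Prog n α} {v : Fin n} {k : ℕ} {f : Fin (k + 1) → Prog n α}
    (hp : p v = .draw k f) (β t : ℕ) :
    execFrom G p β t = (PMF.uniformOfFintype (Fin (k + 1))).bind
      fun i => execFrom G (Function.update p v (f i)) β t := by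
  induction t with
  | zero =>
    simp only [execFrom]
    rw [independent_update_bind _ v (PMF.uniformOfFintype (Fin (k + 1))) (fun i => (f i).settle)
      (by simp [hp, Prog.settle]), PMF.map_bind]
    congr 1; funext i; congr 2; funext w
    by_cases hw : w = v
    · subst hw; simp
    · simp [Function.update_of_ne hw]
  | succ t ih => simp only [execFrom, ih, PMF.bind_bind]

theorem execFrom_ret (r : Fin n → α) (β t : ℕ) :
    execFrom G (fun v => .ret (r v)) β t = PMF.pure ⟨fun v => .ret (r v), β⟩ := by
  induction t with
  | zero => simp only [execFrom, Prog.settle, independent_pure, PMF.pure_map]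
  | succ t ih =>
    simp only [execFrom, ih, PMF.pure_bind, Config.round, Prog.receive, Prog.settle,
      independent_pure, PMF.pure_map]
    congr 2
    simp [Config.inbox, Prog.send]

theorem execFrom_comm (out : Fin n → Fin n → Option Msg)
    (f : Fin n → (Fin n → Option Msg) → Prog n α)
    (hb : ∀ u v m, out u v = some m → msgBits m ≤ b) (β : ℕ) (hβ : β ≤ b) :
    ∃ β' ≤ b, ∀ t, execFrom G (fun v => .comm (out v) (f v)) β (t + 1) =
      execFrom G (fun v => f v (deliver G out v)) β' t := by
  set c : Config n α := ⟨fun v => .comm (out v) (f v), β⟩ with hc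
  have hin : ∀ v, c.inbox G v = deliver G out v := fun v => by
    funext u
    simp [Config.inbox, deliver, hc, Prog.send]
  refine ⟨max c.bits <| Finset.univ.sup fun v => Finset.univ.sup fun u =>
        ((c.inbox G v u).map msgBits).getD 0, ?_, fun t => ?_⟩
  · refine max_le hβ (Finset.sup_le fun v _ => Finset.sup_le fun u _ => ?_)
    rw [hin]
    unfold deliver
    split_ifs with h
    · cases ho : out u v with
      | none => simp
      | some m => simpa using hb u v m ho
    · simp
  · induction t with
    | zero =>
      simp only [execFrom, Prog.settle, independent_pure, PMF.pure_map, PMF.pure_bind]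
      rw [Config.round]
      simp only [hin]
      rfl
    | succ t ih => rw [execFrom, ih, execFrom]

theorem Runs.bits_le {p : Fin n → Prog n α} {μ : PMF (ℕ × (Fin n → α))} (h : Runs G b p μ) :
    ∀ β ≤ b, ∀ t, ∀ c ∈ (execFrom G p β t).support, c.bits ≤ b := by
  induction h with
  | ret r =>
    intro β hβ t c hc
    rw [execFrom_ret] at hc
    simp only [PMF.support_pure, Set.mem_singleton_iff] at hc
    rw [hc]; exact hβ
  | draw v k f hp μ h ih =>
    intro β hβ t c hc
    rw [execFrom_draw hp, PMF.mem_support_bind_iff] at hc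
    obtain ⟨i, -, hi⟩ := hc
    exact ih i β hβ t c hi
  | comm out f hb μ h ih =>
    intro β hβ t c hc
    obtain ⟨β', hβ', H⟩ := execFrom_comm (G := G) out f hb β hβ
    cases t with
    | zero =>
      simp only [execFrom, Prog.settle, independent_pure, PMF.pure_map, PMF.support_pure,
        Set.mem_singleton_iff] at hc
      rw [hc]; exact hβ
    | succ t =>
      rw [H] at hc
      exact ih β' hβ' t c hc

theorem Runs.map_results {p : Fin n → Prog n α} {μ : PMF (ℕ × (Fin n → α))} (h : Runs G b p μ) :
    ∀ β ≤ b, ∀ T, (∀ x ∈ μ.support, x.1 ≤ T) →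
      (execFrom G p β T).map Config.results = μ.map fun x v => some (x.2 v) := by
  induction h with
  | ret r =>
    intro β hβ T hT
    rw [execFrom_ret, PMF.pure_map, PMF.pure_map]
    rfl
  | draw v k f hp μ h ih =>
    intro β hβ T hT
    rw [execFrom_draw hp, PMF.map_bind, PMF.map_bind]
    congr 1; funext i
    refine ih i β hβ T fun x hx => hT x ?_
    rw [PMF.mem_support_bind_iff]; exact ⟨i, by simp, hx⟩
  | comm out f hb μ h ih =>
    intro β hβ T hT
    obtain ⟨β', hβ', H⟩ := execFrom_comm (G := G) out f hb β hβ
    have hT' : ∀ x ∈ μ.support, x.1 + 1 ≤ T := fun x hx =>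
      hT (x.1 + 1, x.2) (by rw [PMF.mem_support_map_iff]; exact ⟨x, hx, rfl⟩)
    cases T with
    | zero =>
      obtain ⟨x, hx⟩ := μ.support_nonempty
      exact absurd (hT' x hx) (by omega)
    | succ T =>
      rw [H, ih β' hβ' T fun x hx => by have := hT' x hx; omega, PMF.map_comp]
      rfl

theorem Runs.halted_le {p : Fin n → Prog n α} {μ : PMF (ℕ × (Fin n → α))} (h : Runs G b p μ) :
    ∀ β ≤ b, ∀ t, μ.toOuterMeasure {x | x.1 ≤ t} ≤
      (execFrom G p β t).toOuterMeasure {c | c.Halted} := by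
  induction h with
  | ret r =>
    intro β hβ t
    rw [execFrom_ret]
    have h : (⟨fun v => .ret (r v), β⟩ : Config n α) ∈ {c : Config n α | c.Halted} := fun v => by
      simp [Prog.result]
    rw [PMF.toOuterMeasure_pure_apply, PMF.toOuterMeasure_pure_apply, if_pos h]
    split_ifs <;> simp
  | draw v k f hp μ h ih =>
    intro β hβ t
    rw [execFrom_draw hp, PMF.toOuterMeasure_bind_apply, PMF.toOuterMeasure_bind_apply]
    exact ENNReal.tsum_le_tsum fun i => mul_le_mul_right (ih i β hβ t) _
  | comm out f hb μ h ih =>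
    intro β hβ t
    obtain ⟨β', hβ', H⟩ := execFrom_comm (G := G) out f hb β hβ
    rw [PMF.toOuterMeasure_map_apply]
    cases t with
    | zero => simp
    | succ t =>
      rw [H]
      simpa using ih β' hβ' t

end Soundness

section Expect

/-- Expectation of a nonnegative function. -/
noncomputable def expect (p : PMF α) (f : α → ℝ≥0∞) : ℝ≥0∞ := ∑' a, p a * f a

theorem expect_pure (a : α) (f : α → ℝ≥0∞) : expect (PMF.pure a) f = f a := by
  classical
  rw [expect, tsum_eq_single a (fun b hb => by simp [PMF.pure_apply, hb])]
  simp

theorem expect_bind (p : PMF α) (q : α → PMF β) (f : β → ℝ≥0∞) :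
    expect (p.bind q) f = expect p fun a => expect (q a) f := by
  simp only [expect, PMF.bind_apply, ← ENNReal.tsum_mul_left, ← ENNReal.tsum_mul_right]
  rw [ENNReal.tsum_comm]
  simp only [mul_assoc]

theorem expect_map (p : PMF α) (g : α → β) (f : β → ℝ≥0∞) :
    expect (p.map g) f = expect p fun a => f (g a) := by
  simp only [PMF.map, expect_bind, Function.comp_def, expect_pure]

theorem expect_mono {p : PMF α} {f g : α → ℝ≥0∞} (h : ∀ a ∈ p.support, f a ≤ g a) :
    expect p f ≤ expect p g := by
  refine ENNReal.tsum_le_tsum fun a => ?_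
  by_cases ha : a ∈ p.support
  · exact mul_le_mul_right (h a ha) _
  · simp [(PMF.apply_eq_zero_iff p a).2 ha]

theorem expect_congr {p : PMF α} {f g : α → ℝ≥0∞} (h : ∀ a ∈ p.support, f a = g a) :
    expect p f = expect p g :=
  le_antisymm (expect_mono fun a ha => (h a ha).le) (expect_mono fun a ha => (h a ha).ge)

theorem expect_const (p : PMF α) (c : ℝ≥0∞) : expect p (fun _ => c) = c := by
  rw [expect, ENNReal.tsum_mul_right, PMF.tsum_coe, one_mul]

theorem expect_add (p : PMF α) (f g : α → ℝ≥0∞) :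
    expect p (fun a => f a + g a) = expect p f + expect p g := by
  simp only [expect, mul_add, ENNReal.tsum_add]

theorem expect_mul_left (p : PMF α) (c : ℝ≥0∞) (f : α → ℝ≥0∞) :
    expect p (fun a => c * f a) = c * expect p f := by
  simp only [expect, ← ENNReal.tsum_mul_left]
  congr 1; funext a; ring

theorem expect_sum {ι : Type*} (p : PMF α) (s : Finset ι) (f : ι → α → ℝ≥0∞) :
    expect p (fun a => ∑ i ∈ s, f i a) = ∑ i ∈ s, expect p (f i) := by
  classical
  induction s using Finset.induction_on with
  | empty => simpa using expect_const p 0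
  | insert i s hi ih => simp only [Finset.sum_insert hi, expect_add, ih]

open scoped Classical in
theorem toOuterMeasure_eq_expect (p : PMF α) (s : Set α) :
    p.toOuterMeasure s = expect p fun a => if a ∈ s then 1 else 0 := by
  rw [PMF.toOuterMeasure_apply, expect]
  congr 1; funext a
  simp [Set.indicator_apply]

open scoped Classical in
theorem ext_of_expect {p q : PMF α} (h : ∀ f, expect p f = expect q f) : p = q := by
  ext a
  have := h fun b => if b = a then 1 else 0
  simpa [expect] using this

theorem expect_uniformOfFintype [Fintype α] [Nonempty α] (f : α → ℝ≥0∞) :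
    expect (PMF.uniformOfFintype α) f = (∑ a, f a) / Fintype.card α := by
  rw [expect, tsum_fintype]
  simp only [PMF.uniformOfFintype_apply, ← Finset.mul_sum]
  rw [mul_comm, div_eq_mul_inv]

theorem expect_uniformOfFinset (s : Finset α) (hs : s.Nonempty) (f : α → ℝ≥0∞) :
    expect (PMF.uniformOfFinset s hs) f = (∑ a ∈ s, f a) / s.card := by
  classical
  rw [expect, tsum_eq_sum (s := s) (fun a ha => by
    rw [PMF.uniformOfFinset_apply_of_notMem hs ha, zero_mul])]
  rw [Finset.sum_congr rfl fun a ha => by rw [PMF.uniformOfFinset_apply_of_mem hs ha],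
    ← Finset.mul_sum, mul_comm, div_eq_mul_inv]

theorem expect_ofMultiset (S : Multiset α) (hS : S ≠ 0) (f : α → ℝ≥0∞) :
    expect (PMF.ofMultiset S hS) f = (S.map f).sum / S.card := by
  classical
  rw [expect, tsum_eq_sum (s := S.toFinset) (fun a ha => by
    rw [PMF.ofMultiset_apply_of_notMem hS (by simpa using ha), zero_mul])]
  simp only [PMF.ofMultiset_apply, div_eq_mul_inv]
  rw [Finset.sum_multiset_map_count, Finset.sum_mul]
  refine Finset.sum_congr rfl fun a _ => ?_
  rw [nsmul_eq_mul]; ring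

theorem expect_eq_zero {p : PMF α} {f : α → ℝ≥0∞} (h : ∀ a ∈ p.support, f a = 0) :
    expect p f = 0 := (expect_congr h).trans (expect_const p 0)

end Expect

section Convolution

variable {M : Type} [AddCommMonoid M]

/-- Laws on a commutative monoid form a commutative monoid under convolution. -/
noncomputable instance convolution : CommMonoid (PMF M) where
  mul p q := p.bind fun a => q.map fun b => a + b
  one := PMF.pure 0
  mul_assoc p q r := by
    change PMF.bind (PMF.bind p fun a => q.map fun b => a + b) (fun a => r.map fun b => a + b) =
      p.bind fun a => (q.bind fun a => r.map fun b => a + b).map fun b => a + b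
    simp only [PMF.bind_bind, PMF.map_bind, PMF.map_comp, PMF.bind_map, Function.comp_def, add_assoc]
  one_mul p := by
    change PMF.bind (PMF.pure 0) (fun a => p.map fun b => a + b) = p
    simp only [PMF.pure_bind, zero_add]
    exact PMF.map_id p
  mul_one p := by
    change PMF.bind p (fun a => (PMF.pure 0).map fun b => a + b) = p
    simp only [PMF.pure_map, add_zero, PMF.bind_pure]
  mul_comm p q := by
    change PMF.bind p (fun a => q.map fun b => a + b) = PMF.bind q fun a => p.map fun b => a + b
    simp only [PMF.map, Function.comp_def]
    rw [PMF.bind_comm]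
    simp only [add_comm]

theorem conv_def (p q : PMF M) : p * q = p.bind fun a => q.map fun b => a + b := rfl

theorem conv_one : (1 : PMF M) = PMF.pure 0 := rfl

theorem conv_pure (a b : M) : PMF.pure a * PMF.pure b = PMF.pure (a + b) := by
  simp [conv_def, PMF.pure_map]

theorem conv_bind_left (p : PMF α) (F : α → PMF M) (q : PMF M) :
    p.bind F * q = p.bind fun a => F a * q := by
  simp only [conv_def, PMF.bind_bind]

theorem conv_bind_right (p : PMF α) (F : α → PMF M) (q : PMF M) :
    q * p.bind F = p.bind fun a => q * F a := by
  rw [mul_comm, conv_bind_left]; simp only [mul_comm]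

theorem conv_bind (p q : PMF M) (f : M → PMF β) :
    (p * q).bind f = p.bind fun a => q.bind fun b => f (a + b) := by
  simp only [conv_def, PMF.bind_bind, PMF.bind_map, Function.comp_def]

theorem expect_conv (p q : PMF M) (f : M → ℝ≥0∞) :
    expect (p * q) f = expect p fun a => expect q fun b => f (a + b) := by
  simp only [conv_def, expect_bind, expect_map]

theorem conv_prod_pure {ι : Type*} (s : Finset ι) (f : ι → M) :
    ∏ i ∈ s, PMF.pure (f i) = PMF.pure (∑ i ∈ s, f i) := by
  classical
  induction s using Finset.induction_on with
  | empty => simp [conv_one]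
  | insert i s hi ih => rw [Finset.prod_insert hi, Finset.sum_insert hi, ih, conv_pure]

theorem conv_list_prod_pure (l : List α) (f : α → M) :
    (l.map fun a => PMF.pure (f a)).prod = PMF.pure (l.map f).sum := by
  induction l with
  | nil => simp [conv_one]
  | cons a l ih => simp only [List.map_cons, List.prod_cons, List.sum_cons, ih, conv_pure]

theorem independent_bind_prod (ν : Fin n → PMF β) (F : Fin n → β → PMF M) :
    ((independent n ν).bind fun σ => ∏ v, F v (σ v)) = ∏ v, (ν v).bind (F v) := by
  induction n with
  | zero => simp [independent]
  | succ n ih =>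
    simp only [independent, PMF.bind_bind, PMF.pure_bind, Fin.prod_univ_succ, Fin.cons_zero,
      Fin.cons_succ]
    rw [← ih (fun i => ν i.succ) (fun i => F i.succ), conv_bind_left]
    simp only [conv_bind_right]

/-- A multiplicative function on the monoid gives a multiplicative expectation. -/
noncomputable def expectHom (f : Multiplicative M →* ℝ≥0∞) : PMF M →* ℝ≥0∞ where
  toFun p := expect p fun a => f (Multiplicative.ofAdd a)
  map_one' := by rw [conv_one, expect_pure]; exact f.map_one
  map_mul' p q := by
    rw [expect_conv]
    simp only [ofAdd_add, map_mul, expect_mul_left]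
    simp only [mul_comm _ (expect q _), expect_mul_left]

end Convolution

section RandomWalk

variable {G : SimpleGraph (Fin n)}

theorem srw_succ' (x : Fin n) (k : ℕ) : G.srw x (k + 1) = (G.srwStep x).bind fun y => G.srw y k := by
  induction k with
  | zero => simp [SimpleGraph.srw]
  | succ k ih =>
    rw [SimpleGraph.srw, ih, PMF.bind_bind]
    rfl

theorem srw_add (x : Fin n) (j k : ℕ) : G.srw x (j + k) = (G.srw x j).bind fun y => G.srw y k := by
  induction k with
  | zero => simp [SimpleGraph.srw]
  | succ k ih =>
    rw [← add_assoc, SimpleGraph.srw, ih, PMF.bind_bind]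
    rfl

/-- The law of `pick`. -/
theorem local_pick (l : List β) (hl : (l : Multiset β) ≠ 0) :
    Local (pick l : Prog n (Option β)) ((PMF.ofMultiset (l : Multiset β) hl).map some) := by
  cases l with
  | nil => simp at hl
  | cons a l =>
    refine (Local.draw l.length _ _ fun i => Local.ret _).congr ?_
    refine ext_of_expect fun f => ?_
    rw [expect_bind, expect_map, expect_ofMultiset, expect_uniformOfFintype]
    simp only [expect_pure, Fintype.card_fin, Multiset.coe_card, List.length_cons,
      Multiset.map_coe, Multiset.sum_coe]
    congr 1
    exact Fin.sum_univ_fun_getElem (a :: l) (fun x => f (some x))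

theorem local_pick_nil : Local (pick [] : Prog n (Option β)) (PMF.pure none) := Local.ret _

open scoped Classical in
theorem local_pick_nbrs {s : Fin n} {ℓ : ℕ} {v : Fin n} (hv : ∃ u, G.Adj v u) :
    Local (pick (input G s ℓ v).nbrs : Prog n (Option (Fin n))) ((G.srwStep v).map some) := by
  have hne : (G.neighborFinset v).Nonempty := by
    obtain ⟨u, hu⟩ := hv
    exact ⟨u, by simpa using hu⟩
  have hnd : (input G s ℓ v).nbrs.Nodup := (List.nodup_finRange n).filter _
  have hset : (input G s ℓ v).nbrs.toFinset = G.neighborFinset v := by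
    ext u; simp [input]
  refine (local_pick _ ?_).congr ?_
  · intro h
    obtain ⟨u, hu⟩ := hne
    rw [← hset] at hu
    simp [(Multiset.coe_eq_zero _).1 h] at hu
  · congr 1
    refine ext_of_expect fun f => ?_
    rw [expect_ofMultiset, SimpleGraph.srwStep, dif_pos hne, expect_uniformOfFinset, ← hset,
      List.sum_toFinset _ hnd, List.toFinset_card_of_nodup hnd]
    simp

theorem mem_support_srwStep {v u : Fin n} (hv : ∃ u, G.Adj v u) (h : u ∈ (G.srwStep v).support) :
    G.Adj v u := by
  classical
  have hne : (G.neighborFinset v).Nonempty := by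
    obtain ⟨u, hu⟩ := hv
    exact ⟨u, by simpa using hu⟩
  rw [SimpleGraph.srwStep, dif_pos hne, PMF.mem_support_uniformOfFinset_iff] at h
  simpa using h

end RandomWalk

variable {G : SimpleGraph (Fin n)} {b : ℕ}

section Sequencing

theorem Runs.bind_const {p : Fin n → Prog n α} {k : Fin n → α → Prog n β} {t : ℕ} {r : Fin n → α}
    {ν : PMF (ℕ × (Fin n → β))} (h : Runs G b p (PMF.pure (t, r)))
    (hk : Runs G b (fun v => k v (r v)) ν) :
    Runs G b (fun v => p v >>= k v) (ν.map fun y => (t + y.1, y.2)) := by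
  refine (h.bind (ν := fun _ => ν) fun x hx => ?_).congr (seqLaw_pure _ _ _)
  simp only [PMF.support_pure, Set.mem_singleton_iff] at hx
  rw [hx]; exact hk

theorem Runs.bind_local {p : Fin n → Prog n α} {k : Fin n → α → Prog n β} {ν : Fin n → PMF α}
    {μ : (Fin n → α) → PMF (ℕ × (Fin n → β))} (h : ∀ v, Local (p v) (ν v))
    (hk : ∀ r ∈ (independent n ν).support, Runs G b (fun v => k v (r v)) (μ r)) :
    Runs G b (fun v => p v >>= k v) ((independent n ν).bind μ) := by
  refine ((Runs.local h).bind (ν := μ) fun x hx => ?_).congr ?_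
  · rw [PMF.mem_support_map_iff] at hx
    obtain ⟨r, hr, rfl⟩ := hx
    exact hk r hr
  · simp only [seqLaw, PMF.bind_map, Function.comp_def, zero_add]
    congr 1; funext r
    exact PMF.map_id _

/-- Prefixing a fixed number of rounds. -/
theorem Runs.bind_time {p : Fin n → Prog n α} {k : Fin n → α → Prog n β} {t t' : ℕ}
    {ν : PMF (Fin n → α)} {μ : (Fin n → α) → PMF (Fin n → β)}
    (h : Runs G b p (ν.map fun r => (t, r)))
    (hk : ∀ r ∈ ν.support, Runs G b (fun v => k v (r v)) ((μ r).map fun r => (t', r))) :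
    Runs G b (fun v => p v >>= k v) ((ν.bind μ).map fun r => (t + t', r)) := by
  refine (h.bind (ν := fun r => (μ r).map fun r => (t', r)) fun x hx => ?_).congr ?_
  · rw [PMF.mem_support_map_iff] at hx
    obtain ⟨r, hr, rfl⟩ := hx
    exact hk r hr
  · simp only [seqLaw, PMF.bind_map, PMF.map_bind, PMF.map_comp, Function.comp_def]

theorem Runs.time_pure {p : Fin n → Prog n α} {t : ℕ} {r : Fin n → α}
    (h : Runs G b p (PMF.pure (t, r))) : Runs G b p ((PMF.pure r).map fun r => (t, r)) := by
  rwa [PMF.pure_map]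

end Sequencing

section Arrivals

theorem mem_arrivals {inbox : Fin n → Option Msg} {u : Fin n} {m : Msg} :
    (u, m) ∈ arrivals inbox ↔ inbox u = some m := by
  simp only [arrivals, List.mem_filterMap, List.mem_finRange, true_and, Option.map_eq_some_iff,
    Prod.mk.injEq]
  constructor
  · rintro ⟨a, m', h, rfl, rfl⟩; exact h
  · intro h; exact ⟨u, m, h, rfl, rfl⟩

theorem arrivals_head?_eq_none {inbox : Fin n → Option Msg} (h : ∀ u, inbox u = none) :
    (arrivals inbox).head? = none := by
  simp [arrivals, h]

theorem arrivals_head?_of_some {inbox : Fin n → Option Msg} {u : Fin n} {m : Msg}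
    (h : inbox u = some m) : ∃ a, (arrivals inbox).head? = some a ∧ inbox a.1 = some a.2 := by
  have hm := mem_arrivals.2 h
  cases ha : arrivals inbox with
  | nil => simp [ha] at hm
  | cons a l =>
    refine ⟨a, rfl, ?_⟩
    have : (a.1, a.2) ∈ arrivals inbox := by simp [ha]
    exact mem_arrivals.1 this

theorem deliver_eq_some {out : Fin n → Fin n → Option Msg} {v u : Fin n} {m : Msg} :
    deliver G out v u = some m ↔ G.Adj u v ∧ out u v = some m := by
  unfold deliver
  split_ifs with h <;> simp [h]

theorem deliver_of_adj {out : Fin n → Fin n → Option Msg} {v u : Fin n} (h : G.Adj u v) :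
    deliver G out v u = out u v := if_pos h

end Arrivals

section Flood

theorem exists_adj_dist_add_one (hG : G.Connected) {u v : Fin n} (h : u ≠ v) :
    ∃ w, G.Adj w v ∧ G.dist u w + 1 = G.dist u v := by
  obtain ⟨p, hp⟩ := hG.exists_walk_length_eq_dist v u
  cases p with
  | nil => exact absurd rfl h
  | @cons _ w _ hvw p =>
    refine ⟨w, hvw.symm, ?_⟩
    rw [SimpleGraph.Walk.length_cons] at hp
    have h1 := SimpleGraph.dist_le p
    have h2 := hG.dist_triangle (u := u) (v := w) (w := v)
    rw [SimpleGraph.dist_eq_one_iff_adj.2 hvw.symm] at h2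
    rw [G.dist_comm (u := w)] at h1
    rw [G.dist_comm (u := v)] at hp
    omega

theorem dist_le_diam' (hG : G.Connected) (u v : Fin n) : G.dist u v ≤ G.diam :=
  haveI : Nonempty (Fin n) := ⟨u⟩
  SimpleGraph.dist_le_diam (SimpleGraph.connected_iff_ediam_ne_top.1 hG)

theorem dist_le_add_one (hG : G.Connected) {r u v : Fin n} (h : G.Adj u v) :
    G.dist r v ≤ G.dist r u + 1 := by
  have h2 := hG.dist_triangle (u := r) (v := u) (w := v)
  rwa [SimpleGraph.dist_eq_one_iff_adj.2 h] at h2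

/-- What the nodes know after `i` rounds of flooding the message `m` from `root`. -/
def FloodState (G : SimpleGraph (Fin n)) (root : Fin n) (m : Msg) (i : ℕ)
    (h : Fin n → Option (Heard n)) : Prop :=
  ∀ v, (G.dist root v ≤ i → ∃ parent, h v = some ⟨m, G.dist root v, parent⟩ ∧
    (v ≠ root → ∃ u, parent = some u ∧ G.Adj u v ∧ G.dist root u + 1 = G.dist root v)) ∧
    (i < G.dist root v → h v = none)

theorem flood_state (hG : G.Connected) {root : Fin n} {m : Msg} (hm : msgBits m ≤ b) (k : ℕ) :
    ∀ i (h : Fin n → Option (Heard n)), FloodState G root m i h →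
      ∃ h', Runs G b (fun v => flood k i (h v)) (PMF.pure (k, h')) ∧
        FloodState G root m (i + k) h' := by
  induction k with
  | zero => intro i h hh; exact ⟨h, Runs.ret h, hh⟩
  | succ k ih =>
    intro i h hh
    have hout : ∀ u x, h u = some x → x.msg = m ∧ G.dist root u ≤ i := by
      intro u x hx
      rcases le_or_gt (G.dist root u) i with hi | hi
      · obtain ⟨p, hp, -⟩ := (hh u).1 hi
        rw [hp] at hx
        cases hx
        exact ⟨rfl, hi⟩
      · rw [(hh u).2 hi] at hx; simp at hx
    have hex := Runs.exchange (G := G) (b := b) (fun u _ => (h u).map Heard.msg) (fun u v m' h' => by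
      obtain ⟨x, hx, rfl⟩ := Option.map_eq_some_iff.1 h'
      rw [(hout u x hx).1]; exact hm)
    set inbox := deliver G (fun u (_ : Fin n) => (h u).map Heard.msg) with hinbox
    obtain ⟨h', hr, hs⟩ := ih (i + 1) (fun v => h v <|> (arrivals (inbox v)).head?.map fun a =>
      ⟨a.2, i + 1, some a.1⟩) (by
        intro v
        constructor
        · intro hv
          rcases le_or_gt (G.dist root v) i with hi | hi
          · obtain ⟨p, hp, hp'⟩ := (hh v).1 hi
            exact ⟨p, by simp [hp], hp'⟩
          · have hd : G.dist root v = i + 1 := by omega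
            have hne : root ≠ v := by rintro rfl; simp at hd
            obtain ⟨w, hw, hwd⟩ := exists_adj_dist_add_one hG hne
            obtain ⟨p, hp, -⟩ := (hh w).1 (by omega)
            obtain ⟨a, ha, ha'⟩ := arrivals_head?_of_some (inbox := inbox v) (u := w) (m := m) (by
              rw [hinbox, deliver_of_adj hw, hp]; rfl)
            rw [hinbox, deliver_eq_some] at ha'
            obtain ⟨haw, ha'⟩ := ha'
            obtain ⟨x, hx, hx'⟩ := Option.map_eq_some_iff.1 ha'
            obtain ⟨hxm, hxd⟩ := hout _ x hx
            refine ⟨some a.1, ?_, fun _ => ⟨a.1, rfl, haw, ?_⟩⟩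
            · simp [(hh v).2 hi, ha, hd, ← hx', hxm]
            · have := dist_le_add_one hG (r := root) haw
              omega
        · intro hv
          have hnone : ∀ u, inbox v u = none := fun u => by
            rw [Option.eq_none_iff_forall_ne_some]
            intro m' hm'
            rw [hinbox, deliver_eq_some] at hm'
            obtain ⟨x, hx, -⟩ := Option.map_eq_some_iff.1 hm'.2
            have h1 := (hout u x hx).2
            have := dist_le_add_one hG (r := root) hm'.1
            omega
          simp [(hh v).2 (by omega), arrivals_head?_eq_none hnone])
    refine ⟨h', ?_, by rwa [show i + (k + 1) = i + 1 + k by ring]⟩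
    have := Runs.bind_const (k := fun v inbox => flood k (i + 1)
      (h v <|> (arrivals inbox).head?.map fun a => ⟨a.2, i + 1, some a.1⟩)) hex hr
    rw [PMF.pure_map, add_comm 1 k] at this
    exact this

theorem flood_root (hG : G.Connected) {root : Fin n} {m : Msg} (hm : msgBits m ≤ b) (k : ℕ)
    (h : Fin n → Option (Heard n)) (hh : ∀ v, h v = if v = root then some ⟨m, 0, none⟩ else none) :
    ∃ h', Runs G b (fun v => flood k 0 (h v)) (PMF.pure (k, h')) ∧ FloodState G root m k h' := by
  have := flood_state (b := b) hG hm k 0 h (by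
    intro v
    constructor
    · intro hv
      have : v = root := by
        have := (hG.dist_eq_zero_iff (u := root) (v := v)).1 (Nat.le_zero.1 hv)
        exact this.symm
      subst this
      exact ⟨none, by simp [hh], fun h => absurd rfl h⟩
    · intro hv
      rw [hh, if_neg]
      rintro rfl; simp at hv)
  simpa using this

theorem flood_isSome (hG : G.Connected) {m : Msg} (hm : msgBits m ≤ b) (S : Fin n → Prop)
    (k : ℕ) : ∀ i (h : Fin n → Option (Heard n)), (∀ v x, h v = some x → x.msg = m) →
      (∀ v, (h v).isSome ↔ ∃ u, S u ∧ G.dist u v ≤ i) →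
      ∃ h', Runs G b (fun v => flood k i (h v)) (PMF.pure (k, h')) ∧
        ∀ v, (h' v).isSome ↔ ∃ u, S u ∧ G.dist u v ≤ i + k := by
  induction k with
  | zero => intro i h _ hh; exact ⟨h, Runs.ret h, hh⟩
  | succ k ih =>
    intro i h hmsg hh
    have hex := Runs.exchange (G := G) (b := b) (fun u _ => (h u).map Heard.msg) (fun u v m' h' => by
      obtain ⟨x, hx, rfl⟩ := Option.map_eq_some_iff.1 h'
      rw [hmsg u x hx]; exact hm)
    set inbox := deliver G (fun u (_ : Fin n) => (h u).map Heard.msg) with hinbox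
    have harr : ∀ v a, (arrivals (inbox v)).head? = some a → G.Adj a.1 v ∧ (h a.1).isSome ∧ a.2 = m := by
      intro v a ha
      have h1 : (a.1, a.2) ∈ arrivals (inbox v) := List.mem_of_mem_head? ha
      rw [mem_arrivals, hinbox, deliver_eq_some] at h1
      obtain ⟨x, hx, hx'⟩ := Option.map_eq_some_iff.1 h1.2
      exact ⟨h1.1, by simp [hx], by rw [← hx', hmsg _ x hx]⟩
    obtain ⟨h', hr, hs⟩ := ih (i + 1) (fun v => h v <|> (arrivals (inbox v)).head?.map fun a =>
      ⟨a.2, i + 1, some a.1⟩) (by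
        intro v x hx
        cases hv : h v with
        | some y => 
          simp only [hv, Option.orElse_eq_orElse, Option.orElse_some, Option.some.injEq] at hx
          rw [← hx]; exact hmsg v y hv
        | none =>
          simp only [hv, Option.orElse_eq_orElse, Option.orElse_none, Option.map_eq_some_iff] at hx
          obtain ⟨a, ha, rfl⟩ := hx
          exact (harr v a ha).2.2) (by
        intro v
        constructor
        · intro hx
          cases hv : h v with
          | some y =>
            obtain ⟨u, hu, hd⟩ := (hh v).1 (by simp [hv])
            exact ⟨u, hu, by omega⟩
          | none =>
            simp only [hv, Option.orElse_eq_orElse, Option.orElse_none, Option.isSome_map] at hx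
            obtain ⟨a, ha⟩ := Option.isSome_iff_exists.1 hx
            obtain ⟨haw, h2, -⟩ := harr v a ha
            obtain ⟨u, hu, hd⟩ := (hh _).1 h2
            have := dist_le_add_one hG (r := u) haw
            exact ⟨u, hu, by omega⟩
        · rintro ⟨u, hu, hd⟩
          cases hv : h v with
          | some y => simp
          | none =>
            have h1 : ¬ G.dist u v ≤ i := fun h' => by
              have := (hh v).2 ⟨u, hu, h'⟩
              simp [hv] at this
            have hne : u ≠ v := by rintro rfl; simp at h1
            obtain ⟨w, hw, hwd⟩ := exists_adj_dist_add_one hG hne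
            obtain ⟨x, hx⟩ := Option.isSome_iff_exists.1 ((hh w).2 ⟨u, hu, by omega⟩)
            obtain ⟨a, ha, -⟩ := arrivals_head?_of_some (inbox := inbox v) (u := w) (m := x.msg) (by
              rw [hinbox, deliver_of_adj hw, hx]; rfl)
            simp [ha])
    refine ⟨h', ?_, by rwa [show i + (k + 1) = i + 1 + k by ring]⟩
    have := Runs.bind_const (k := fun v inbox => flood k (i + 1)
      (h v <|> (arrivals inbox).head?.map fun a => ⟨a.2, i + 1, some a.1⟩)) hex hr
    rw [PMF.pure_map, add_comm 1 k] at this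
    exact this

end Flood

section Placement

/-- The law of `place` at node `v`. -/
noncomputable def placeLaw (G : SimpleGraph (Fin n)) (v : Fin n) (pool : Pool n) (t : Token) :
    PMF (Pool n) :=
  if t.len ≤ t.cnt then PMF.pure { pool with stored := pool.stored ++ [(t.src, t.len)] }
  else (G.srwStep v).map fun u =>
    { pool with queue := Function.update pool.queue u (pool.queue u ++ [t]) }

theorem local_place {s : Fin n} {ℓ : ℕ} {v : Fin n} (hv : ∃ u, G.Adj v u) (pool : Pool n)
    (t : Token) : Local (place (input G s ℓ v) pool t) (placeLaw G v pool t) := by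
  unfold place placeLaw
  split_ifs with h
  · exact Local.ret _
  · refine ((local_pick_nbrs hv).bind (ρ := fun o => match o with
      | none => PMF.pure pool
      | some u => PMF.pure { pool with queue := Function.update pool.queue u (pool.queue u ++ [t]) })
      fun o => ?_).congr ?_
    · cases o <;> exact Local.ret _
    · rw [PMF.bind_map]; rfl

/-- The law of placing several tokens at node `v`. -/
noncomputable def placeAllLaw (G : SimpleGraph (Fin n)) (v : Fin n) :
    List Token → Pool n → PMF (Pool n)
  | [], pool => PMF.pure pool
  | t :: l, pool => (placeLaw G v pool t).bind (placeAllLaw G v l)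

theorem local_placeAll {s : Fin n} {ℓ : ℕ} {v : Fin n} (hv : ∃ u, G.Adj v u) (l : List Token) :
    ∀ pool, Local (l.foldlM (place (input G s ℓ v)) pool) (placeAllLaw G v l pool) := by
  induction l with
  | nil => intro pool; exact Local.ret _
  | cons t l ih =>
    intro pool
    rw [List.foldlM_cons]
    exact (local_place hv pool t).bind ih

/-- The law of `launch` at node `v`. -/
noncomputable def launchLaw (G : SimpleGraph (Fin n)) (lam : ℕ) (v : Fin n) :
    ℕ → Pool n → PMF (Pool n)
  | 0, pool => PMF.pure pool
  | k + 1, pool => (PMF.uniformOfFintype (Fin (lam - 1 + 1))).bind fun r =>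
      (placeLaw G v pool ⟨v, lam + r, 0⟩).bind (launchLaw G lam v k)

theorem local_launch {s : Fin n} {ℓ : ℕ} {v : Fin n} (hv : ∃ u, G.Adj v u) (P : Params) (k : ℕ) :
    ∀ pool, Local (launch (input G s ℓ v) P k pool) (launchLaw G P.lam v k pool) := by
  induction k with
  | zero => intro pool; exact Local.ret _
  | succ k ih =>
    intro pool
    refine ((Local.uniform (P.lam - 1)).bind fun r =>
      (local_place hv pool ⟨v, P.lam + r, 0⟩).bind ih).congr ?_
    simp only [PMF.bind_map, launchLaw, Function.comp_def]

/-- Laws on a commutative monoid attached to stored walks, queued tokens and tokens to be placed, in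
such a way that placing a token preserves the expected product. -/
structure TokenLaw (G : SimpleGraph (Fin n)) (M : Type) [AddCommMonoid M] where
  done : Fin n → ℕ × ℕ → PMF M
  queued : Fin n → Fin n → Token → PMF M
  held : Fin n → Token → PMF M
  held_done : ∀ v t, t.len ≤ t.cnt → held v t = done v (t.src, t.len)
  held_step : ∀ v t, t.cnt < t.len → held v t = (G.srwStep v).bind fun u => queued v u t

variable {M : Type} [AddCommMonoid M]

namespace TokenLaw

/-- The contribution of the memory of node `v`. -/
noncomputable def node (L : TokenLaw G M) (v : Fin n) (pool : Pool n) : PMF M :=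
  (pool.stored.map (L.done v)).prod * ∏ u, ((pool.queue u).map (L.queued v u)).prod

/-- The contribution of all nodes. -/
noncomputable def total (L : TokenLaw G M) (σ : Fin n → Pool n) : PMF M := ∏ v, L.node v (σ v)

theorem placeLaw_bind (L : TokenLaw G M) (v : Fin n) (pool : Pool n) (t : Token) :
    (placeLaw G v pool t).bind (L.node v) = L.node v pool * L.held v t := by
  unfold placeLaw
  split_ifs with h
  · rw [PMF.pure_bind, L.held_done v t h]
    simp only [node, List.map_append, List.prod_append, List.map_cons, List.map_nil,
      List.prod_cons, List.prod_nil, mul_one]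
    exact mul_right_comm _ _ _
  · rw [L.held_step v t (by omega), conv_bind_right, PMF.bind_map]
    congr 1; funext u
    simp only [node, Function.comp_def, mul_assoc]
    congr 1
    rw [← Finset.mul_prod_erase _ _ (Finset.mem_univ u), ← Finset.mul_prod_erase _ _ (Finset.mem_univ u)]
    simp only [Function.update_self, List.map_append, List.prod_append, List.map_cons, List.map_nil,
      List.prod_cons, List.prod_nil, mul_one]
    rw [Finset.prod_congr rfl fun w hw => by rw [Function.update_of_ne (Finset.ne_of_mem_erase hw)]]
    exact mul_right_comm _ _ _

theorem placeAllLaw_bind (L : TokenLaw G M) (v : Fin n) (l : List Token) : ∀ pool,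
    (placeAllLaw G v l pool).bind (L.node v) = L.node v pool * (l.map (L.held v)).prod := by
  induction l with
  | nil => intro pool; simp [placeAllLaw]
  | cons t l ih =>
    intro pool
    simp only [placeAllLaw, PMF.bind_bind, ih, List.map_cons, List.prod_cons]
    rw [← conv_bind_left, placeLaw_bind, mul_assoc]

theorem launchLaw_bind (L : TokenLaw G M) (lam : ℕ) (v : Fin n) (k : ℕ) : ∀ pool,
    (launchLaw G lam v k pool).bind (L.node v) = L.node v pool *
      ((PMF.uniformOfFintype (Fin (lam - 1 + 1))).bind fun r => L.held v ⟨v, lam + r, 0⟩) ^ k := by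
  induction k with
  | zero => intro pool; simp [launchLaw]
  | succ k ih =>
    intro pool
    simp only [launchLaw, PMF.bind_bind, ih]
    simp only [← conv_bind_left, placeLaw_bind]
    rw [← conv_bind_right, pow_succ', mul_assoc]

end TokenLaw

/-- The desired length of a short walk and its source are in the right range. -/
def GoodWalk (n lam : ℕ) (w : ℕ × ℕ) : Prop := w.1 < n ∧ lam ≤ w.2 ∧ w.2 < 2 * lam

/-- The memory of node `v` is consistent. -/
def PoolOK (G : SimpleGraph (Fin n)) (lam : ℕ) (v : Fin n) (pool : Pool n) : Prop :=
  (∀ w ∈ pool.stored, GoodWalk n lam w) ∧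
  ∀ u, ∀ t ∈ pool.queue u, G.Adj v u ∧ GoodWalk n lam (t.src, t.len) ∧ t.cnt < t.len

/-- The number of steps that the queued tokens still have to make. -/
def Pool.remaining (pool : Pool n) : ℕ := ∑ u, ((pool.queue u).map fun t => t.len - t.cnt).sum

theorem placeLaw_support {lam : ℕ} {v : Fin n} (hv : ∃ u, G.Adj v u) {pool pool' : Pool n}
    {t : Token} (hp : PoolOK G lam v pool) (ht : GoodWalk n lam (t.src, t.len))
    (h : pool' ∈ (placeLaw G v pool t).support) :
    PoolOK G lam v pool' ∧ pool'.remaining = pool.remaining + (t.len - t.cnt) ∧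
      ∀ u, ∀ τ ∈ pool'.queue u, τ ∈ pool.queue u ∨ τ = t := by
  unfold placeLaw at h
  split_ifs at h with hc
  · simp only [PMF.support_pure, Set.mem_singleton_iff] at h
    subst h
    refine ⟨⟨?_, hp.2⟩, ?_, fun u τ h => Or.inl h⟩
    · intro w hw
      rcases List.mem_append.1 hw with hw | hw
      · exact hp.1 w hw
      · rw [List.mem_singleton.1 hw]; exact ht
    · rw [Nat.sub_eq_zero_of_le hc]; rfl
  · rw [PMF.mem_support_map_iff] at h
    obtain ⟨u, hu, rfl⟩ := h
    have key : ∀ w, ∀ τ ∈ Function.update pool.queue u (pool.queue u ++ [t]) w,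
        τ ∈ pool.queue w ∨ (τ = t ∧ w = u) := by
      intro w τ hτ
      by_cases hw : w = u
      · subst hw
        rw [Function.update_self, List.mem_append, List.mem_singleton] at hτ
        rcases hτ with h | h
        · exact Or.inl h
        · exact Or.inr ⟨h, rfl⟩
      · rw [Function.update_of_ne hw] at hτ
        exact Or.inl hτ
    refine ⟨⟨hp.1, ?_⟩, ?_, fun w τ hτ => (key w τ hτ).imp_right And.left⟩
    · intro w τ hτ
      rcases key w τ hτ with h | ⟨rfl, rfl⟩
      · exact hp.2 w τ h
      · exact ⟨mem_support_srwStep hv hu, ht, by omega⟩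
    · simp only [Pool.remaining]
      rw [← Finset.add_sum_erase _ _ (Finset.mem_univ u),
        ← Finset.add_sum_erase _ (fun u => ((pool.queue u).map fun t => t.len - t.cnt).sum)
          (Finset.mem_univ u)]
      rw [Finset.sum_congr rfl fun w hw => by rw [Function.update_of_ne (Finset.ne_of_mem_erase hw)]]
      simp only [Function.update_self, List.map_append, List.sum_append, List.map_cons,
        List.map_nil, List.sum_cons, List.sum_nil]
      ring

theorem placeAllLaw_support {lam : ℕ} {v : Fin n} (hv : ∃ u, G.Adj v u) {pool' : Pool n}
    (l : List Token) : ∀ pool : Pool n, PoolOK G lam v pool →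
      (∀ t ∈ l, GoodWalk n lam (t.src, t.len)) → pool' ∈ (placeAllLaw G v l pool).support →
      PoolOK G lam v pool' ∧
      pool'.remaining = pool.remaining + (l.map fun t => t.len - t.cnt).sum ∧
      ∀ u, ∀ τ ∈ pool'.queue u, τ ∈ pool.queue u ∨ τ ∈ l := by
  induction l with
  | nil =>
    intro pool hp _ h
    simp only [placeAllLaw, PMF.support_pure, Set.mem_singleton_iff] at h
    subst h
    exact ⟨hp, by simp, fun u τ h => Or.inl h⟩
  | cons t l ih =>
    intro pool hp hl h
    simp only [placeAllLaw, PMF.mem_support_bind_iff] at h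
    obtain ⟨q, hq, h⟩ := h
    obtain ⟨h1, h2, h3⟩ := placeLaw_support hv hp (hl t (by simp)) hq
    obtain ⟨h4, h5, h6⟩ := ih q h1 (fun t ht => hl t (by simp [ht])) h
    refine ⟨h4, ?_, fun u τ hτ => ?_⟩
    · rw [h5, h2, List.map_cons, List.sum_cons, add_assoc]
    · rcases h6 u τ hτ with h | h
      · rcases h3 u τ h with h | h
        · exact Or.inl h
        · exact Or.inr (by simp [h])
      · exact Or.inr (by simp [h])

theorem launchLaw_support {lam : ℕ} (hlam : 0 < lam) {v : Fin n} (hv : ∃ u, G.Adj v u)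
    {pool' : Pool n} (k : ℕ) : ∀ pool : Pool n, PoolOK G lam v pool →
      (∀ u, ∀ τ ∈ pool.queue u, τ.cnt = 0) → pool' ∈ (launchLaw G lam v k pool).support →
      PoolOK G lam v pool' ∧ pool'.remaining ≤ pool.remaining + k * (2 * lam) ∧
      ∀ u, ∀ τ ∈ pool'.queue u, τ.cnt = 0 := by
  induction k with
  | zero =>
    intro pool hp h0 h
    simp only [launchLaw, PMF.support_pure, Set.mem_singleton_iff] at h
    subst h
    exact ⟨hp, by simp, h0⟩
  | succ k ih =>
    intro pool hp h0 h
    simp only [launchLaw, PMF.mem_support_bind_iff] at h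
    obtain ⟨r, -, q, hq, h⟩ := h
    have hr := r.2
    obtain ⟨h1, h2, h3⟩ := placeLaw_support hv hp (lam := lam)
      (by refine ⟨v.2, ?_, ?_⟩ <;> simp only <;> omega) hq
    obtain ⟨h4, h5, h6⟩ := ih q h1 (fun u τ hτ => by
      rcases h3 u τ hτ with h | h
      · exact h0 u τ h
      · rw [h]) h
    refine ⟨h4, h5.trans ?_, h6⟩
    rw [h2, add_mul]
    simp only
    omega

end Placement

section Transmission

/-- The token that arrives. -/
def Token.incr (t : Token) : Token := ⟨t.src, t.len, t.cnt + 1⟩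

open scoped Classical in
theorem filterMap_arrivals (q : Fin n → Fin n → List Token) (v : Fin n) :
    (arrivals (deliver G (fun u w => (q u w).head?.map Token.msg) v)).filterMap
      (fun a => Token.ofMsg a.2) = (List.finRange n).filterMap fun u =>
        if G.Adj u v then (q u v).head?.map Token.incr else none := by
  rw [arrivals, List.filterMap_filterMap]
  congr 1; funext u
  unfold deliver
  split_ifs with h
  · change ((Option.map (fun m => (u, m)) ((q u v).head?.map Token.msg)).bind _) = _
    cases (q u v).head? <;> rfl
  · rfl

@[to_additive]
theorem prod_map_filterMap_finRange {M : Type} [CommMonoid M] (o : Fin n → Option α) (f : α → M) :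
    (((List.finRange n).filterMap o).map f).prod = ∏ u, ((o u).toList.map f).prod := by
  rw [Fin.prod_univ_def]
  generalize List.finRange n = l
  induction l with
  | nil => rfl
  | cons u l ih =>
    rw [List.map_cons, List.prod_cons, ← ih]
    cases ho : o u with
    | none => simp [ho]
    | some a => simp [ho]

theorem transmit_runs (k : ℕ) : ∀ (q : Fin n → Fin n → List Token) (buf : Fin n → List Token),
    (∀ v u, ∀ t ∈ q v u, G.Adj v u ∧ msgBits t.msg ≤ b) →
    ∃ buf' : Fin n → List Token,
      Runs G b (fun v => transmit k (q v) (buf v))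
        (PMF.pure (k, fun v => (fun u => (q v u).drop k, buf' v))) ∧
      (∀ v, ∀ t ∈ buf' v, t ∈ buf v ∨ ∃ u, ∃ t' ∈ q u v, t = t'.incr) ∧
      ∀ (M : Type) [CommMonoid M] (f : Fin n → Token → M),
        ∏ v, ((buf' v).map (f v)).prod = (∏ v, ((buf v).map (f v)).prod) *
          ∏ v, ∏ u, (((q v u).take k).map fun t => f u t.incr).prod := by
  classical
  induction k with
  | zero =>
    intro q buf _
    exact ⟨buf, Runs.ret _, fun v t h => Or.inl h, fun M _ f => by simp⟩
  | succ k ih =>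
    intro q buf hq
    have hex := Runs.exchange (G := G) (b := b) (fun v u => (q v u).head?.map Token.msg)
      (fun u v m h => by
        obtain ⟨t, ht, rfl⟩ := Option.map_eq_some_iff.1 h
        exact (hq u v t (List.mem_of_mem_head? ht)).2)
    obtain ⟨buf', h1, h2, h3⟩ := ih (fun v u => (q v u).tail) (fun v => buf v ++
      (arrivals (deliver G (fun u w => (q u w).head?.map Token.msg) v)).filterMap
        (fun a => Token.ofMsg a.2)) (fun v u t ht => hq v u t (List.mem_of_mem_tail ht))
    refine ⟨buf', ?_, ?_, ?_⟩
    · have := Runs.bind_const (k := fun v inbox => transmit k (fun u => (q v u).tail)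
        (buf v ++ (arrivals inbox).filterMap fun a => Token.ofMsg a.2)) hex h1
      rw [PMF.pure_map, add_comm 1 k] at this
      simp only [List.drop_tail] at this
      exact this
    · intro v t ht
      rcases h2 v t ht with h | ⟨u, t', ht', rfl⟩
      · rw [List.mem_append] at h
        rcases h with h | h
        · exact Or.inl h
        · rw [filterMap_arrivals, List.mem_filterMap] at h
          obtain ⟨u, -, hu⟩ := h
          split_ifs at hu
          obtain ⟨t', ht', rfl⟩ := Option.map_eq_some_iff.1 hu
          exact Or.inr ⟨u, t', List.mem_of_mem_head? ht', rfl⟩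
      · exact Or.inr ⟨u, t', List.mem_of_mem_tail ht', rfl⟩
    · intro M _ f
      rw [h3]
      simp only [filterMap_arrivals, List.map_append, List.prod_append, Finset.prod_mul_distrib,
        prod_map_filterMap_finRange, mul_assoc]
      congr 1
      rw [Finset.prod_comm, ← Finset.prod_mul_distrib]
      refine Finset.prod_congr rfl fun v _ => ?_
      rw [← Finset.prod_mul_distrib]
      refine Finset.prod_congr rfl fun u _ => ?_
      have := hq v u
      cases hl : q v u with
      | nil => simp
      | cons t l =>
        rw [hl] at this
        rw [if_pos (this t (by simp)).1]
        simp

end Transmission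

section Iteration

theorem sum_drop_add_sum_take_le (k : ℕ) (l : List Token) :
    ((l.drop k).map fun t => t.len - t.cnt).sum + ((l.take k).map fun t => t.len - (t.cnt + 1)).sum ≤
      (l.map fun t => t.len - t.cnt).sum := by
  conv_rhs => rw [← List.take_append_drop k l, List.map_append, List.sum_append, add_comm]
  exact Nat.add_le_add_left (List.sum_le_sum fun t _ => by omega) _

theorem sum_drop_add_sum_take_lt {k : ℕ} (hk : 0 < k) {l : List Token} (hl : l ≠ [])
    (h : ∀ t ∈ l, t.cnt < t.len) :
    ((l.drop k).map fun t => t.len - t.cnt).sum + ((l.take k).map fun t => t.len - (t.cnt + 1)).sum <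
      (l.map fun t => t.len - t.cnt).sum := by
  obtain ⟨k, rfl⟩ := Nat.exists_eq_succ_of_ne_zero hk.ne'
  cases l with
  | nil => simp at hl
  | cons t l =>
    have h1 := sum_drop_add_sum_take_le k l
    have h2 := h t (by simp)
    simp only [Nat.succ_eq_add_one, List.drop_succ_cons, List.take_succ_cons, List.map_cons,
      List.sum_cons]
    omega

/-- The number of steps still to be made in the whole network. -/
def remainingSteps (σ : Fin n → Pool n) : ℕ := ∑ v, (σ v).remaining

/-- All queued tokens have made `j` steps. -/
def AllCount (j : ℕ) (σ : Fin n → Pool n) : Prop := ∀ v u, ∀ t ∈ (σ v).queue u, t.cnt = j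

/-- No token is queued. -/
def AllDone (σ : Fin n → Pool n) : Prop := ∀ v u, (σ v).queue u = []

theorem iteration_runs (hadj : ∀ v, ∃ u, G.Adj v u) {s : Fin n} {ℓ : ℕ} {P : Params}
    (hslots : 0 < P.slots)
    (hb : ∀ t : Token, GoodWalk n P.lam (t.src, t.len) → t.cnt < t.len → msgBits t.msg ≤ b)
    {σ : Fin n → Pool n} (hσ : ∀ v, PoolOK G P.lam v (σ v)) :
    ∃ ν : PMF (Fin n → Pool n),
      Runs G b (fun v => iteration (input G s ℓ v) P (σ v)) (ν.map fun r => (P.slots, r)) ∧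
      (∀ σ' ∈ ν.support, (∀ v, PoolOK G P.lam v (σ' v)) ∧
        remainingSteps σ' ≤ remainingSteps σ - 1 ∧
        ((∀ v u, ((σ v).queue u).length ≤ P.slots) → ∀ j, AllCount j σ → AllCount (j + 1) σ')) ∧
      ∀ (M : Type) [AddCommMonoid M] (L : TokenLaw G M),
        (∀ v u, ∀ t ∈ (σ v).queue u, L.queued v u t = L.held u t.incr) →
        ν.bind L.total = L.total σ := by
  obtain ⟨buf, h1, h2, h3⟩ := transmit_runs (G := G) (b := b) P.slots (fun v => (σ v).queue)
    (fun _ => []) (fun v u t ht => by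
      obtain ⟨ha, hg, hc⟩ := (hσ v).2 u t ht
      exact ⟨ha, hb t hg hc⟩)
  set pool : Fin n → Pool n := fun v =>
    { σ v with queue := fun u => ((σ v).queue u).drop P.slots } with hpool
  have hpoolOK : ∀ v, PoolOK G P.lam v (pool v) := fun v =>
    ⟨(hσ v).1, fun u t ht => (hσ v).2 u t (List.mem_of_mem_drop ht)⟩
  have hbuf : ∀ v, ∀ t ∈ buf v, ∃ u, ∃ t' ∈ (σ u).queue v, t = t'.incr := fun v t ht => by
    rcases h2 v t ht with h | h
    · simp at h
    · exact h
  have hgood : ∀ v, ∀ t ∈ buf v, GoodWalk n P.lam (t.src, t.len) := fun v t ht => by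
    obtain ⟨u, t', ht', rfl⟩ := hbuf v t ht
    exact ((hσ u).2 v t' ht').2.1
  refine ⟨independent n fun v => placeAllLaw G v (buf v) (pool v), ?_, ?_, ?_⟩
  · have hloc := Runs.local (G := G) (b := b) (fun v =>
      local_placeAll (s := s) (ℓ := ℓ) (hadj v) (buf v) (pool v))
    have := Runs.bind_const (k := fun v x => match x with
      | (q, buf) => buf.foldlM (place (input G s ℓ v)) { σ v with queue := q }) h1 hloc
    rw [PMF.map_comp] at this
    simp only [Function.comp_def, add_zero] at this
    exact this
  · intro σ' hσ'
    have hs := fun v => placeAllLaw_support (hadj v) (buf v) (pool v) (hpoolOK v) (hgood v)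
      (mem_support_independent hσ' v)
    refine ⟨fun v => (hs v).1, ?_, ?_⟩
    · have hsum : remainingSteps σ' = ∑ v, ∑ u,
          ((((σ v).queue u).drop P.slots |>.map fun t => t.len - t.cnt).sum +
          (((σ v).queue u).take P.slots |>.map fun t => t.len - (t.cnt + 1)).sum) := by
        have := congrArg Multiplicative.toAdd
          (h3 (Multiplicative ℕ) fun _ t => Multiplicative.ofAdd (t.len - t.cnt))
        simp only [toAdd_mul, toAdd_prod, toAdd_list_sum, List.map_map, Function.comp_def,
          toAdd_ofAdd, List.map_nil, List.sum_nil, Finset.sum_const_zero, zero_add] at this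
        simp only [remainingSteps, fun v => (hs v).2.1, Finset.sum_add_distrib, this]
        rfl
      have hle : ∀ v ∈ Finset.univ, _ := fun v (_ : v ∈ (Finset.univ : Finset (Fin n))) =>
        Finset.sum_le_sum (s := Finset.univ) fun u _ =>
          sum_drop_add_sum_take_le P.slots ((σ v).queue u)
      by_cases hd : AllDone σ
      · rw [hsum]; simp [show ∀ v u, (σ v).queue u = [] from hd]
      · simp only [AllDone, not_forall] at hd
        obtain ⟨v, u, hvu⟩ := hd
        refine Nat.le_sub_one_of_lt ?_
        rw [hsum]
        exact Finset.sum_lt_sum hle ⟨v, Finset.mem_univ v, Finset.sum_lt_sum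
          (fun u _ => sum_drop_add_sum_take_le P.slots ((σ v).queue u)) ⟨u, Finset.mem_univ u,
            sum_drop_add_sum_take_lt hslots hvu fun t ht => ((hσ v).2 u t ht).2.2⟩⟩
    · intro hlen j hj v u t ht
      rcases (hs v).2.2 u t ht with h | h
      · have : ((σ v).queue u).drop P.slots = [] := List.drop_eq_nil_of_le (hlen v u)
        simp only [hpool, this, List.not_mem_nil] at h
      · obtain ⟨w, t', ht', rfl⟩ := hbuf v t h
        simp only [Token.incr, hj w v t' ht']
  · intro M _ L hL
    rw [show L.total = fun σ => ∏ v, L.node v (σ v) from rfl, independent_bind_prod _ L.node]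
    simp only [TokenLaw.placeAllLaw_bind, TokenLaw.node, hpool]
    rw [Finset.prod_mul_distrib, h3]
    simp only [Finset.prod_mul_distrib, List.map_nil, List.prod_nil, Finset.prod_const_one, one_mul,
      mul_assoc]
    congr 1
    rw [← Finset.prod_mul_distrib]
    refine Finset.prod_congr rfl fun v _ => ?_
    rw [← Finset.prod_mul_distrib]
    refine Finset.prod_congr rfl fun u _ => ?_
    conv_rhs => rw [← List.take_append_drop P.slots ((σ v).queue u), List.map_append,
      List.prod_append, mul_comm]
    congr 2
    exact List.map_congr_left fun t ht => (hL v u t (List.mem_of_mem_take ht)).symm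

end Iteration

section Crossing

/-- The law of the number of tokens that cross the edge from `u₀` to `v₀` in their step number
`t` (counted from `0`). -/
noncomputable def crossing (G : SimpleGraph (Fin n)) (t : ℕ) (u₀ v₀ : Fin n) : TokenLaw G ℕ where
  done _ _ := PMF.pure 0
  queued v u τ :=
    if τ.len ≤ t then PMF.pure 0
    else if τ.cnt < t then (G.srw u (t - τ.cnt - 1)).bind fun w => (G.srwStep w).map fun z =>
      if w = u₀ ∧ z = v₀ then 1 else 0
    else if τ.cnt = t then PMF.pure (if v = u₀ ∧ u = v₀ then 1 else 0)
    else PMF.pure 0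
  held v τ :=
    if τ.len ≤ t then PMF.pure 0
    else if τ.cnt ≤ t then (G.srw v (t - τ.cnt)).bind fun w => (G.srwStep w).map fun z =>
      if w = u₀ ∧ z = v₀ then 1 else 0
    else PMF.pure 0
  held_done v τ h := by
    by_cases h1 : τ.len ≤ t
    · simp [h1]
    · simp [h1, show ¬ τ.cnt ≤ t by omega]
  held_step v τ h := by
    by_cases h1 : τ.len ≤ t
    · simp [h1]
    · simp only [h1, if_false]
      rcases lt_trichotomy τ.cnt t with h2 | h2 | h2
      · simp only [h2, h2.le, if_true]
        rw [show t - τ.cnt = t - τ.cnt - 1 + 1 by omega, srw_succ', PMF.bind_bind]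
        simp
      · simp only [h2, le_refl, lt_irrefl, if_true, if_false, Nat.sub_self, SimpleGraph.srw,
          PMF.pure_bind]
        rfl
      · simp [show ¬ τ.cnt ≤ t by omega, show ¬ τ.cnt < t by omega, show ¬ τ.cnt = t by omega]

theorem crossing_queued_eq_held {t : ℕ} {u₀ v₀ : Fin n} (v u : Fin n) {τ : Token} (h : τ.cnt < t) :
    (crossing G t u₀ v₀).queued v u τ = (crossing G t u₀ v₀).held u τ.incr := by
  simp only [crossing, Token.incr, h, if_true, show τ.cnt + 1 ≤ t from h]
  rfl

theorem crossing_total_eq {t : ℕ} {u₀ v₀ : Fin n} {σ : Fin n → Pool n} (h : AllCount t σ)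
    (hlen : ∀ v u, ∀ τ ∈ (σ v).queue u, τ.cnt < τ.len) :
    (crossing G t u₀ v₀).total σ = PMF.pure ((σ u₀).queue v₀).length := by
  have hq : ∀ v u, (((σ v).queue u).map ((crossing G t u₀ v₀).queued v u)).prod =
      PMF.pure (if v = u₀ ∧ u = v₀ then ((σ v).queue u).length else 0) := by
    intro v u
    rw [List.map_congr_left (g := fun _ => PMF.pure (if v = u₀ ∧ u = v₀ then 1 else 0)) (by
      intro τ hτ
      have h1 := h v u τ hτ
      have h2 := hlen v u τ hτ
      simp only [crossing, h1, show ¬ τ.len ≤ t by omega, lt_irrefl, if_false, if_true])]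
    rw [conv_list_prod_pure]
    congr 1
    split_ifs <;> simp
  have hs : ∀ v (l : List (ℕ × ℕ)), (l.map ((crossing G t u₀ v₀).done v)).prod = 1 := by
    intro v l
    have := conv_list_prod_pure l (fun _ => (0 : ℕ))
    simp only [List.map_const', List.sum_replicate, smul_zero] at this
    simp only [crossing, List.map_const', this, conv_one]
  simp only [TokenLaw.total, TokenLaw.node, hq, hs, one_mul, conv_prod_pure]
  congr 1
  rw [Finset.sum_eq_single u₀ (fun v _ hv => by simp [hv]) (by simp)]
  simp

/-- Bound for the probability that a queue becomes longer than `B` from iteration `j` on. -/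
noncomputable def congestionBound (G : SimpleGraph (Fin n)) (lam B j : ℕ) (σ : Fin n → Pool n) :
    ℝ≥0∞ :=
  ∑ t ∈ Finset.Ico j (2 * lam), ∑ e : Fin n × Fin n,
    expect ((crossing G t e.1 e.2).total σ) fun X => if B < X then 1 else 0

end Crossing

section Iterations

theorem remainingSteps_eq_zero {lam : ℕ} {σ : Fin n → Pool n} (hσ : ∀ v, PoolOK G lam v (σ v))
    (h : remainingSteps σ = 0) : AllDone σ := by
  intro v u
  simp only [remainingSteps, Pool.remaining, Finset.sum_eq_zero_iff, Finset.mem_univ,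
    forall_const, List.sum_eq_zero_iff] at h
  rw [List.eq_nil_iff_forall_not_mem]
  intro t ht
  have h1 := h v u (t.len - t.cnt) (List.mem_map.2 ⟨t, ht, rfl⟩)
  have h2 := ((hσ v).2 u t ht).2.2
  omega

theorem iterations_runs (hadj : ∀ v, ∃ u, G.Adj v u) {s : Fin n} {ℓ : ℕ} {P : Params}
    (hslots : 0 < P.slots)
    (hb : ∀ t : Token, GoodWalk n P.lam (t.src, t.len) → t.cnt < t.len → msgBits t.msg ≤ b)
    (k : ℕ) : ∀ {σ : Fin n → Pool n}, (∀ v, PoolOK G P.lam v (σ v)) →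
    ∃ ν : PMF (Fin n → Pool n),
      Runs G b (fun v => iterations (input G s ℓ v) P k (σ v)) (ν.map fun r => (k * P.slots, r)) ∧
      (∀ σ' ∈ ν.support, (∀ v, PoolOK G P.lam v (σ' v)) ∧
        remainingSteps σ' ≤ remainingSteps σ - k) ∧
      (∀ (M : Type) [AddCommMonoid M] (L : TokenLaw G M),
        (∀ v u t, L.queued v u t = L.held u t.incr) → ν.bind L.total = L.total σ) ∧
      ∀ j, j + k = 2 * P.lam → AllCount j σ →
        ν.toOuterMeasure {σ' | ¬ AllDone σ'} ≤ congestionBound G P.lam P.slots j σ := by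
  induction k with
  | zero =>
    intro σ hσ
    refine ⟨PMF.pure σ, ?_, ?_, ?_, ?_⟩
    · rw [PMF.pure_map, zero_mul]; exact Runs.ret σ
    · intro σ' h
      simp only [PMF.support_pure, Set.mem_singleton_iff] at h
      subst h
      exact ⟨hσ, by simp⟩
    · intro M _ L _
      rw [PMF.pure_bind]
    · intro j hj hc
      rw [PMF.toOuterMeasure_pure_apply, if_neg]
      · exact zero_le
      · simp only [Set.mem_ofPred_eq, not_not]
        intro v u
        rw [List.eq_nil_iff_forall_not_mem]
        intro t ht
        obtain ⟨-, ⟨-, -, h1⟩, h2⟩ := (hσ v).2 u t ht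
        have := hc v u t ht
        simp only at h1
        omega
  | succ k ih =>
    intro σ hσ
    obtain ⟨ν, h1, h2, h3⟩ := iteration_runs (s := s) (ℓ := ℓ) hadj hslots hb hσ
    have ih' : ∀ σ' : Fin n → Pool n, ∃ ν' : PMF (Fin n → Pool n), (∀ v, PoolOK G P.lam v (σ' v)) →
        _ := fun σ' => by
      by_cases h : ∀ v, PoolOK G P.lam v (σ' v)
      · obtain ⟨ν', h'⟩ := ih h
        exact ⟨ν', fun _ => h'⟩
      · exact ⟨PMF.pure σ', fun h' => absurd h' h⟩
    choose ν' hν' using ih'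
    refine ⟨ν.bind ν', ?_, ?_, ?_, ?_⟩
    · rw [show (k + 1) * P.slots = P.slots + k * P.slots by ring]
      exact Runs.bind_time h1 fun r hr => (hν' r (h2 r hr).1).1
    · intro σ'' h
      rw [PMF.mem_support_bind_iff] at h
      obtain ⟨σ', hσ', h⟩ := h
      obtain ⟨ha, hb, hc⟩ := h2 σ' hσ'
      obtain ⟨hd, he⟩ := (hν' σ' ha).2.1 σ'' h
      exact ⟨hd, by omega⟩
    · intro M _ L hL
      rw [PMF.bind_bind, ← h3 M L fun v u t _ => hL v u t]
      refine ext_of_expect fun f => ?_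
      rw [expect_bind, expect_bind]
      refine expect_congr fun σ' hσ' => ?_
      rw [(hν' σ' (h2 σ' hσ').1).2.2.1 M L hL]
    · intro j hj hc
      have hlen : ∀ v u, ∀ τ ∈ (σ v).queue u, τ.cnt < τ.len := fun v u τ hτ => ((hσ v).2 u τ hτ).2.2
      by_cases hq : ∀ v u, ((σ v).queue u).length ≤ P.slots
      · rw [toOuterMeasure_eq_expect, expect_bind]
        refine (expect_mono (g := congestionBound G P.lam P.slots (j + 1)) fun σ' hσ' => ?_).trans ?_
        · rw [← toOuterMeasure_eq_expect]
          obtain ⟨ha, -, hc'⟩ := h2 σ' hσ'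
          exact (hν' σ' ha).2.2.2 (j + 1) (by omega) (hc' hq j hc)
        · unfold congestionBound
          rw [expect_sum]
          refine (Finset.sum_le_sum fun t ht => ?_).trans
            (Finset.sum_le_sum_of_subset (Finset.Ico_subset_Ico_left (Nat.le_succ j)))
          rw [expect_sum]
          refine Finset.sum_le_sum fun e _ => ?_
          rw [← expect_bind, h3]
          intro v u τ hτ
          have h1 := hc v u τ hτ
          have h2 := (Finset.mem_Ico.1 ht).1
          exact crossing_queued_eq_held v u (by omega)
      · push Not at hq
        obtain ⟨v, u, hvu⟩ := hq
        have h1 : (1 : ℝ≥0∞) ≤ congestionBound G P.lam P.slots j σ := by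
          unfold congestionBound
          refine le_trans ?_ (Finset.single_le_sum (f := fun t => ∑ e : Fin n × Fin n,
            expect ((crossing G t e.1 e.2).total σ) fun X => if P.slots < X then 1 else 0)
            (fun _ _ => zero_le) (Finset.mem_Ico.2 ⟨le_refl j, by omega⟩))
          refine le_trans ?_ (Finset.single_le_sum (f := fun e : Fin n × Fin n =>
            expect ((crossing G j e.1 e.2).total σ) fun X => if P.slots < X then 1 else 0)
            (fun _ _ => zero_le) (Finset.mem_univ (v, u)))
          rw [crossing_total_eq hc hlen, expect_pure, if_pos hvu]
        refine le_trans ?_ h1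
        rw [toOuterMeasure_eq_expect]
        refine (expect_mono (g := fun _ => 1) fun σ' _ => ?_).trans (expect_const _ _).le
        split_ifs <;> simp

end Iterations

section Blocks

theorem blocks_runs (hG : G.Connected) (hadj : ∀ v, ∃ u, G.Adj v u) {s : Fin n} {ℓ : ℕ} {P : Params}
    (hslots : 0 < P.slots) (hlam : 0 < P.lam)
    (hb : ∀ t : Token, GoodWalk n P.lam (t.src, t.len) → t.cnt < t.len → msgBits t.msg ≤ b)
    (hb' : 2 ≤ b) (k : ℕ) : ∀ {σ : Fin n → Pool n}, (∀ v, PoolOK G P.lam v (σ v)) →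
      remainingSteps σ ≤ k →
    ∃ μ : PMF (ℕ × (Fin n → Pool n)),
      Runs G b (fun v => blocks (input G s ℓ v) P k (σ v)) μ ∧
      (∀ x ∈ μ.support, (∀ v, PoolOK G P.lam v (x.2 v)) ∧ AllDone x.2 ∧
        x.1 ≤ k * (2 * P.lam * P.slots + G.diam)) ∧
      (∀ (M : Type) [AddCommMonoid M] (L : TokenLaw G M),
        (∀ v u t, L.queued v u t = L.held u t.incr) → (μ.bind fun x => L.total x.2) = L.total σ) ∧
      (AllCount 0 σ → μ.toOuterMeasure {x | 2 * P.lam * P.slots + G.diam < x.1} ≤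
        congestionBound G P.lam P.slots 0 σ) := by
  induction k with
  | zero =>
    intro σ hσ hR
    refine ⟨PMF.pure (0, σ), Runs.ret σ, ?_, ?_, ?_⟩
    · intro x h
      simp only [PMF.support_pure, Set.mem_singleton_iff] at h
      subst h
      exact ⟨hσ, remainingSteps_eq_zero hσ (Nat.le_zero.1 hR), Nat.zero_le _⟩
    · intro M _ L _
      rw [PMF.pure_bind]
    · intro _
      rw [PMF.toOuterMeasure_pure_apply, if_neg]
      · exact zero_le
      · simp
  | succ k ih =>
    intro σ hσ hR
    obtain ⟨ν, h1, h2, h3, h4⟩ := iterations_runs (s := s) (ℓ := ℓ) hadj hslots hb (2 * P.lam) hσ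
    set k₂ : Fin n → Pool n → Prog n (Pool n) := fun v pool => do
      let h ← flood G.diam 0 (if (List.finRange n).any (fun u => !(pool.queue u).isEmpty) then
        some ⟨[], 0, none⟩ else none)
      if h.isSome then blocks (input G s ℓ v) P k pool else return pool with hk₂
    have key : ∀ σ' : Fin n → Pool n, ∃ μ' : PMF (ℕ × (Fin n → Pool n)), σ' ∈ ν.support →
        Runs G b (fun v => k₂ v (σ' v)) μ' ∧
        (∀ x ∈ μ'.support, (∀ v, PoolOK G P.lam v (x.2 v)) ∧ AllDone x.2 ∧
          x.1 ≤ G.diam + k * (2 * P.lam * P.slots + G.diam)) ∧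
        (∀ (M : Type) [AddCommMonoid M] (L : TokenLaw G M),
          (∀ v u t, L.queued v u t = L.held u t.incr) →
          (μ'.bind fun x => L.total x.2) = L.total σ') ∧
        (AllDone σ' → μ' = PMF.pure (G.diam, σ')) := by
      intro σ'
      by_cases hσ' : σ' ∈ ν.support
      swap; · exact ⟨PMF.pure (0, σ'), fun h => absurd h hσ'⟩
      obtain ⟨hOK, hrem⟩ := h2 σ' hσ'
      have hbusy : ∀ v, (List.finRange n).any (fun u => !((σ' v).queue u).isEmpty) = true ↔
          ∃ u, (σ' v).queue u ≠ [] := fun v => by simp [List.any_eq_true]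
      obtain ⟨h', hr, hs⟩ := flood_isSome (b := b) hG (m := []) hb'
        (fun v => ∃ u, (σ' v).queue u ≠ []) G.diam 0
        (fun v => if (List.finRange n).any (fun u => !((σ' v).queue u).isEmpty) then
          some ⟨[], 0, none⟩ else none)
        (fun v x hx => by
          split_ifs at hx
          rw [← Option.some.inj hx]) (fun v => by
          constructor
          · intro h
            refine ⟨v, (hbusy v).1 ?_, by simp⟩
            by_contra hc
            simp [hc] at h
          · rintro ⟨u, hu, hd⟩
            have : u = v := (hG.dist_eq_zero_iff (u := u) (v := v)).1 (Nat.le_zero.1 hd)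
            subst this
            rw [if_pos ((hbusy u).2 hu)]; rfl)
      have hs' : ∀ v, (h' v).isSome ↔ ¬ AllDone σ' := fun v => by
        rw [hs v, AllDone]
        push Not
        constructor
        · rintro ⟨u, hu, -⟩; exact ⟨u, hu⟩
        · rintro ⟨u, hu⟩; exact ⟨u, hu, by simpa using dist_le_diam' hG u v⟩
      by_cases hd : AllDone σ'
      · refine ⟨PMF.pure (G.diam, σ'), fun _ => ⟨?_, ?_, ?_, fun _ => rfl⟩⟩
        · have := Runs.bind_const (k := fun v (h : Option (Heard n)) =>
            if h.isSome then blocks (input G s ℓ v) P k (σ' v) else return σ' v) hr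
            (ν := PMF.pure (0, σ')) (by
              simp only [hs', hd, not_true, if_false]
              exact Runs.ret _)
          rw [PMF.pure_map] at this
          exact this
        · intro x hx
          simp only [PMF.support_pure, Set.mem_singleton_iff] at hx
          subst hx
          exact ⟨hOK, hd, Nat.le_add_right _ _⟩
        · intro M _ L _
          rw [PMF.pure_bind]
      · obtain ⟨μ', g1, g2, g3, -⟩ := ih hOK (by omega)
        refine ⟨μ'.map fun x => (G.diam + x.1, x.2), fun _ => ⟨?_, ?_, ?_, fun h => absurd h hd⟩⟩
        · exact Runs.bind_const (k := fun v (h : Option (Heard n)) =>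
            if h.isSome then blocks (input G s ℓ v) P k (σ' v) else return σ' v) hr (by
              simp only [hs', hd, not_false_eq_true, if_true]
              exact g1)
        · intro x hx
          rw [PMF.mem_support_map_iff] at hx
          obtain ⟨y, hy, rfl⟩ := hx
          obtain ⟨ha, hb, hc⟩ := g2 y hy
          exact ⟨ha, hb, Nat.add_le_add_left hc _⟩
        · intro M _ L hL
          rw [PMF.bind_map]
          exact g3 M L hL
    choose μ' hμ' using key
    have hsup : ∀ x ∈ (seqLaw (ν.map fun r => (2 * P.lam * P.slots, r)) μ').support,
        ∃ σ' ∈ ν.support, ∃ y ∈ (μ' σ').support, x = (2 * P.lam * P.slots + y.1, y.2) := by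
      intro x hx
      simp only [seqLaw, PMF.bind_map, PMF.mem_support_bind_iff, Function.comp_def,
        PMF.mem_support_map_iff] at hx
      obtain ⟨σ', h, y, hy, rfl⟩ := hx
      exact ⟨σ', h, y, hy, rfl⟩
    refine ⟨seqLaw (ν.map fun r => (2 * P.lam * P.slots, r)) μ', ?_, ?_, ?_, ?_⟩
    · refine h1.bind (k := k₂) fun x hx => ?_
      rw [PMF.mem_support_map_iff] at hx
      obtain ⟨r, hr, rfl⟩ := hx
      exact (hμ' r hr).1
    · intro x hx
      obtain ⟨σ', h, y, hy, rfl⟩ := hsup x hx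
      obtain ⟨ha, hb, hc⟩ := (hμ' σ' h).2.1 y hy
      refine ⟨ha, hb, ?_⟩
      simp only
      rw [add_mul]; omega
    · intro M _ L hL
      rw [← h3 M L hL]
      simp only [seqLaw, PMF.bind_map, PMF.bind_bind, Function.comp_def]
      refine ext_of_expect fun f => ?_
      rw [expect_bind, expect_bind]
      refine expect_congr fun σ' hσ' => ?_
      rw [(hμ' σ' hσ').2.2.1 M L hL]
    · intro hc
      refine le_trans ?_ (h4 0 (by omega) hc)
      rw [toOuterMeasure_eq_expect, toOuterMeasure_eq_expect]
      simp only [seqLaw, PMF.bind_map, expect_bind, Function.comp_def, expect_map]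
      refine expect_mono fun σ' hσ' => ?_
      by_cases hd : AllDone σ'
      · rw [(hμ' σ' hσ').2.2.2 hd, expect_pure]
        simp
      · simp only [Set.mem_ofPred_eq, hd, not_false_eq_true, if_true]
        refine (expect_mono (g := fun _ => 1) fun y _ => ?_).trans (expect_const _ _).le
        split_ifs <;> simp

end Blocks

section Reversibility

open scoped Classical in
/-- Degree of a node. -/
noncomputable def deg (G : SimpleGraph (Fin n)) (v : Fin n) : ℕ := (G.neighborFinset v).card

theorem length_nbrs {s : Fin n} {ℓ : ℕ} (v : Fin n) : (input G s ℓ v).nbrs.length = deg G v := by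
  classical
  rw [deg, ← List.toFinset_card_of_nodup (l := (input G s ℓ v).nbrs)
    ((List.nodup_finRange n).filter _)]
  congr 1
  ext u; simp [input]

open scoped Classical in
theorem deg_mul_srwStep (x y : Fin n) :
    (deg G x : ℝ≥0∞) * G.srwStep x y = if G.Adj x y then 1 else 0 := by
  by_cases h : (G.neighborFinset x).Nonempty
  · rw [SimpleGraph.srwStep, dif_pos h, PMF.uniformOfFinset_apply, deg]
    simp only [SimpleGraph.mem_neighborFinset, mul_ite, mul_zero]
    congr 1
    exact ENNReal.mul_inv_cancel (Nat.cast_ne_zero.2 (Finset.card_ne_zero.2 h))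
      (ENNReal.natCast_ne_top _)
  · rw [if_neg fun hxy => h ⟨y, by simpa using hxy⟩]
    have : deg G x = 0 := Finset.card_eq_zero.2 (Finset.not_nonempty_iff_eq_empty.1 h)
    simp [this]

theorem deg_mul_srwStep_comm (x y : Fin n) :
    (deg G x : ℝ≥0∞) * G.srwStep x y = deg G y * G.srwStep y x := by
  rw [deg_mul_srwStep, deg_mul_srwStep, G.adj_comm]

theorem deg_mul_srw_comm (k : ℕ) (x y : Fin n) :
    (deg G x : ℝ≥0∞) * G.srw x k y = deg G y * G.srw y k x := by
  induction k generalizing x y with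
  | zero =>
    simp only [SimpleGraph.srw, PMF.pure_apply]
    by_cases h : x = y
    · subst h; rfl
    · simp [h, Ne.symm h]
  | succ k ih =>
    rw [SimpleGraph.srw, srw_succ', PMF.bind_apply, PMF.bind_apply, ← ENNReal.tsum_mul_left,
      ← ENNReal.tsum_mul_left]
    congr 1; funext z
    rw [← mul_assoc, ih, ← mul_assoc, ← deg_mul_srwStep_comm]
    ring

theorem sum_deg_mul_srw (k : ℕ) (y : Fin n) : ∑ x, (deg G x : ℝ≥0∞) * G.srw x k y = deg G y := by
  simp only [deg_mul_srw_comm k _ y, ← Finset.mul_sum]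
  rw [(tsum_fintype (fun x => G.srw y k x)).symm.trans (PMF.tsum_coe _), mul_one]

end Reversibility

section Chernoff

theorem prod_one_add_pow_le (q : Fin n → ℝ≥0∞) (d : Fin n → ℕ) (hq : ∀ v, q v ≤ 1)
    (h : ∑ v, (d v : ℝ≥0∞) * q v ≤ 1) (η : ℕ) : ∏ v, (1 + q v) ^ (η * d v) ≤ 4 ^ η := by
  have hq' : ∀ v, q v = ENNReal.ofReal (q v).toReal := fun v =>
    (ENNReal.ofReal_toReal (ne_top_of_le_ne_top ENNReal.one_ne_top (hq v))).symm
  have h1 : ∏ v, (1 + q v) ^ d v ≤ ENNReal.ofReal (Real.exp (∑ v, d v * (q v).toReal)) := by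
    rw [Real.exp_sum, ENNReal.ofReal_prod_of_nonneg fun v _ => (Real.exp_pos _).le]
    refine Finset.prod_le_prod' fun v _ => ?_
    rw [Real.exp_nat_mul, ENNReal.ofReal_pow (Real.exp_pos _).le]
    refine pow_le_pow_left' ?_ _
    conv_lhs => rw [hq' v, ← ENNReal.ofReal_one, ← ENNReal.ofReal_add zero_le_one
      ENNReal.toReal_nonneg]
    refine ENNReal.ofReal_le_ofReal ?_
    rw [add_comm]; exact Real.add_one_le_exp _
  have h2 : ∑ v, d v * (q v).toReal ≤ 1 := by
    have := ENNReal.toReal_mono ENNReal.one_ne_top h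
    rw [ENNReal.toReal_sum fun v _ => ENNReal.mul_ne_top (by simp)
      (ne_top_of_le_ne_top ENNReal.one_ne_top (hq v))] at this
    simpa using this
  have h3 : ∏ v, (1 + q v) ^ d v ≤ 4 := by
    refine h1.trans ?_
    rw [show (4 : ℝ≥0∞) = ENNReal.ofReal 4 by simp]
    refine ENNReal.ofReal_le_ofReal ((Real.exp_le_exp.2 h2).trans ?_)
    have := Real.exp_one_lt_d9
    linarith
  simp only [mul_comm η, pow_mul, Finset.prod_pow]
  exact pow_le_pow_left' h3 η

theorem expect_crossing_held_le (t lam : ℕ) (u₀ v₀ v : Fin n) (r : ℕ) :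
    expect ((crossing G t u₀ v₀).held v ⟨v, lam + r, 0⟩) (fun X => 2 ^ X) ≤
      1 + G.srw v t u₀ * G.srwStep u₀ v₀ := by
  classical
  simp only [crossing]
  split_ifs with h1 h2
  · simp [expect_pure]
  · rw [expect_bind]
    simp only [expect_map]
    have : ∀ w z : Fin n, (2 : ℝ≥0∞) ^ (if w = u₀ ∧ z = v₀ then 1 else 0) =
        1 + (if w = u₀ then 1 else 0) * (if z = v₀ then 1 else 0) := by
      intro w z
      by_cases hw : w = u₀ <;> by_cases hz : z = v₀ <;> simp [hw, hz, one_add_one_eq_two]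
    simp only [this, expect_add, expect_const, expect_mul_left]
    simp only [expect, mul_ite, mul_one, mul_zero, ite_mul, zero_mul, tsum_ite_eq, one_mul,
      Nat.sub_zero]
    rfl
  · simp [expect_pure]

theorem expect_congestion_le (lam B η : ℕ) (t : ℕ) (e : Fin n × Fin n) :
    expect (∏ v, ((PMF.uniformOfFintype (Fin (lam - 1 + 1))).bind fun r =>
      (crossing G t e.1 e.2).held v ⟨v, lam + r, 0⟩) ^ (η * deg G v))
      (fun X => if B < X then 1 else 0) ≤ 4 ^ η / 2 ^ B := by
  set two : Multiplicative ℕ →* ℝ≥0∞ := (powersHom ℝ≥0∞) 2 with htwo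
  have htwo' : ∀ X : ℕ, two (Multiplicative.ofAdd X) = 2 ^ X := fun X => by simp [htwo]
  have h1 : ∀ p : PMF ℕ, expect p (fun X => if B < X then 1 else 0) ≤ expectHom two p / 2 ^ B := by
    intro p
    rw [div_eq_mul_inv, mul_comm]
    change _ ≤ _ * expect p _
    rw [← expect_mul_left]
    refine expect_mono fun X _ => ?_
    split_ifs with h
    · rw [htwo', mul_comm, ← div_eq_mul_inv]
      rw [ENNReal.le_div_iff_mul_le (by simp) (by simp), one_mul]
      exact pow_le_pow_right₀ one_le_two h.le
    · exact zero_le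
  refine (h1 _).trans (ENNReal.div_le_div_right ?_ _)
  rw [map_prod]
  simp only [map_pow]
  refine (Finset.prod_le_prod' fun v _ => pow_le_pow_left'
    (b := 1 + G.srw v t e.1 * G.srwStep e.1 e.2) ?_ _).trans
    (prod_one_add_pow_le _ (deg G) (fun v => ?_) ?_ η)
  · change expect _ (fun X => two (Multiplicative.ofAdd X)) ≤ _
    simp only [htwo']
    rw [expect_bind]
    refine (expect_mono (g := fun _ => 1 + G.srw v t e.1 * G.srwStep e.1 e.2) fun r _ => ?_).trans
      (expect_const _ _).le
    exact expect_crossing_held_le t lam e.1 e.2 v r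
  · exact (mul_le_mul' (PMF.coe_le_one _ _) (PMF.coe_le_one _ _)).trans (by simp)
  · simp only [← mul_assoc, ← Finset.sum_mul, sum_deg_mul_srw]
    rw [deg_mul_srwStep]
    split_ifs <;> simp

end Chernoff

section PhaseOne

/-- A finished short walk: source, length and endpoint. -/
abbrev ShortWalk (n : ℕ) := ℕ × ℕ × Fin n

/-- The finished short walks in the whole network. -/
def walks (st : Fin n → List (ℕ × ℕ)) : Multiset (ShortWalk n) :=
  ∑ v, ((st v).map fun w => (w.1, w.2, v) : List (ShortWalk n))

/-- The law of a short walk from `v`. -/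
noncomputable def walkLaw (G : SimpleGraph (Fin n)) (lam : ℕ) (v : Fin n) : PMF (ShortWalk n) :=
  (PMF.uniformOfFintype (Fin (lam - 1 + 1))).bind fun r =>
    (G.srw v (lam + r)).map fun y => (v.val, lam + r, y)

/-- The law of `c v` independent short walks from each node `v`. -/
noncomputable def fresh (G : SimpleGraph (Fin n)) (lam : ℕ) (c : Fin n → ℕ) :
    PMF (Multiset (ShortWalk n)) :=
  ∏ v, ((walkLaw G lam v).map fun w => {w}) ^ c v

/-- The law of the finished walks, given the state in Phase 1. -/
noncomputable def finishing (G : SimpleGraph (Fin n)) : TokenLaw G (Multiset (ShortWalk n)) where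
  done v w := PMF.pure {(w.1, w.2, v)}
  queued _ u t := (G.srw u (t.len - t.cnt - 1)).map fun y => {(t.src, t.len, y)}
  held v t := (G.srw v (t.len - t.cnt)).map fun y => {(t.src, t.len, y)}
  held_done v t h := by simp [Nat.sub_eq_zero_of_le h, SimpleGraph.srw, PMF.pure_map]
  held_step v t h := by
    rw [show t.len - t.cnt = t.len - t.cnt - 1 + 1 by omega, srw_succ', PMF.map_bind]
    simp

theorem sum_singleton_coe (l : List α) : (l.map fun a => ({a} : Multiset α)).sum = (l : Multiset α) := by
  induction l with
  | nil => rfl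
  | cons a l ih => rw [List.map_cons, List.sum_cons, ih]; rfl

theorem finishing_total {σ : Fin n → Pool n} (h : AllDone σ) :
    (finishing G).total σ = PMF.pure (walks fun v => (σ v).stored) := by
  simp only [TokenLaw.total, TokenLaw.node, show ∀ v u, (σ v).queue u = [] from h, List.map_nil,
    List.prod_nil, Finset.prod_const_one, mul_one]
  simp only [finishing, conv_list_prod_pure _ (fun w : ℕ × ℕ => ({(w.1, w.2, _)} : Multiset (ShortWalk n))),
    conv_prod_pure, walks]
  congr 1
  refine Finset.sum_congr rfl fun v _ => ?_
  rw [← sum_singleton_coe, List.map_map]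
  rfl

/-- The Phase 1 memory at the beginning. -/
def emptyPool (n : ℕ) : Pool n := ⟨[], fun _ => []⟩

theorem phaseOne_runs (hG : G.Connected) (hadj : ∀ v, ∃ u, G.Adj v u) {s : Fin n} {ℓ : ℕ}
    {P : Params} (hslots : 0 < P.slots) (hlam : 0 < P.lam)
    (hb : ∀ t : Token, GoodWalk n P.lam (t.src, t.len) → t.cnt < t.len → msgBits t.msg ≤ b)
    (hb' : 2 ≤ b) :
    ∃ μ : PMF (ℕ × (Fin n → List (ℕ × ℕ))),
      Runs G b (fun v => phaseOne (input G s ℓ v) P) μ ∧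
      (∀ x ∈ μ.support, (∀ v, ∀ w ∈ x.2 v, GoodWalk n P.lam w) ∧
        x.1 ≤ 2 * P.lam * P.eta * n ^ 2 * (2 * P.lam * P.slots + G.diam)) ∧
      (μ.map fun x => walks x.2) = fresh G P.lam (fun v => P.eta * deg G v) ∧
      μ.toOuterMeasure {x | 2 * P.lam * P.slots + G.diam < x.1} ≤
        (2 * P.lam : ℕ) * (n ^ 2 : ℕ) * (4 ^ P.eta / 2 ^ P.slots) := by
  set ν := independent n fun v => launchLaw G P.lam v (P.eta * deg G v) (emptyPool n) with hν
  have hsup : ∀ σ ∈ ν.support, (∀ v, PoolOK G P.lam v (σ v)) ∧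
      remainingSteps σ ≤ 2 * P.lam * P.eta * n ^ 2 ∧ AllCount 0 σ := by
    intro σ hσ
    have hs := fun v => launchLaw_support hlam (hadj v) (P.eta * deg G v) (emptyPool n)
      (by simp [PoolOK, emptyPool]) (by simp [emptyPool]) (mem_support_independent hσ v)
    refine ⟨fun v => (hs v).1, ?_, fun v => (hs v).2.2⟩
    have h1 : ∀ v ∈ Finset.univ, (σ v).remaining ≤ 2 * P.lam * P.eta * n := fun v _ => by
      refine (hs v).2.1.trans ?_
      have h0 : (emptyPool n).remaining = 0 := by simp [Pool.remaining, emptyPool]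
      have h2 : deg G v ≤ n := by
        classical
        exact (Finset.card_le_univ _).trans (by simp)
      rw [h0, zero_add]
      calc P.eta * deg G v * (2 * P.lam) ≤ P.eta * n * (2 * P.lam) := by gcongr
        _ = _ := by ring
    refine (Finset.sum_le_card_nsmul _ _ _ h1).trans (le_of_eq ?_)
    simp; ring
  have hnode : ∀ (M : Type) [AddCommMonoid M] (L : TokenLaw G M), ν.bind L.total =
      ∏ v, ((PMF.uniformOfFintype (Fin (P.lam - 1 + 1))).bind fun r =>
        L.held v ⟨v, P.lam + r, 0⟩) ^ (P.eta * deg G v) := by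
    intro M _ L
    rw [show L.total = fun σ => ∏ v, L.node v (σ v) from rfl, hν, independent_bind_prod _ L.node]
    refine Finset.prod_congr rfl fun v _ => ?_
    rw [TokenLaw.launchLaw_bind]
    simp [TokenLaw.node, emptyPool]
  have key : ∀ σ : Fin n → Pool n, ∃ μ : PMF (ℕ × (Fin n → Pool n)), σ ∈ ν.support → _ := fun σ => by
    by_cases h : σ ∈ ν.support
    · obtain ⟨h1, h2, h3⟩ := hsup σ h
      obtain ⟨μ, hμ⟩ := blocks_runs (s := s) (ℓ := ℓ) hG hadj hslots hlam hb hb' _ h1 h2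
      exact ⟨μ, fun _ => hμ⟩
    · exact ⟨PMF.pure (0, σ), fun h' => absurd h' h⟩
  choose μ hμ using key
  have hruns : Runs G b (fun v => phaseOne (input G s ℓ v) P)
      (ν.bind fun σ => (μ σ).map fun x => (x.1, fun v => (x.2 v).stored)) := by
    refine Runs.bind_local (p := fun v => launch (input G s ℓ v) P
        (P.eta * (input G s ℓ v).nbrs.length) (emptyPool n))
      (k := fun v pool => do
        let pool ← blocks (input G s ℓ v) P (2 * P.lam * P.eta * n ^ 2) pool
        return pool.stored) (fun v => ?_) fun σ hσ => ?_
    · have := local_launch (s := s) (ℓ := ℓ) (hadj v) P (P.eta * deg G v) (emptyPool n)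
      rwa [length_nbrs]
    · refine ((hμ σ hσ).1.bind (k := fun v pool => return pool.stored)
        (ν := fun σ' => PMF.pure (0, fun v => (σ' v).stored)) fun x _ => Runs.ret _).congr ?_
      simp only [seqLaw, PMF.pure_map, add_zero]
      rfl
  refine ⟨_, hruns, ?_, ?_, ?_⟩
  · intro x hx
    simp only [PMF.mem_support_bind_iff, PMF.mem_support_map_iff] at hx
    obtain ⟨σ, hσ, y, hy, rfl⟩ := hx
    obtain ⟨h1, -, h2⟩ := (hμ σ hσ).2.1 y hy
    exact ⟨fun v => (h1 v).1, h2⟩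
  · have h1 := hnode _ (finishing G)
    have h2 : (∏ v, ((PMF.uniformOfFintype (Fin (P.lam - 1 + 1))).bind fun r =>
        (finishing G).held v ⟨v, P.lam + r, 0⟩) ^ (P.eta * deg G v)) =
        fresh G P.lam (fun v => P.eta * deg G v) := by
      simp only [fresh, walkLaw, finishing, PMF.map_bind, PMF.map_comp, Nat.sub_zero,
        Function.comp_def]
    rw [← h2, ← h1]
    simp only [PMF.map_bind, PMF.map_comp, Function.comp_def]
    refine ext_of_expect fun f => ?_
    rw [expect_bind, expect_bind]
    refine expect_congr fun σ hσ => ?_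
    rw [← (hμ σ hσ).2.2.1 _ (finishing G) (fun v u t => by
      simp only [finishing, Token.incr, Nat.sub_sub]), expect_map, expect_bind]
    refine expect_congr fun x hx => ?_
    rw [finishing_total ((hμ σ hσ).2.1 x hx).2.1, expect_pure]
  · rw [toOuterMeasure_eq_expect, expect_bind]
    refine (expect_mono (g := congestionBound G P.lam P.slots 0) fun σ hσ => ?_).trans ?_
    · refine le_trans (le_of_eq ?_) ((hμ σ hσ).2.2.2 (hsup σ hσ).2.2)
      rw [expect_map, toOuterMeasure_eq_expect]
      rfl
    · unfold congestionBound
      rw [expect_sum]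
      simp only [expect_sum, ← expect_bind]
      simp only [hnode]
      refine (Finset.sum_le_sum fun t _ => Finset.sum_le_sum fun e _ =>
        expect_congestion_le P.lam P.slots P.eta t e).trans (le_of_eq ?_)
      simp only [Finset.sum_const, Finset.card_univ, Fintype.card_prod, Fintype.card_fin,
        Nat.card_Ico, Nat.sub_zero, nsmul_eq_mul]
      rw [mul_assoc, ← pow_two]

end PhaseOne

section Merge

/-- Total count of several samples. -/
def sampleTotal (cs : List Sample) : ℕ := (cs.map Sample.count).sum

/-- Weighted sum over several samples. -/
noncomputable def weighted (φ : ℕ → ℕ → ℝ≥0∞) (cs : List Sample) : ℝ≥0∞ :=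
  (cs.map fun c => (c.count : ℝ≥0∞) * φ c.owner c.len).sum

open scoped Classical in
/-- The law of `pick`. -/
noncomputable def pickLaw (l : List β) : PMF (Option β) :=
  if h : (l : Multiset β) ≠ 0 then (PMF.ofMultiset (l : Multiset β) h).map some else PMF.pure none

theorem local_pick' (l : List β) : Local (pick l : Prog n (Option β)) (pickLaw l) := by
  unfold pickLaw
  split_ifs with h
  · exact local_pick l h
  · rw [not_not, Multiset.coe_eq_zero] at h
    subst h
    exact local_pick_nil

theorem expect_pickLaw {l : List β} (hl : l ≠ []) (f : Option β → ℝ≥0∞) :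
    expect (pickLaw l) f = (l.map fun a => f (some a)).sum / l.length := by
  have h : (l : Multiset β) ≠ 0 := by rwa [ne_eq, Multiset.coe_eq_zero]
  rw [pickLaw, dif_pos h, expect_map, expect_ofMultiset]
  simp

theorem mem_support_pickLaw {l : List β} {o : Option β} (h : o ∈ (pickLaw l).support) :
    (o = none ∧ l = []) ∨ ∃ a ∈ l, o = some a := by
  unfold pickLaw at h
  split_ifs at h with hl
  · rw [PMF.mem_support_map_iff] at h
    obtain ⟨a, ha, rfl⟩ := h
    rw [PMF.mem_support_ofMultiset_iff] at ha
    exact Or.inr ⟨a, by simpa using ha, rfl⟩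
  · rw [not_not, Multiset.coe_eq_zero] at hl
    simp only [PMF.support_pure, Set.mem_singleton_iff] at h
    exact Or.inl ⟨h, hl⟩

/-- The law of `merge`. -/
noncomputable def mergeLaw (cs : List Sample) : PMF (Option Sample) :=
  (pickLaw (cs.flatMap fun c => List.replicate c.count c)).map fun c =>
    c.map fun c => { c with count := sampleTotal cs }

theorem local_merge (cs : List Sample) : Local (merge cs : Prog n (Option Sample)) (mergeLaw cs) :=
  ((local_pick' _).bind fun _ => Local.ret _).congr (by rfl)

theorem length_copies (cs : List Sample) :
    (cs.flatMap fun c => List.replicate c.count c).length = sampleTotal cs := by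
  rw [List.length_flatMap]; simp [sampleTotal]

theorem sum_copies (cs : List Sample) (φ : ℕ → ℕ → ℝ≥0∞) :
    ((cs.flatMap fun c => List.replicate c.count c).map fun c => φ c.owner c.len).sum =
      weighted φ cs := by
  induction cs with
  | nil => rfl
  | cons c cs ih =>
    rw [List.flatMap_cons, List.map_append, List.sum_append, ih]
    simp [weighted]

theorem expect_mergeLaw (cs : List Sample) (φ : ℕ → ℕ → ℝ≥0∞) :
    expect (mergeLaw cs) (fun o => weighted φ o.toList) = weighted φ cs := by
  rw [mergeLaw, expect_map]
  by_cases h : (cs.flatMap fun c => List.replicate c.count c) = []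
  · rw [← sum_copies, h, pickLaw, dif_neg (by simp), expect_pure]
    simp [weighted]
  · have h0 : sampleTotal cs ≠ 0 := by
      rw [← length_copies]; exact fun h' => h (List.length_eq_zero_iff.1 h')
    rw [expect_pickLaw h, length_copies, ← sum_copies]
    simp only [weighted, Option.map_some, Option.toList_some, List.map_cons, List.map_nil,
      List.sum_cons, List.sum_nil, add_zero, List.sum_map_mul_left]
    rw [mul_comm, ENNReal.mul_div_cancel_right (by simpa using h0) (by simp)]

theorem mem_support_mergeLaw {cs : List Sample} {o : Option Sample}
    (h : o ∈ (mergeLaw cs).support) : (o = none ∧ sampleTotal cs = 0) ∨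
      ∃ c ∈ cs, o = some ⟨c.owner, c.len, sampleTotal cs⟩ ∧ sampleTotal cs ≠ 0 := by
  rw [mergeLaw, PMF.mem_support_map_iff] at h
  obtain ⟨a, ha, rfl⟩ := h
  rcases mem_support_pickLaw ha with ⟨rfl, hl⟩ | ⟨c, hc, rfl⟩
  · left
    exact ⟨rfl, by rw [← length_copies, hl]; rfl⟩
  · right
    obtain ⟨c', hc', hcc⟩ := List.mem_flatMap.1 hc
    rw [List.eq_of_mem_replicate hcc]
    refine ⟨c', hc', rfl, ?_⟩
    rw [← length_copies]
    intro h
    rw [List.length_eq_zero_iff.1 h] at hc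
    simp at hc

theorem sampleTotal_mergeLaw {cs : List Sample} {o : Option Sample}
    (h : o ∈ (mergeLaw cs).support) : sampleTotal o.toList = sampleTotal cs := by
  rcases mem_support_mergeLaw h with ⟨rfl, h0⟩ | ⟨c, -, rfl, -⟩
  · rw [h0]; rfl
  · simp [sampleTotal]

end Merge

section UpSweep

variable (lev : Fin n → ℕ) (par : Fin n → Option (Fin n))

open scoped Classical in
theorem filterMap_arrivals_sample (c : Fin n → Option Sample) (v : Fin n) :
    (arrivals (deliver G (fun u w => if par u = some w then (c u).map Sample.msg else none) v)).filterMap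
      (fun a => Sample.ofMsg a.2) = (List.finRange n).filterMap fun u =>
        if G.Adj u v ∧ par u = some v then c u else none := by
  rw [arrivals, List.filterMap_filterMap]
  congr 1; funext u
  unfold deliver
  by_cases h1 : G.Adj u v <;> by_cases h2 : par u = some v
  · simp only [h1, h2, if_true, and_self]
    cases c u <;> rfl
  · simp [h1, h2]
  · simp [h1]
  · simp [h1]

variable {lev par}

open scoped Classical in
theorem sum_children {M : Type} [AddCommMonoid M]
    (htree : ∀ v, lev v ≠ 0 → ∃ u, par v = some u ∧ G.Adj u v ∧ lev u + 1 = lev v) (i : ℕ)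
    (c : Fin n → Option Sample) (hc : ∀ v, lev v ≠ i + 1 → c v = none) (X : Sample → M)
    (cs : Fin n → List Sample) :
    ∑ v with lev v ≤ i, ((cs v ++ (List.finRange n).filterMap fun u =>
        if G.Adj u v ∧ par u = some v then c u else none).map X).sum =
      ∑ v with lev v ≤ i, ((cs v).map X).sum +
        ∑ v with lev v = i + 1, ((c v).toList.map X).sum := by
  simp only [List.map_append, List.sum_append, Finset.sum_add_distrib, sum_map_filterMap_finRange]
  congr 1
  rw [Finset.sum_comm, Finset.sum_filter]
  refine Finset.sum_congr rfl fun u _ => ?_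
  split_ifs with h
  · obtain ⟨w, hw, hadj, hlev⟩ := htree u (by omega)
    rw [Finset.sum_eq_single_of_mem w (by simp; omega)]
    · rw [if_pos ⟨hadj.symm, hw⟩]
    · intro v _ hv
      rw [if_neg]
      · rfl
      · rintro ⟨-, h'⟩
        rw [hw] at h'
        exact hv (Option.some.inj h').symm
  · refine Finset.sum_eq_zero fun v _ => ?_
    rw [hc u h]
    simp

theorem expect_independent_apply (ν : Fin n → PMF β) (v : Fin n) (f : β → ℝ≥0∞) :
    expect (independent n ν) (fun σ => f (σ v)) = expect (ν v) f := by
  rw [← independent_map_apply ν v, expect_map]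

theorem upSweep_runs {ok : ℕ → ℕ → Prop} {N : ℕ}
    (hb : ∀ c : Sample, ok c.owner c.len → c.count ≤ N → msgBits c.msg ≤ b)
    (htree : ∀ v, lev v ≠ 0 → ∃ u, par v = some u ∧ G.Adj u v ∧ lev u + 1 = lev v) (i : ℕ) :
    ∀ cs : Fin n → List Sample, (∀ v, ∀ c ∈ cs v, ok c.owner c.len) →
      ∑ v with lev v ≤ i, sampleTotal (cs v) ≤ N →
    ∃ ν : PMF (Fin n → List Sample),
      Runs G b (fun v => upSweep (lev v) (par v) i (cs v)) (ν.map fun r => (i, r)) ∧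
      (∀ cs' ∈ ν.support, (∀ v, ∀ c ∈ cs' v, ok c.owner c.len) ∧
        ∑ v with lev v ≤ 0, sampleTotal (cs' v) = ∑ v with lev v ≤ i, sampleTotal (cs v)) ∧
      ∀ φ, expect ν (fun cs' => ∑ v with lev v ≤ 0, weighted φ (cs' v)) =
        ∑ v with lev v ≤ i, weighted φ (cs v) := by
  classical
  induction i with
  | zero =>
    intro cs hcs _
    refine ⟨PMF.pure cs, (Runs.ret cs).time_pure, ?_, fun φ => expect_pure _ _⟩
    intro cs' h
    simp only [PMF.support_pure, Set.mem_singleton_iff] at h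
    subst h
    exact ⟨hcs, rfl⟩
  | succ i ih =>
    intro cs hcs hN
    set ρ : Fin n → PMF (Option Sample) := fun v =>
      if lev v = i + 1 then mergeLaw (cs v) else PMF.pure none with hρ
    have hsplit : ∀ {M : Type} [AddCommMonoid M] (X : Fin n → M), ∑ v with lev v ≤ i + 1, X v =
        ∑ v with lev v ≤ i, X v + ∑ v with lev v = i + 1, X v := by
      intro M _ X
      rw [← Finset.sum_union (Finset.disjoint_filter.2 fun v _ h => by omega)]
      congr 1
      ext v
      simp only [Finset.mem_filter, Finset.mem_univ, true_and, Finset.mem_union]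
      omega
    set cs₁ : (Fin n → Option Sample) → Fin n → List Sample := fun c v => cs v ++
      (List.finRange n).filterMap fun u => if G.Adj u v ∧ par u = some v then c u else none with hcs₁
    have hsup : ∀ c ∈ (independent n ρ).support, (∀ v, lev v ≠ i + 1 → c v = none) ∧
        (∀ v, ∀ a, c v = some a → ok a.owner a.len ∧ a.count ≤ N) ∧
        (∀ v, ∀ a ∈ cs₁ c v, ok a.owner a.len) ∧
        ∑ v with lev v ≤ i, sampleTotal (cs₁ c v) = ∑ v with lev v ≤ i + 1, sampleTotal (cs v) := by
      intro c hc
      have hv := fun v => mem_support_independent hc v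
      have h1 : ∀ v, lev v ≠ i + 1 → c v = none := fun v h => by simpa [hρ, h] using hv v
      have h2 : ∀ v, ∀ a, c v = some a → ok a.owner a.len ∧ a.count ≤ N := by
        intro v a ha
        by_cases h : lev v = i + 1
        · have hv := hv v
          simp only [hρ, h, if_true, ha] at hv
          rcases mem_support_mergeLaw hv with ⟨h', -⟩ | ⟨c', hc', h', -⟩
          · simp at h'
          · rw [Option.some.inj h']
            refine ⟨hcs v c' hc', le_trans ?_ hN⟩
            exact Finset.single_le_sum (f := fun v => sampleTotal (cs v)) (fun _ _ => Nat.zero_le _)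
              (by simp [h])
        · rw [h1 v h] at ha; simp at ha
      refine ⟨h1, h2, ?_, ?_⟩
      · intro v a ha
        rcases List.mem_append.1 ha with ha | ha
        · exact hcs v a ha
        · obtain ⟨u, -, hu⟩ := List.mem_filterMap.1 ha
          split_ifs at hu
          exact (h2 u a hu).1
      · rw [hsplit]
        refine (sum_children htree i c h1 Sample.count cs).trans ?_
        congr 1
        refine Finset.sum_congr rfl fun v h => ?_
        have hv := hv v
        simp only [hρ, (Finset.mem_filter.1 h).2, if_true] at hv
        exact sampleTotal_mergeLaw hv
    have key : ∀ c : Fin n → Option Sample, ∃ ν : PMF (Fin n → List Sample),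
        c ∈ (independent n ρ).support → _ := fun c => by
      by_cases h : c ∈ (independent n ρ).support
      · obtain ⟨ν, hν⟩ := ih (cs₁ c) (hsup c h).2.2.1 ((hsup c h).2.2.2.le.trans hN)
        exact ⟨ν, fun _ => hν⟩
      · exact ⟨PMF.pure cs, fun h' => absurd h' h⟩
    choose ν hν using key
    refine ⟨(independent n ρ).bind ν, ?_, ?_, ?_⟩
    · have hprog : (fun v => upSweep (lev v) (par v) (i + 1) (cs v)) = fun v =>
          (if lev v = i + 1 then merge (cs v) else pure none) >>= fun c =>
            exchange (fun u => if par v = some u then c.map Sample.msg else none) >>= fun inbox =>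
              upSweep (lev v) (par v) i
                (cs v ++ (arrivals inbox).filterMap fun a => Sample.ofMsg a.2) := by
        funext v
        rw [upSweep]
        split_ifs <;> rfl
      rw [hprog, PMF.map_bind]
      refine Runs.bind_local (fun v => ?_) fun c hc => ?_
      · simp only [hρ]
        split_ifs
        · exact local_merge _
        · exact Local.ret _
      · have hex := Runs.exchange (G := G) (b := b)
          (fun v u => if par v = some u then (c v).map Sample.msg else none) (fun u v m h => by
            split_ifs at h
            obtain ⟨a, ha, rfl⟩ := Option.map_eq_some_iff.1 h
            obtain ⟨h1, h2⟩ := (hsup c hc).2.1 u a ha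
            exact hb a h1 h2)
        have := Runs.bind_const (k := fun v inbox => upSweep (lev v) (par v) i
          (cs v ++ (arrivals inbox).filterMap fun a => Sample.ofMsg a.2)) hex (by
            simp only [filterMap_arrivals_sample]
            exact (hν c hc).1)
        rw [PMF.map_comp] at this
        refine this.congr ?_
        simp only [Function.comp_def, add_comm]
    · intro cs' h
      rw [PMF.mem_support_bind_iff] at h
      obtain ⟨c, hc, h⟩ := h
      obtain ⟨h1, h2⟩ := (hν c hc).2.1 cs' h
      exact ⟨h1, h2.trans (hsup c hc).2.2.2⟩
    · intro φ
      rw [expect_bind, expect_congr fun c hc => (hν c hc).2.2 φ, hsplit]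
      refine (expect_congr fun c hc => sum_children htree i c (hsup c hc).1
        (fun a => (a.count : ℝ≥0∞) * φ a.owner a.len) cs).trans ?_
      rw [expect_add, expect_const]
      congr 1
      rw [expect_sum]
      refine Finset.sum_congr rfl fun v h => ?_
      rw [expect_independent_apply ρ v fun o =>
        (o.toList.map fun a => (a.count : ℝ≥0∞) * φ a.owner a.len).sum]
      simp only [hρ, (Finset.mem_filter.1 h).2, if_true]
      exact expect_mergeLaw _ _

end UpSweep

section SampleDestination

/-- What a node concludes from the announced message. -/
def announced (I : Input n) (mem : Memory) (root : ℕ) : Msg → ℕ × Bool × Memory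
  | [s, v, k] => (root, true,
      { stored := if v = I.id.val then mem.stored.erase (root, k) else mem.stored
        token := if v = I.id.val then some s else none
        walked := mem.walked + k })
  | _ => (root, false, mem)

/-- The message with which the holder of the token `s` announces a sample. -/
def sampleNews (s : ℕ) : Option Sample → Msg
  | some c => [s, c.owner, c.len]
  | none => []

/-- The third sweep of Sample-Destination. -/
def announce (I : Input n) (mem : Memory) (root : ℕ) (top : Option Sample) :
    Prog n (ℕ × Bool × Memory) := do
  let h ← flood I.diam 0 (mem.token.map fun s => (⟨sampleNews s top, 0, none⟩ : Heard n))
  return announced I mem root ((h.map Heard.msg).getD [])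

/-- The second and third sweeps of Sample-Destination. -/
def sampleFrom (I : Input n) (mem : Memory) (root level : ℕ) (parent : Option (Fin n)) :
    Prog n (ℕ × Bool × Memory) := do
  let d ← pick (mem.stored.filter fun w => w.1 = root)
  let cs ← upSweep level parent I.diam (d.map fun w =>
    (⟨I.id.val, w.2, (mem.stored.filter fun w => w.1 = root).length⟩ : Sample)).toList
  (if mem.token.isSome then merge cs else pure none) >>= announce I mem root

theorem sampleDestination_eq (I : Input n) (mem : Memory) :
    sampleDestination I mem =
      flood I.diam 0 (if mem.token.isSome then some ⟨[I.id.val], 0, none⟩ else none) >>= fun tree =>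
        sampleFrom I mem (((tree.map Heard.msg).getD []).headD 0) ((tree.map Heard.level).getD 0)
          (tree.bind Heard.parent) := by
  unfold sampleDestination sampleFrom announce
  congr 1; funext tree
  dsimp only
  congr 1; funext d
  congr 1; funext cs
  split_ifs <;>
  · refine congrArg (_ >>= ·) (funext fun top => ?_)
    refine congrArg₂ (· >>= ·) (by cases top <;> rfl) (funext fun h => ?_)
    generalize (h.map Heard.msg).getD [] = m
    rcases m with _ | ⟨_, _ | ⟨_, _ | ⟨_, _ | _⟩⟩⟩ <;> rfl

/-- The memory after the announcement of the sample `c`, at node `v`. -/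
def Memory.move (src root : ℕ) (c : Sample) (v : Fin n) (mem : Memory) : Memory where
  stored := if c.owner = v.val then mem.stored.erase (root, c.len) else mem.stored
  token := if c.owner = v.val then some src else none
  walked := mem.walked + c.len

/-- The result of Sample-Destination at node `v`. -/
def sampleResult (src root : ℕ) (mem : Fin n → Memory) (o : Option Sample) (v : Fin n) :
    ℕ × Bool × Memory :=
  match o with
  | some c => (root, true, (mem v).move src root c v)
  | none => (root, false, mem v)

/-- Node `x` holds the token. -/
def Holds (src : ℕ) (x : Fin n) (mem : Fin n → Memory) : Prop :=
  ∀ v, (mem v).token = if v = x then some src else none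

theorem announce_runs (hG : G.Connected) {s : Fin n} {ℓ : ℕ} {src : ℕ} {x : Fin n}
    {mem : Fin n → Memory} (hx : Holds src x mem) (root : ℕ) (top : Fin n → Option Sample)
    (hb : ∀ c, top x = some c → msgBits [src, c.owner, c.len] ≤ b) (hb' : 2 ≤ b) :
    Runs G b (fun v => announce (input G s ℓ v) (mem v) root (top v))
      (PMF.pure (G.diam, sampleResult src root mem (top x))) := by
  obtain ⟨h', hr, hs⟩ := flood_root (b := b) hG (root := x) (m := sampleNews src (top x)) (by
      cases ht : top x with
      | none => exact hb'
      | some c => exact hb c ht) G.diam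
    (fun v => (mem v).token.map fun s => (⟨sampleNews s (top v), 0, none⟩ : Heard n)) (fun v => by
      rw [hx v]
      split_ifs with hv
      · subst hv; rfl
      · rfl)
  have hmsg : ∀ v, ((h' v).map Heard.msg).getD [] = sampleNews src (top x) := fun v => by
    obtain ⟨p, hp, -⟩ := (hs v).1 (dist_le_diam' hG x v)
    rw [hp]; rfl
  have := Runs.bind_const (k := fun v (h : Option (Heard n)) =>
    (pure (announced (input G s ℓ v) (mem v) root ((h.map Heard.msg).getD [])) :
      Prog n (ℕ × Bool × Memory))) hr
    (ν := PMF.pure (0, sampleResult src root mem (top x))) (by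
      simp only [hmsg]
      cases ht : top x with
      | none => exact Runs.ret _
      | some c => exact Runs.ret _)
  rw [PMF.pure_map] at this
  exact this

/-- Sample-Destination in terms of the law of the sample: its weighted expectations are sums over
all stored walks of the caller. -/
theorem sampleDestination_runs (hG : G.Connected) {s : Fin n} {ℓ : ℕ} {src : ℕ} {x : Fin n}
    {mem : Fin n → Memory} (hx : Holds src x mem) {lam N : ℕ}
    (hstored : ∀ v, ∀ w ∈ (mem v).stored, GoodWalk n lam w)
    (hN : ∑ v, ((mem v).stored.filter fun w => w.1 = x.val).length = N)
    (hb : ∀ a c d, a < n → c < 2 * lam → d ≤ max N src → msgBits [a, c, d] ≤ b)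
    (hbs : ∀ a c, a < n → c < 2 * lam → msgBits [src, a, c] ≤ b)
    (hbx : msgBits [x.val] ≤ b) (hb' : 2 ≤ b) :
    ∃ ρ : PMF (Option Sample),
      Runs G b (fun v => sampleDestination (input G s ℓ v) (mem v))
        (ρ.map fun o => (3 * G.diam, sampleResult src x mem o)) ∧
      (∀ o ∈ ρ.support, (o = none ∧ N = 0) ∨
        ∃ c, o = some c ∧ c.owner < n ∧ (lam ≤ c.len ∧ c.len < 2 * lam) ∧ c.count = N ∧ N ≠ 0) ∧
      ∀ φ, expect ρ (fun o => weighted φ o.toList) =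
        ∑ v, (((mem v).stored.filter fun w => w.1 = x.val).map fun w => φ v w.2).sum := by
  classical
  set own : Fin n → List (ℕ × ℕ) := fun v => (mem v).stored.filter fun w => w.1 = x.val with hown
  obtain ⟨tree, htr, htree⟩ := flood_root (b := b) hG (root := x) (m := [x.val]) hbx G.diam
    (fun v => if (mem v).token.isSome then some ⟨[v.val], 0, none⟩ else none) (fun v => by
      rw [hx v]
      by_cases h : v = x
      · simp [h]
      · simp [h])
  choose par hpar hpar' using fun v => (htree v).1 (dist_le_diam' hG x v)
  set lev : Fin n → ℕ := fun v => G.dist x v with hlev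
  have hlev0 : ∀ v, lev v ≤ 0 ↔ v = x := fun v => by
    rw [Nat.le_zero, hlev]
    exact (hG.dist_eq_zero_iff).trans eq_comm
  have htree' : ∀ v, lev v ≠ 0 → ∃ u, par v = some u ∧ G.Adj u v ∧ lev u + 1 = lev v := fun v hv =>
    hpar' v fun h => by subst h; simp [hlev] at hv
  have hlevD : (Finset.univ.filter fun v => lev v ≤ G.diam) = Finset.univ :=
    Finset.filter_true_of_mem fun v _ => dist_le_diam' hG x v
  have hlevx : (Finset.univ.filter fun v => lev v ≤ 0) = {x} := by
    ext v; simp only [Finset.mem_filter, Finset.mem_univ, true_and, Finset.mem_singleton, hlev0]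
  set cs₀ : (Fin n → Option (ℕ × ℕ)) → Fin n → List Sample := fun d v =>
    ((d v).map fun w => (⟨v.val, w.2, (own v).length⟩ : Sample)).toList with hcs₀
  set ok : ℕ → ℕ → Prop := fun a c => a < n ∧ lam ≤ c ∧ c < 2 * lam with hok
  set ρ₁ := independent n fun v => pickLaw (own v) with hρ₁
  have hsup₁ : ∀ d ∈ ρ₁.support, (∀ v, ∀ c ∈ cs₀ d v, ok c.owner c.len) ∧
      ∑ v with lev v ≤ G.diam, sampleTotal (cs₀ d v) = N := by
    intro d hd
    have hd' := fun v => mem_support_pickLaw (mem_support_independent hd v)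
    constructor
    · intro v c hc
      rcases hd' v with ⟨h, -⟩ | ⟨w, hw, h⟩
      · simp [hcs₀, h] at hc
      · simp only [hcs₀, h, Option.map_some, Option.toList_some, List.mem_singleton] at hc
        subst hc
        obtain ⟨-, h2, h3⟩ := hstored v w (List.mem_of_mem_filter hw)
        exact ⟨v.2, h2, h3⟩
    · rw [hlevD, ← hN]
      refine Finset.sum_congr rfl fun v _ => ?_
      rcases hd' v with ⟨h, h'⟩ | ⟨w, hw, h⟩
      · simp only [hcs₀, h, hown, Option.map_none, Option.toList_none, sampleTotal, List.map_nil,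
          List.sum_nil]
        rw [show ((mem v).stored.filter fun w => w.1 = x.val) = [] from h']; rfl
      · simp [hcs₀, h, sampleTotal, hown]
  have key : ∀ d : Fin n → Option (ℕ × ℕ), ∃ ν : PMF (Fin n → List Sample),
      d ∈ ρ₁.support → _ := fun d => by
    by_cases h : d ∈ ρ₁.support
    · obtain ⟨ν, hν⟩ := upSweep_runs (b := b) (lev := lev) (par := par) (N := N) (ok := ok)
        (fun c h1 h2 => hb _ _ _ h1.1 h1.2.2 (h2.trans (le_max_left _ _))) htree' G.diam (cs₀ d)
        (hsup₁ d h).1 (hsup₁ d h).2.le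
      exact ⟨ν, fun _ => hν⟩
    · exact ⟨PMF.pure (cs₀ d), fun h' => absurd h' h⟩
  choose ν hν using key
  have hsup₂ : ∀ d ∈ ρ₁.support, ∀ cs ∈ (ν d).support, ∀ o ∈ (mergeLaw (cs x)).support,
      (o = none ∧ N = 0) ∨ ∃ c, o = some c ∧ c.owner < n ∧ (lam ≤ c.len ∧ c.len < 2 * lam) ∧
        c.count = N ∧ N ≠ 0 := by
    intro d hd cs hcs o ho
    obtain ⟨h1, h2⟩ := (hν d hd).2.1 cs hcs
    rw [(hsup₁ d hd).2, hlevx, Finset.sum_singleton] at h2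
    rcases mem_support_mergeLaw ho with ⟨h3, h4⟩ | ⟨c, hc, h3, h4⟩
    · exact Or.inl ⟨h3, h2.symm.trans h4⟩
    · obtain ⟨h5, h6⟩ := h1 x c hc
      exact Or.inr ⟨_, h3, h5, h6, h2, fun h => h4 (h2.trans h)⟩
  refine ⟨ρ₁.bind fun d => (ν d).bind fun cs => mergeLaw (cs x), ?_, ?_, ?_⟩
  · simp only [sampleDestination_eq]
    have hann : ∀ d ∈ ρ₁.support, ∀ cs ∈ (ν d).support, Runs G b
        (fun v => (if (mem v).token.isSome then merge (cs v) else pure none) >>=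
          announce (input G s ℓ v) (mem v) x)
        ((mergeLaw (cs x)).map fun o => (G.diam, sampleResult src x mem o)) := by
      intro d hd cs hcs
      set τ : Fin n → PMF (Option Sample) := fun v =>
        if v = x then mergeLaw (cs v) else PMF.pure none with hτ
      have hτx : τ x = mergeLaw (cs x) := by simp [hτ]
      refine (Runs.bind_local (ν := τ) (μ := fun t => PMF.pure (G.diam, sampleResult src x mem (t x)))
        (fun v => ?_) fun t ht => ?_).congr ?_
      · rw [hx v]
        simp only [hτ]
        split_ifs with h1 h2 h2
        · exact local_merge _
        · simp at h2
        · simp at h2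
        · exact Local.ret _
      · refine announce_runs hG hx x.val t (fun c hc => ?_) hb'
        have := mem_support_independent ht x
        rw [hτx, hc] at this
        rcases hsup₂ d hd cs hcs _ this with ⟨h, -⟩ | ⟨c', h, h1, h2, -⟩
        · simp at h
        · rw [Option.some.inj h]
          exact hbs _ _ h1 h2.2
      · rw [← hτx, ← independent_map_apply τ x, PMF.map_comp]
        rfl
    have hsf : Runs G b (fun v => sampleFrom (input G s ℓ v) (mem v) x (lev v) (par v))
        (ρ₁.bind fun d => (ν d).bind fun cs => (mergeLaw (cs x)).map fun o =>
          (2 * G.diam, sampleResult src x mem o)) := by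
      refine Runs.bind_local (fun v => local_pick' _) fun d hd => ?_
      refine ((hν d hd).1.bind (k := fun v cs =>
        (if (mem v).token.isSome then merge cs else pure none) >>=
          announce (input G s ℓ v) (mem v) x) (ν := fun cs => (mergeLaw (cs x)).map fun o =>
            (G.diam, sampleResult src x mem o)) fun y hy => ?_).congr ?_
      · rw [PMF.mem_support_map_iff] at hy
        obtain ⟨cs, hcs, rfl⟩ := hy
        exact hann d hd cs hcs
      · simp only [seqLaw, PMF.bind_map, PMF.map_comp, Function.comp_def, two_mul]
    have := Runs.bind_const (k := fun v (tree : Option (Heard n)) =>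
      sampleFrom (input G s ℓ v) (mem v) (((tree.map Heard.msg).getD []).headD 0)
        ((tree.map Heard.level).getD 0) (tree.bind Heard.parent)) htr (by
      simp only [hpar]
      exact hsf)
    refine this.congr ?_
    simp only [PMF.map_bind, PMF.map_comp, Function.comp_def]
    rw [show 3 * G.diam = G.diam + 2 * G.diam by ring]
  · intro o ho
    simp only [PMF.mem_support_bind_iff] at ho
    obtain ⟨d, hd, cs, hcs, ho⟩ := ho
    exact hsup₂ d hd cs hcs o ho
  · intro φ
    simp only [expect_bind, expect_mergeLaw]
    have h1 : ∀ d ∈ ρ₁.support, expect (ν d) (fun cs => weighted φ (cs x)) =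
        ∑ v, weighted φ (cs₀ d v) := fun d hd => by
      have := (hν d hd).2.2 φ
      simpa only [hlevx, hlevD, Finset.sum_singleton] using this
    rw [expect_congr h1, expect_sum]
    refine Finset.sum_congr rfl fun v _ => ?_
    rw [hρ₁, expect_independent_apply _ v fun o : Option (ℕ × ℕ) => weighted φ
      ((o.map fun w => (⟨v.val, w.2, (own v).length⟩ : Sample)).toList)]
    by_cases h : own v = []
    · have h' : ((mem v).stored.filter fun w => w.1 = x.val) = [] := h
      rw [h', h, pickLaw, dif_neg (by simp), expect_pure]
      simp [weighted]
    · rw [expect_pickLaw h]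
      simp only [weighted, Option.map_some, Option.toList_some, List.map_cons, List.map_nil,
        List.sum_cons, List.sum_nil, add_zero, List.sum_map_mul_left]
      rw [mul_comm, ENNReal.mul_div_cancel_right (by simpa using h) (by simp)]

end SampleDestination

section Scatter

/-- The law of `scatter` at node `v`. -/
noncomputable def scatterLaw (G : SimpleGraph (Fin n)) (v : Fin n) : ℕ → PMF (Fin n → ℕ)
  | 0 => PMF.pure fun _ => 0
  | c + 1 => (G.srwStep v).bind fun u => (scatterLaw G v c).map fun f =>
      Function.update f u (f u + 1)

theorem local_scatter {s : Fin n} {ℓ : ℕ} {v : Fin n} (hv : ∃ u, G.Adj v u) (c : ℕ) :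
    Local (scatter (input G s ℓ v) c) (scatterLaw G v c) := by
  induction c with
  | zero => exact Local.ret _
  | succ c ih =>
    rw [scatter]
    refine ((local_pick_nbrs hv).bind fun o => ih.bind fun f => Local.ret _).congr ?_
    rw [PMF.bind_map]
    rfl

theorem scatterLaw_bind {M : Type} [AddCommMonoid M] (v : Fin n) (B : Fin n → PMF M) (c : ℕ) :
    (scatterLaw G v c).bind (fun f => ∏ u, B u ^ f u) = ((G.srwStep v).bind B) ^ c := by
  induction c with
  | zero => simp [scatterLaw]
  | succ c ih =>
    have h : ∀ (f : Fin n → ℕ) (u : Fin n),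
        ∏ w, B w ^ Function.update f u (f u + 1) w = B u * ∏ w, B w ^ f w := by
      intro f u
      rw [← Finset.mul_prod_erase _ _ (Finset.mem_univ u),
        ← Finset.mul_prod_erase _ (fun w => B w ^ f w) (Finset.mem_univ u),
        Finset.prod_congr rfl fun w hw => by rw [Function.update_of_ne (Finset.ne_of_mem_erase hw)]]
      rw [Function.update_self, pow_succ', mul_assoc]
    simp only [scatterLaw, PMF.bind_bind, PMF.bind_map, Function.comp_def, h]
    simp only [← conv_bind_right, ih]
    rw [← conv_bind_left, pow_succ']

theorem mem_support_scatterLaw {v : Fin n} (hv : ∃ u, G.Adj v u) {c : ℕ} : ∀ {f : Fin n → ℕ},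
    f ∈ (scatterLaw G v c).support → ∑ u, f u = c ∧ ∀ u, f u ≠ 0 → G.Adj v u := by
  induction c with
  | zero =>
    intro f hf
    simp only [scatterLaw, PMF.support_pure, Set.mem_singleton_iff] at hf
    subst hf
    simp
  | succ c ih =>
    intro f hf
    simp only [scatterLaw, PMF.mem_support_bind_iff, PMF.mem_support_map_iff] at hf
    obtain ⟨u, hu, g, hg, rfl⟩ := hf
    obtain ⟨h1, h2⟩ := ih hg
    constructor
    · rw [← Finset.add_sum_erase _ _ (Finset.mem_univ u), ← h1,
        ← Finset.add_sum_erase _ g (Finset.mem_univ u),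
        Finset.sum_congr rfl fun w hw => by rw [Function.update_of_ne (Finset.ne_of_mem_erase hw)]]
      rw [Function.update_self]; ring
    · intro w hw
      by_cases h : w = u
      · subst h; exact mem_support_srwStep hv hu
      · rw [Function.update_of_ne h] at hw
        exact h2 w hw

end Scatter

section StepCounts

open scoped Classical in
theorem sum_arrivals_counts (root : ℕ) (f : Fin n → Fin n → ℕ)
    (hf : ∀ u v, f u v ≠ 0 → G.Adj u v) (v : Fin n) :
    ((arrivals (deliver G (fun u w => if f u w = 0 then none else some [root, f u w]) v)).map
      fun a => a.2.getD 1 0).sum = ∑ u, f u v := by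
  rw [arrivals, sum_map_filterMap_finRange]
  refine Finset.sum_congr rfl fun u _ => ?_
  by_cases h : f u v = 0
  · have : deliver G (fun u w => if f u w = 0 then none else some [root, f u w]) v u = none := by
      unfold deliver; split_ifs <;> simp [h]
    rw [this, h]; rfl
  · rw [deliver_of_adj (hf u v h), if_neg h]
    simp

theorem stepCounts_runs (hadj : ∀ v, ∃ u, G.Adj v u) {s : Fin n} {ℓ root N : ℕ}
    (hb : ∀ k ≤ N, msgBits [root, k] ≤ b) (c : Fin n → ℕ) (hc : ∑ v, c v ≤ N) :
    ∃ ν : PMF (Fin n → ℕ),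
      Runs G b (fun v => stepCounts (input G s ℓ v) root (c v)) (ν.map fun r => (1, r)) ∧
      (∀ c' ∈ ν.support, ∑ v, c' v ≤ N) ∧
      ∀ (M : Type) [AddCommMonoid M] (B : Fin n → PMF M),
        ν.bind (fun c' => ∏ v, B v ^ c' v) = ∏ v, ((G.srwStep v).bind B) ^ c v := by
  set ρ := independent n fun v => scatterLaw G v (c v) with hρ
  have hsup : ∀ f ∈ ρ.support, (∀ u v, f u v ≠ 0 → G.Adj u v) ∧ ∑ v, ∑ u, f u v ≤ N := by
    intro f hf
    have hs := fun v => mem_support_scatterLaw (hadj v) (mem_support_independent hf v)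
    refine ⟨fun u => (hs u).2, ?_⟩
    rw [Finset.sum_comm]
    simpa only [fun v => (hs v).1] using hc
  refine ⟨ρ.map fun f v => ∑ u, f u v, ?_, ?_, ?_⟩
  · refine (Runs.bind_local (fun v => local_scatter (hadj v) (c v))
      (μ := fun f : Fin n → Fin n → ℕ => PMF.pure (1, fun v => ∑ u, f u v)) fun f hf => ?_).congr ?_
    · have hex := Runs.exchange (G := G) (b := b)
        (fun v u => if f v u = 0 then none else some [root, f v u]) (fun u v m h => by
          split_ifs at h
          rw [← Option.some.inj h]
          refine hb _ (le_trans ?_ (hsup f hf).2)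
          exact (Finset.single_le_sum (f := fun u => f u v) (fun _ _ => Nat.zero_le _)
            (Finset.mem_univ u)).trans (Finset.single_le_sum (f := fun v => ∑ u, f u v)
            (fun _ _ => Nat.zero_le _) (Finset.mem_univ v)))
      have := Runs.bind_const (k := fun (_ : Fin n) (inbox : Fin n → Option Msg) =>
        (pure ((arrivals inbox).map fun a => a.2.getD 1 0).sum : Prog n ℕ)) hex
        (ν := PMF.pure (0, fun v => ∑ u, f u v)) (by
          simp only [sum_arrivals_counts root f (hsup f hf).1]
          exact Runs.ret _)
      rw [PMF.pure_map] at this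
      exact this
    · rw [PMF.map_comp]; rfl
  · intro c' hc'
    rw [PMF.mem_support_map_iff] at hc'
    obtain ⟨f, hf, rfl⟩ := hc'
    exact (hsup f hf).2
  · intro M _ B
    rw [PMF.bind_map]
    simp only [Function.comp_def, ← scatterLaw_bind]
    rw [hρ, ← independent_bind_prod (fun v => scatterLaw G v (c v))
      fun _ (f : Fin n → ℕ) => ∏ u, B u ^ f u]
    congr 1; funext f
    rw [Finset.prod_comm]
    refine Finset.prod_congr rfl fun v _ => ?_
    rw [Finset.prod_pow_eq_pow_sum]

theorem walkCounts_runs (hadj : ∀ v, ∃ u, G.Adj v u) {s : Fin n} {ℓ root N : ℕ}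
    (hb : ∀ k ≤ N, msgBits [root, k] ≤ b) (k : ℕ) : ∀ c : Fin n → ℕ, ∑ v, c v ≤ N →
    ∃ ν : PMF (Fin n → ℕ),
      Runs G b (fun v => walkCounts (input G s ℓ v) root k (c v)) (ν.map fun r => (k, r)) ∧
      (∀ c' ∈ ν.support, ∑ v, c' v ≤ N) ∧
      ∀ (M : Type) [AddCommMonoid M] (B : Fin n → PMF M),
        ν.bind (fun c' => ∏ v, B v ^ c' v) = ∏ v, ((G.srw v k).bind B) ^ c v := by
  induction k with
  | zero =>
    intro c hc
    refine ⟨PMF.pure c, (Runs.ret c).time_pure, ?_, ?_⟩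
    · intro c' h
      simp only [PMF.support_pure, Set.mem_singleton_iff] at h
      rw [h]; exact hc
    · intro M _ B
      simp [SimpleGraph.srw]
  | succ k ih =>
    intro c hc
    obtain ⟨ν, h1, h2, h3⟩ := stepCounts_runs (s := s) (ℓ := ℓ) hadj hb c hc
    have key : ∀ c : Fin n → ℕ, ∃ ν' : PMF (Fin n → ℕ), c ∈ ν.support → _ := fun c => by
      by_cases h : c ∈ ν.support
      · obtain ⟨ν', hν'⟩ := ih c (h2 c h)
        exact ⟨ν', fun _ => hν'⟩
      · exact ⟨PMF.pure c, fun h' => absurd h' h⟩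
    choose ν' hν' using key
    refine ⟨ν.bind ν', ?_, ?_, ?_⟩
    · have := Runs.bind_time h1 fun r hr => (hν' r hr).1
      rw [add_comm 1 k] at this
      exact this
    · intro c'' h
      rw [PMF.mem_support_bind_iff] at h
      obtain ⟨c', hc', h⟩ := h
      exact (hν' c' hc').2.1 c'' h
    · intro M _ B
      simp only [srw_succ']
      have := h3 M fun v => (G.srw v k).bind B
      simp only [PMF.bind_bind] at this ⊢
      rw [← this]
      refine ext_of_expect fun f => ?_
      rw [expect_bind, expect_bind]
      refine expect_congr fun c' hc' => ?_
      rw [(hν' c' hc').2.2 M B]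

end StepCounts

section Reservoir

/-- The law of `thin`. -/
noncomputable def thinLaw (j : ℕ) : ℕ → PMF ℕ
  | 0 => PMF.pure 0
  | c + 1 => (PMF.uniformOfFintype (Fin (j + 1))).bind fun i => (thinLaw j c).map fun k =>
      if i.val = 0 then k + 1 else k

theorem local_thin (j c : ℕ) : Local (thin j c : Prog n ℕ) (thinLaw j c) := by
  induction c with
  | zero => exact Local.ret _
  | succ c ih =>
    rw [thin]
    refine ((Local.uniform j).bind fun i => ih.bind fun k => Local.ret _).congr ?_
    rw [PMF.bind_map]
    rfl

theorem mem_support_thinLaw {j c : ℕ} : ∀ {k : ℕ}, k ∈ (thinLaw j c).support → k ≤ c := by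
  induction c with
  | zero =>
    intro k hk
    simp only [thinLaw, PMF.support_pure, Set.mem_singleton_iff] at hk
    exact hk.le
  | succ c ih =>
    intro k hk
    simp only [thinLaw, PMF.mem_support_bind_iff, PMF.mem_support_map_iff] at hk
    obtain ⟨i, -, k', hk', rfl⟩ := hk
    have := ih hk'
    split_ifs <;> omega

theorem thinLaw_bind {M : Type} [AddCommMonoid M] (j : ℕ) (A B : PMF M) (c : ℕ) :
    (thinLaw j c).bind (fun k => A ^ k * B ^ (c - k)) =
      ((PMF.uniformOfFintype (Fin (j + 1))).bind fun i => if i.val = 0 then A else B) ^ c := by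
  induction c with
  | zero => simp [thinLaw]
  | succ c ih =>
    simp only [thinLaw, PMF.bind_bind, PMF.bind_map, Function.comp_def]
    rw [pow_succ', ← ih, conv_bind_left]
    simp only [conv_bind_right]
    congr 1; funext i
    refine ext_of_expect fun f => ?_
    rw [expect_bind, expect_bind]
    refine expect_congr fun k hk => ?_
    congr 1
    have := mem_support_thinLaw hk
    split_ifs
    · rw [show c + 1 - (k + 1) = c - k by omega, pow_succ', mul_assoc]
    · rw [show c + 1 - k = c - k + 1 by omega, pow_succ', mul_left_comm]

/-- The law of the finished walk of a token at `v` with `j` iterations of reservoir sampling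
ahead. -/
noncomputable def tailLaw (G : SimpleGraph (Fin n)) (root lam : ℕ) :
    ℕ → Fin n → PMF (Multiset (ShortWalk n))
  | 0, _ => 1
  | j + 1, v => (PMF.uniformOfFintype (Fin (j + 1))).bind fun i =>
      if i.val = 0 then PMF.pure {(root, lam + (lam - (j + 1)), v)}
      else (G.srwStep v).bind (tailLaw G root lam j)

theorem tailLaw_eq (root lam j : ℕ) (hj : j + 1 ≤ lam) (v : Fin n) :
    tailLaw G root lam (j + 1) v = (PMF.uniformOfFintype (Fin (j + 1))).bind fun r =>
      (G.srw v r).map fun y => {(root, lam + (lam - (j + 1)) + r, y)} := by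
  induction j generalizing v with
  | zero =>
    rw [tailLaw]
    congr 1; funext i
    have : i = 0 := Fin.ext (by omega)
    subst this
    simp [SimpleGraph.srw, PMF.pure_map]
  | succ j ih =>
    rw [tailLaw]
    refine ext_of_expect fun f => ?_
    rw [expect_bind, expect_bind, expect_uniformOfFintype, expect_uniformOfFintype]
    congr 1
    refine (Fin.sum_univ_succ _).trans (Eq.trans ?_ (Fin.sum_univ_succ _).symm)
    congr 1
    · simp [SimpleGraph.srw, PMF.pure_map]
    · simp only [Fin.val_succ, Nat.succ_ne_zero, if_false]
      rw [Finset.sum_const, Finset.card_univ, Fintype.card_fin, expect_bind]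
      simp only [ih (by omega), srw_succ', expect_bind, expect_map, expect_uniformOfFintype,
        Fintype.card_fin]
      rw [← expect_sum]
      simp only [div_eq_mul_inv, mul_comm _ (((j + 1 : ℕ) : ℝ≥0∞)⁻¹), expect_mul_left, nsmul_eq_mul]
      rw [← mul_assoc, ENNReal.mul_inv_cancel (by simp) (by simp), one_mul]
      refine expect_congr fun y _ => Finset.sum_congr rfl fun r _ => expect_congr fun z _ => ?_
      rw [show lam + (lam - (j + 1)) + r.val = lam + (lam - (j + 1 + 1)) + (r.val + 1) by omega]

theorem walks_append_replicate (st : Fin n → List (ℕ × ℕ)) (k : Fin n → ℕ) (w : ℕ × ℕ) :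
    PMF.pure (walks fun v => st v ++ List.replicate (k v) w) =
      PMF.pure (walks st) * ∏ v, PMF.pure ({(w.1, w.2, v)} : Multiset (ShortWalk n)) ^ k v := by
  have h1 : ∀ (a : Multiset (ShortWalk n)) (k : ℕ), PMF.pure a ^ k = PMF.pure (k • a) := by
    intro a k
    induction k with
    | zero => simp [conv_one]
    | succ k ih => rw [pow_succ, ih, conv_pure, succ_nsmul]
  simp only [h1, conv_prod_pure, conv_pure]
  congr 1
  rw [walks, walks, ← Finset.sum_add_distrib]
  refine Finset.sum_congr rfl fun v _ => ?_
  rw [List.map_append, List.map_replicate, ← Multiset.coe_add, Multiset.coe_replicate,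
    Multiset.nsmul_singleton]

theorem extend_runs (hadj : ∀ v, ∃ u, G.Adj v u) {s : Fin n} {ℓ root lam N : ℕ} (hroot : root < n)
    (hb : ∀ k ≤ N, msgBits [root, k] ≤ b) (j : ℕ) (hj : j ≤ lam) :
    ∀ (c : Fin n → ℕ) (st : Fin n → List (ℕ × ℕ)), ∑ v, c v ≤ N →
      (∀ v, ∀ w ∈ st v, GoodWalk n lam w) →
    ∃ ν : PMF (Fin n → List (ℕ × ℕ)),
      Runs G b (fun v => extend (input G s ℓ v) root lam j (c v) (st v)) (ν.map fun r => (j, r)) ∧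
      (∀ st' ∈ ν.support, ∀ v, ∀ w ∈ st' v, GoodWalk n lam w) ∧
      ν.map walks = PMF.pure (walks st) * ∏ v, tailLaw G root lam j v ^ c v := by
  induction j with
  | zero =>
    intro c st _ hst
    refine ⟨PMF.pure st, (Runs.ret st).time_pure, ?_, ?_⟩
    · intro st' h
      simp only [PMF.support_pure, Set.mem_singleton_iff] at h
      rw [h]; exact hst
    · simp [PMF.pure_map, tailLaw]
  | succ j ih =>
    intro c st hc hst
    set ρ := independent n fun v => thinLaw j (c v) with hρ
    set st₁ : (Fin n → ℕ) → Fin n → List (ℕ × ℕ) := fun k v =>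
      st v ++ List.replicate (k v) (root, lam + (lam - (j + 1))) with hst₁
    have hgood : ∀ k v, ∀ w ∈ st₁ k v, GoodWalk n lam w := by
      intro k v w hw
      rcases List.mem_append.1 hw with h | h
      · exact hst v w h
      · rw [List.eq_of_mem_replicate h]
        refine ⟨hroot, ?_, ?_⟩ <;> simp only <;> omega
    have hsum : ∀ k : Fin n → ℕ, ∑ v, (c v - k v) ≤ N := fun k =>
      (Finset.sum_le_sum fun v _ => Nat.sub_le _ _).trans hc
    choose ν₁ h1 h2 h3 using fun k : Fin n → ℕ => stepCounts_runs (s := s) (ℓ := ℓ) hadj hb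
      (fun v => c v - k v) (hsum k)
    have key : ∀ (k c' : Fin n → ℕ), ∃ ν' : PMF (Fin n → List (ℕ × ℕ)),
        c' ∈ (ν₁ k).support → _ := fun k c' => by
      by_cases h : c' ∈ (ν₁ k).support
      · obtain ⟨ν', hν'⟩ := ih (by omega) c' (st₁ k) (h2 k c' h) (hgood k)
        exact ⟨ν', fun _ => hν'⟩
      · exact ⟨PMF.pure st, fun h' => absurd h' h⟩
    choose ν' hν' using key
    refine ⟨ρ.bind fun k => (ν₁ k).bind (ν' k), ?_, ?_, ?_⟩
    · rw [PMF.map_bind]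
      refine Runs.bind_local (p := fun v => thin j (c v)) (k := fun v k => do
        let c ← stepCounts (input G s ℓ v) root (c v - k)
        extend (input G s ℓ v) root lam j c
          (st v ++ List.replicate k (root, lam + (lam - (j + 1)))))
        (fun v => local_thin j (c v)) fun k _ => ?_
      have := Runs.bind_time (k := fun v c => extend (input G s ℓ v) root lam j c (st₁ k v)) (h1 k)
        fun c' hc' => (hν' k c' hc').1
      rw [add_comm 1 j] at this
      exact this
    · intro st' h
      simp only [PMF.mem_support_bind_iff] at h
      obtain ⟨k, -, c', hc', h⟩ := h
      exact (hν' k c' hc').2.1 st' h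
    · have step : ∀ k, ((ν₁ k).bind (ν' k)).map walks = PMF.pure (walks st) *
          ∏ v, PMF.pure ({(root, lam + (lam - (j + 1)), v)} : Multiset (ShortWalk n)) ^ k v *
            ((G.srwStep v).bind (tailLaw G root lam j)) ^ (c v - k v) := by
        intro k
        rw [Finset.prod_mul_distrib, ← mul_assoc,
          ← walks_append_replicate st k (root, lam + (lam - (j + 1))), ← h3 k, conv_bind_right,
          PMF.map_bind]
        refine ext_of_expect fun f => ?_
        rw [expect_bind, expect_bind]
        refine expect_congr fun c' hc' => ?_
        rw [(hν' k c' hc').2.2]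
      rw [PMF.map_bind]
      simp only [step]
      rw [← conv_bind_right, hρ, independent_bind_prod _ fun v (k : ℕ) =>
        PMF.pure ({(root, lam + (lam - (j + 1)), v)} : Multiset (ShortWalk n)) ^ k *
            ((G.srwStep v).bind (tailLaw G root lam j)) ^ (c v - k)]
      simp only [thinLaw_bind, tailLaw]

theorem getMoreWalks_runs (hadj : ∀ v, ∃ u, G.Adj v u) {s : Fin n} {ℓ src : ℕ} {P : Params}
    (hlam : 0 < P.lam) {x : Fin n} {mem : Fin n → Memory} (hx : Holds src x mem)
    (hb : ∀ k ≤ ℓ / P.lam, msgBits [x.val, k] ≤ b)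
    (hst : ∀ v, ∀ w ∈ (mem v).stored, GoodWalk n P.lam w) :
    ∃ ν : PMF (Fin n → List (ℕ × ℕ)),
      Runs G b (fun v => getMoreWalks (input G s ℓ v) P x (mem v))
        (ν.map fun r => (2 * P.lam, fun v => { mem v with stored := r v })) ∧
      (∀ st' ∈ ν.support, ∀ v, ∀ w ∈ st' v, GoodWalk n P.lam w) ∧
      ν.map walks = PMF.pure (walks fun v => (mem v).stored) *
        ((walkLaw G P.lam x).map fun w => {w}) ^ (ℓ / P.lam) := by
  set c : Fin n → ℕ := fun v => if v = x then ℓ / P.lam else 0 with hc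
  have hc' : ∀ v, (if (mem v).token.isSome then ℓ / P.lam else 0) = c v := fun v => by
    rw [hx v, hc]
    by_cases h : v = x <;> simp [h]
  obtain ⟨ν₁, h1, h2, h3⟩ := walkCounts_runs (s := s) (ℓ := ℓ) hadj hb P.lam c (by simp [hc])
  have key : ∀ c' : Fin n → ℕ, ∃ ν' : PMF (Fin n → List (ℕ × ℕ)), c' ∈ ν₁.support → _ := fun c' => by
    by_cases h : c' ∈ ν₁.support
    · obtain ⟨ν', hν'⟩ := extend_runs (s := s) (ℓ := ℓ) hadj x.2 hb P.lam le_rfl c'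
        (fun v => (mem v).stored) (h2 c' h) hst
      exact ⟨ν', fun _ => hν'⟩
    · exact ⟨PMF.pure fun _ => [], fun h' => absurd h' h⟩
  choose ν' hν' using key
  refine ⟨ν₁.bind ν', ?_, ?_, ?_⟩
  · have hext : ∀ c' ∈ ν₁.support, Runs G b (fun v =>
        extend (input G s ℓ v) x.val P.lam P.lam (c' v) (mem v).stored >>= fun st =>
          (pure { mem v with stored := st } : Prog n Memory))
        (((ν' c').map fun r v => ({ mem v with stored := r v } : Memory)).map
          fun r => (P.lam, r)) := by
      intro c' h
      have := Runs.bind_time (hν' c' h).1 (k := fun v st =>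
        (pure { mem v with stored := st } : Prog n Memory)) (t' := 0)
        (μ := fun r => PMF.pure fun v => { mem v with stored := r v }) fun r _ =>
          (Runs.ret _).time_pure
      exact this
    have := Runs.bind_time (k := fun v c' =>
      extend (input G s ℓ v) x.val P.lam P.lam c' (mem v).stored >>= fun st =>
          (pure { mem v with stored := st } : Prog n Memory)) h1 hext
    simp only [← hc'] at this
    refine this.congr ?_
    simp only [PMF.map_bind, PMF.map_comp, two_mul]
    rfl
  · intro st' h
    rw [PMF.mem_support_bind_iff] at h
    obtain ⟨c', h', h⟩ := h
    exact (hν' c' h').2.1 st' h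
  · have h4 : (ν₁.bind ν').map walks = PMF.pure (walks fun v => (mem v).stored) *
        ∏ v, ((G.srw v P.lam).bind (tailLaw G x.val P.lam P.lam)) ^ c v := by
      rw [← h3, conv_bind_right, PMF.map_bind]
      refine ext_of_expect fun f => ?_
      rw [expect_bind, expect_bind]
      refine expect_congr fun c' hc' => ?_
      rw [(hν' c' hc').2.2]
    rw [h4]
    congr 1
    rw [Finset.prod_eq_single x (fun v _ hv => by simp [hc, hv]) (by simp)]
    simp only [hc, if_true]
    congr 1
    obtain ⟨j, hj⟩ := Nat.exists_eq_succ_of_ne_zero hlam.ne'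
    have hadd : ∀ r, G.srw x (j + 1 + r) = (G.srw x (j + 1)).bind fun y => G.srw y r := fun r =>
      srw_add ..
    rw [walkLaw, hj]
    simp only [PMF.map_bind, PMF.map_comp, Nat.succ_eq_add_one, hadd]
    rw [PMF.bind_comm]
    congr 1; funext y
    rw [tailLaw_eq x.val (j + 1) j le_rfl]
    simp only [Nat.sub_self, add_zero]
    rfl

end Reservoir

section DeferredDecisions

theorem expect_comm (p : PMF α) (q : PMF β) (f : α → β → ℝ≥0∞) :
    expect p (fun a => expect q (f a)) = expect q fun b => expect p fun a => f a b := by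
  simp only [expect, ← ENNReal.tsum_mul_left]
  rw [ENNReal.tsum_comm]
  simp only [mul_left_comm]

/-- The expected sum over the samples with a property, if all others come without it. -/
theorem expect_sum_erase [DecidableEq α] (q : PMF α) (R : PMF (Multiset α)) (P : α → Prop)
    [DecidablePred P] (hq : ∀ e ∈ q.support, P e) (hR : ∀ S ∈ R.support, ∀ e ∈ S, ¬ P e) (k : ℕ) :
    ∀ K : α → Multiset α → ℝ≥0∞,
    expect ((q.map fun e => {e}) ^ k * R) (fun S =>
      ((S.filter P).map fun e => K e (S.erase e)).sum) =
    k * expect q fun e => expect ((q.map fun e => {e}) ^ (k - 1) * R) (K e) := by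
  induction k with
  | zero =>
    intro K
    rw [pow_zero, one_mul, Nat.cast_zero, zero_mul]
    refine expect_eq_zero fun S hS => ?_
    rw [Multiset.filter_eq_nil.2 (hR S hS)]
    rfl
  | succ k ih =>
    intro K
    rw [Nat.add_sub_cancel, pow_succ', mul_assoc, expect_conv, expect_map]
    have h1 : ∀ e₀ ∈ q.support, expect ((q.map fun e => {e}) ^ k * R) (fun S =>
        (((({e₀} : Multiset α) + S).filter P).map fun e => K e ((({e₀} : Multiset α) + S).erase e)).sum) =
        expect ((q.map fun e => {e}) ^ k * R) (K e₀) +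
        expect ((q.map fun e => {e}) ^ k * R) fun S => ((S.filter P).map fun e =>
          K e (e₀ ::ₘ S.erase e)).sum := by
      intro e₀ he₀
      rw [← expect_add]
      refine expect_congr fun S _ => ?_
      rw [Multiset.singleton_add, Multiset.filter_cons_of_pos _ (hq e₀ he₀), Multiset.map_cons,
        Multiset.sum_cons, Multiset.erase_cons_head]
      congr 2
      refine Multiset.map_congr rfl fun e he => ?_
      rw [Multiset.erase_cons_tail_of_mem (Multiset.mem_of_mem_filter he)]
    rw [expect_congr h1, expect_add]
    have h2 : ∀ e₀, expect ((q.map fun e => {e}) ^ k * R) (fun S => ((S.filter P).map fun e =>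
          K e (e₀ ::ₘ S.erase e)).sum) = _ := fun e₀ => ih fun e S => K e (e₀ ::ₘ S)
    simp only [h2]
    rw [expect_mul_left, Nat.cast_succ, add_comm, add_mul, one_mul]
    congr 1
    rcases k with _ | k
    · simp
    · congr 1
      rw [expect_comm]
      refine expect_congr fun e _ => ?_
      rw [Nat.add_sub_cancel, pow_succ', mul_assoc, expect_conv, expect_map]
      simp only [Multiset.singleton_add]

theorem mem_support_conv {M : Type} [AddCommMonoid M] {p q : PMF M} {a : M} :
    a ∈ (p * q).support ↔ ∃ x ∈ p.support, ∃ y ∈ q.support, x + y = a := by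
  simp only [conv_def, PMF.mem_support_bind_iff, PMF.mem_support_map_iff]

theorem walkLaw_source {lam : ℕ} {x : Fin n} {e : ShortWalk n} (h : e ∈ (walkLaw G lam x).support) :
    e.1 = x.val := by
  simp only [walkLaw, PMF.mem_support_bind_iff, PMF.mem_support_map_iff] at h
  obtain ⟨r, -, y, -, rfl⟩ := h
  rfl

theorem walkLaw_length {lam : ℕ} (hlam : 0 < lam) {x : Fin n} {e : ShortWalk n}
    (h : e ∈ (walkLaw G lam x).support) : lam ≤ e.2.1 ∧ e.2.1 < 2 * lam := by
  simp only [walkLaw, PMF.mem_support_bind_iff, PMF.mem_support_map_iff] at h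
  obtain ⟨r, -, y, -, rfl⟩ := h
  have := r.2
  constructor <;> simp only <;> omega

/-- The short walks that start at `x`. -/
def unused (x : Fin n) (S : Multiset (ShortWalk n)) : Multiset (ShortWalk n) := S.filter fun e => e.1 = x.val

theorem unused_of_mem_support_pow {lam : ℕ} {x y : Fin n} {k : ℕ} : ∀ {S : Multiset (ShortWalk n)},
    S ∈ (((walkLaw G lam x).map fun w => {w}) ^ k).support →
    (unused y S).card = if y = x then k else 0 := by
  induction k with
  | zero =>
    intro S h
    rw [pow_zero, conv_one, PMF.support_pure, Set.mem_singleton_iff] at h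
    subst h
    simp [unused]
  | succ k ih =>
    intro S h
    rw [pow_succ', mem_support_conv] at h
    obtain ⟨_, he, S, hS, rfl⟩ := h
    rw [PMF.mem_support_map_iff] at he
    obtain ⟨e, he, rfl⟩ := he
    have h1 := ih hS
    have h2 := walkLaw_source he
    rw [unused, Multiset.singleton_add]
    by_cases hy : y = x
    · subst hy
      rw [Multiset.filter_cons_of_pos (p := fun e : ShortWalk n => e.1 = y.val) _ h2, Multiset.card_cons]
      rw [if_pos rfl] at h1 ⊢
      rw [← h1]; rfl
    · rw [Multiset.filter_cons_of_neg (p := fun e : ShortWalk n => e.1 = y.val) _ (by rw [h2]; exact fun h => hy (Fin.ext h.symm))]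
      rw [if_neg hy] at h1 ⊢
      exact h1

theorem unused_of_mem_support_prod {lam : ℕ} {c : Fin n → ℕ} (T : Finset (Fin n)) {y : Fin n} :
    ∀ {S : Multiset (ShortWalk n)},
    S ∈ (∏ v ∈ T, ((walkLaw G lam v).map fun w => {w}) ^ c v).support →
    (unused y S).card = if y ∈ T then c y else 0 := by
  induction T using Finset.induction_on with
  | empty =>
    intro S h
    rw [Finset.prod_empty, conv_one, PMF.support_pure, Set.mem_singleton_iff] at h
    subst h
    simp [unused]
  | insert x T hx ih =>
    intro S h
    rw [Finset.prod_insert hx, mem_support_conv] at h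
    obtain ⟨S₁, h₁, S₂, h₂, rfl⟩ := h
    have h1 := unused_of_mem_support_pow (y := y) h₁
    have h2 := ih h₂
    simp only [unused] at h1 h2 ⊢
    rw [Multiset.filter_add, Multiset.card_add, h1, h2]
    by_cases hy : y = x
    · subst hy; simp [hx]
    · simp [hy]

theorem unused_of_mem_support_fresh {lam : ℕ} {c : Fin n → ℕ} {S : Multiset (ShortWalk n)} {y : Fin n}
    (h : S ∈ (fresh G lam c).support) : (unused y S).card = c y := by
  simpa using unused_of_mem_support_prod Finset.univ h

/-- The principle of deferred decisions: taking a random one of the short walks of `x` out of a fresh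
collection is the same as performing a new short walk, next to a fresh collection. -/
theorem expect_fresh_erase (lam : ℕ) (c : Fin n → ℕ) (x : Fin n)
    (K : ShortWalk n → Multiset (ShortWalk n) → ℝ≥0∞) :
    expect (fresh G lam c) (fun S => ((unused x S).map fun e => K e (S.erase e)).sum) =
      c x * expect (walkLaw G lam x) fun e =>
        expect (fresh G lam (Function.update c x (c x - 1))) (K e) := by
  have h : ∀ c' : Fin n → ℕ, (∀ v, v ≠ x → c' v = c v) → fresh G lam c' =
      ((walkLaw G lam x).map fun w => {w}) ^ c' x *
        ∏ v ∈ Finset.univ.erase x, ((walkLaw G lam v).map fun w => {w}) ^ c v := by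
    intro c' hc'
    rw [fresh, ← Finset.mul_prod_erase _ _ (Finset.mem_univ x)]
    congr 1
    refine Finset.prod_congr rfl fun v hv => ?_
    rw [hc' v (Finset.ne_of_mem_erase hv)]
  rw [h c fun _ _ => rfl, h (Function.update c x (c x - 1)) fun v hv => Function.update_of_ne hv _ _,
    Function.update_self]
  refine expect_sum_erase _ _ _ (fun e he => walkLaw_source he) (fun S hS e he hex => ?_) _ K
  have := unused_of_mem_support_prod (y := x) _ hS
  rw [if_neg (by simp), Multiset.card_eq_zero] at this
  exact Multiset.notMem_zero e (this ▸ Multiset.mem_filter.2 ⟨he, hex⟩)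

end DeferredDecisions

section Chain

/-- Time, position and length of the walk completed. -/
abbrev Progress (n : ℕ) := ℕ × Fin n × ℕ

/-- The same progress, `t` rounds later. -/
def later (t : ℕ) (r : Progress n) : Progress n := (t + r.1, r.2)

/-- Extend the walk at `x` by a random short walk in `S`, and continue as `A`; this takes `t` rounds
in addition to those of `A`. -/
noncomputable def extendLaw (A : Multiset (ShortWalk n) → Fin n → ℕ → PMF (Progress n)) (t : ℕ)
    (S : Multiset (ShortWalk n)) (x : Fin n) (w : ℕ) : PMF (Progress n) :=
  if h : unused x S = 0 then PMF.pure (t, x, w)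
  else (PMF.ofMultiset (unused x S) h).bind fun e =>
    (A (S.erase e) e.2.2 (w + e.2.1)).map (later t)

/-- The law of the progress in the loop of Phase 2, for a collection `S` of short walks. -/
noncomputable def stitchLaw (G : SimpleGraph (Fin n)) (lam ℓ : ℕ) :
    ℕ → Multiset (ShortWalk n) → Fin n → ℕ → PMF (Progress n)
  | 0, _, x, w => PMF.pure (0, x, w)
  | k + 1, S, x, w =>
    if w + 2 * lam ≤ ℓ then
      if unused x S = 0 then (((walkLaw G lam x).map fun e => {e}) ^ (ℓ / lam)).bind fun S' =>
        extendLaw (stitchLaw G lam ℓ k) (3 * G.diam + 2 * lam + 3 * G.diam) (S + S') x w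
      else extendLaw (stitchLaw G lam ℓ k) (3 * G.diam) S x w
    else PMF.pure (0, x, w)

/-- The law of the progress in the loop of Phase 2, if only the numbers of unused short walks are
kept and short walks are performed when they are used. -/
noncomputable def chainLaw (G : SimpleGraph (Fin n)) (lam ℓ : ℕ) :
    ℕ → (Fin n → ℕ) → Fin n → ℕ → PMF (Progress n)
  | 0, _, x, w => PMF.pure (0, x, w)
  | k + 1, c, x, w =>
    if w + 2 * lam ≤ ℓ then
      (walkLaw G lam x).bind fun e =>
        (chainLaw G lam ℓ k
          (Function.update c x ((if c x = 0 then ℓ / lam else c x) - 1)) e.2.2 (w + e.2.1)).map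
        (later (if c x = 0 then 3 * G.diam + 2 * lam + 3 * G.diam else 3 * G.diam))
    else PMF.pure (0, x, w)

theorem fresh_extendLaw {lam : ℕ} {A : Multiset (ShortWalk n) → Fin n → ℕ → PMF (Progress n)}
    {C : (Fin n → ℕ) → Fin n → ℕ → PMF (Progress n)}
    (hA : ∀ c x w, (fresh G lam c).bind (fun S => A S x w) = C c x w) (t : ℕ) (c : Fin n → ℕ)
    (x : Fin n) (w : ℕ) (hc : c x ≠ 0) :
    (fresh G lam c).bind (fun S => extendLaw A t S x w) = (walkLaw G lam x).bind fun e =>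
      (C (Function.update c x (c x - 1)) e.2.2 (w + e.2.1)).map (later t) := by
  refine ext_of_expect fun f => ?_
  have h1 : ∀ S ∈ (fresh G lam c).support, expect (extendLaw A t S x w) f = ((c x : ℕ) : ℝ≥0∞)⁻¹ *
      ((unused x S).map fun e => expect (A (S.erase e) e.2.2 (w + e.2.1)) fun r =>
        f (later t r)).sum := by
    intro S hS
    have hcard := unused_of_mem_support_fresh (y := x) hS
    have h0 : unused x S ≠ 0 := fun h => hc (by rw [← hcard, h]; rfl)
    rw [extendLaw, dif_neg h0, expect_bind, expect_ofMultiset, hcard, div_eq_mul_inv, mul_comm]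
    simp only [expect_map]
  rw [expect_bind, expect_congr h1, expect_mul_left, expect_fresh_erase lam c x fun e S =>
    expect (A S e.2.2 (w + e.2.1)) fun r => f (later t r), ← mul_assoc,
    ENNReal.inv_mul_cancel (by simpa using hc) (by simp), one_mul, expect_bind]
  refine expect_congr fun e _ => ?_
  rw [expect_map, ← hA, expect_bind]

theorem fresh_stitchLaw {lam ℓ : ℕ} (hlam : 0 < lam) (k : ℕ) (c : Fin n → ℕ) (x : Fin n) (w : ℕ) :
    (fresh G lam c).bind (fun S => stitchLaw G lam ℓ k S x w) = chainLaw G lam ℓ k c x w := by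
  induction k generalizing c x w with
  | zero => simp [stitchLaw, chainLaw]
  | succ k ih =>
    rw [chainLaw]
    by_cases hw : w + 2 * lam ≤ ℓ
    swap
    · simp [stitchLaw, hw]
    rw [if_pos hw]
    by_cases hc : c x = 0
    · have hq : ℓ / lam ≠ 0 := (Nat.div_pos (by omega) hlam).ne'
      have h1 : fresh G lam (Function.update c x (ℓ / lam)) =
          fresh G lam c * ((walkLaw G lam x).map fun e => {e}) ^ (ℓ / lam) := by
        rw [fresh, fresh, ← Finset.mul_prod_erase _ _ (Finset.mem_univ x),
          ← Finset.mul_prod_erase _ (fun v => ((walkLaw G lam v).map fun w => ({w} : Multiset (ShortWalk n))) ^ c v)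
          (Finset.mem_univ x), hc, pow_zero, one_mul, Function.update_self, mul_comm]
        congr 1
        refine Finset.prod_congr rfl fun v hv => ?_
        rw [Function.update_of_ne (Finset.ne_of_mem_erase hv)]
      have h2 := fresh_extendLaw ih (3 * G.diam + 2 * lam + 3 * G.diam)
        (Function.update c x (ℓ / lam)) x w (by simpa using hq)
      rw [Function.update_self, Function.update_idem, h1, conv_bind] at h2
      simp only [hc, if_true]
      rw [← h2]
      refine ext_of_expect fun f => ?_
      rw [expect_bind, expect_bind]
      refine expect_congr fun S hS => ?_
      rw [stitchLaw, if_pos hw, if_pos]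
      rw [← Multiset.card_eq_zero, unused_of_mem_support_fresh hS, hc]
    · rw [if_neg hc, if_neg hc, ← fresh_extendLaw ih _ c x w hc]
      refine ext_of_expect fun f => ?_
      rw [expect_bind, expect_bind]
      refine expect_congr fun S hS => ?_
      rw [stitchLaw, if_pos hw, if_neg]
      rw [← Multiset.card_eq_zero, unused_of_mem_support_fresh hS]
      exact hc

end Chain

section Stitch

theorem msgBits_le {m : Msg} {H : ℕ} (hm : m.length ≤ 3) (hH : ∀ x ∈ m, x ≤ H) :
    msgBits m ≤ 8 + 6 * Nat.size H := by
  have h : (m.map fun x => 2 * Nat.size x + 2).sum ≤ m.length * (2 * Nat.size H + 2) := by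
    rw [← smul_eq_mul, ← List.length_map (as := m) (fun x => 2 * Nat.size x + 2)]
    refine List.sum_le_card_nsmul _ _ fun y hy => ?_
    obtain ⟨x, hx, rfl⟩ := List.mem_map.1 hy
    have := Nat.size_le_size (hH x hx)
    omega
  have := Nat.mul_le_mul_right (2 * Nat.size H + 2) hm
  rw [msgBits]
  omega

theorem sum_map_unused {M : Type} [AddCommMonoid M] (x : Fin n) (st : Fin n → List (ℕ × ℕ))
    (g : ShortWalk n → M) : ((unused x (walks st)).map g).sum =
      ∑ v, (((st v).filter fun w => w.1 = x.val).map fun w => g (w.1, w.2, v)).sum := by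
  have h : ∀ T : Finset (Fin n), ((unused x (∑ v ∈ T,
      (((st v).map fun w => (w.1, w.2, v) : List (ShortWalk n)) : Multiset (ShortWalk n)))).map g).sum =
      ∑ v ∈ T, (((st v).filter fun w => w.1 = x.val).map fun w => g (w.1, w.2, v)).sum := by
    intro T
    induction T using Finset.induction_on with
    | empty => rfl
    | insert v T hv ih =>
      rw [Finset.sum_insert hv, Finset.sum_insert hv, ← ih, unused, Multiset.filter_add,
        Multiset.map_add, Multiset.sum_add]
      congr 1
      rw [Multiset.filter_coe, Multiset.map_coe, Multiset.sum_coe, List.filter_map, List.map_map]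
      rfl
  exact h Finset.univ

theorem card_unused (x : Fin n) (st : Fin n → List (ℕ × ℕ)) :
    (unused x (walks st)).card = ∑ v, ((st v).filter fun w => w.1 = x.val).length := by
  have := sum_map_unused x st fun _ => 1
  simpa using this

theorem walks_erase (st : Fin n → List (ℕ × ℕ)) (w : ℕ × ℕ) (y : Fin n) :
    walks (fun v => if y = v then (st v).erase w else st v) = (walks st).erase (w.1, w.2, y) := by
  have h : ∀ st : Fin n → List (ℕ × ℕ), walks st =
      ((st y).map fun w => (w.1, w.2, y) : List (ShortWalk n)) + ∑ v ∈ Finset.univ.erase y,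
        (((st v).map fun w => (w.1, w.2, v) : List (ShortWalk n)) : Multiset (ShortWalk n)) := fun st =>
    (Finset.add_sum_erase _ _ (Finset.mem_univ y)).symm
  have hinj : Function.Injective fun w : ℕ × ℕ => ((w.1, w.2, y) : ShortWalk n) := by
    rintro ⟨a, c⟩ ⟨a', c'⟩ h
    simp only [Prod.mk.injEq, and_true] at h
    exact Prod.ext h.1 h.2
  have hrest : ∑ v ∈ Finset.univ.erase y,
      (((if y = v then (st v).erase w else st v).map fun w => (w.1, w.2, v) : List (ShortWalk n)) :
        Multiset (ShortWalk n)) = ∑ v ∈ Finset.univ.erase y,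
      (((st v).map fun w => (w.1, w.2, v) : List (ShortWalk n)) : Multiset (ShortWalk n)) :=
    Finset.sum_congr rfl fun v hv => by rw [if_neg (Finset.ne_of_mem_erase hv).symm]
  rw [h, h st, hrest, if_pos rfl]
  by_cases hw : w ∈ st y
  · rw [Multiset.erase_add_left_pos]
    · rw [List.map_erase hinj, Multiset.coe_erase]
      congr!
    · exact List.mem_map.2 ⟨w, hw, rfl⟩
  · rw [List.erase_of_not_mem hw, Multiset.erase_of_notMem]
    rw [Multiset.mem_add, Multiset.mem_sum]
    rintro (h | ⟨v, hv, h⟩)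
    · obtain ⟨w', hw', h⟩ := List.mem_map.1 h
      exact hw (hinj h ▸ hw')
    · obtain ⟨w', hw', h⟩ := List.mem_map.1 h
      exact Finset.ne_of_mem_erase hv (congrArg (fun e : ShortWalk n => e.2.2) h)

/-- The programs `p` compute memories according to the progress law `A`. -/
def Tracks (G : SimpleGraph (Fin n)) (b src : ℕ) (p : Fin n → Prog n Memory)
    (A : PMF (Progress n)) : Prop :=
  ∃ μ : PMF (Progress n × (Fin n → Memory)),
    Runs G b p (μ.map fun r => (r.1.1, r.2)) ∧
    (∀ r ∈ μ.support, Holds src r.1.2.1 r.2 ∧ ∀ v, (r.2 v).walked = r.1.2.2) ∧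
    μ.map Prod.fst = A

theorem Tracks.ret {src : ℕ} {x : Fin n} {w : ℕ} {mem : Fin n → Memory} (hx : Holds src x mem)
    (hw : ∀ v, (mem v).walked = w) :
    Tracks G b src (fun v => pure (mem v)) (PMF.pure (0, x, w)) := by
  refine ⟨PMF.pure ((0, x, w), mem), ?_, ?_, PMF.pure_map ..⟩
  · rw [PMF.pure_map]
    exact Runs.ret _
  · intro r hr
    rw [PMF.support_pure, Set.mem_singleton_iff] at hr
    subst hr
    exact ⟨hx, hw⟩

theorem Tracks.bind {src t : ℕ} {p : Fin n → Prog n α} {k : Fin n → α → Prog n Memory}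
    {ν : PMF (Fin n → α)} {B : (Fin n → α) → PMF (Progress n)}
    (hp : Runs G b p (ν.map fun r => (t, r)))
    (hk : ∀ r ∈ ν.support, Tracks G b src (fun v => k v (r v)) (B r)) :
    Tracks G b src (fun v => p v >>= k v) (ν.bind fun r => (B r).map (later t)) := by
  classical
  have key : ∀ r, ∃ μ : PMF (Progress n × (Fin n → Memory)), r ∈ ν.support →
    Runs G b (fun v => k v (r v)) (μ.map fun r => (r.1.1, r.2)) ∧
    (∀ r ∈ μ.support, Holds src r.1.2.1 r.2 ∧ ∀ v, (r.2 v).walked = r.1.2.2) ∧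
    μ.map Prod.fst = B r := fun r => by
      by_cases h : r ∈ ν.support
      · obtain ⟨μ, hμ⟩ := hk r h
        exact ⟨μ, fun _ => hμ⟩
      · obtain ⟨r₀, hr₀⟩ := ν.support_nonempty
        obtain ⟨μ, -⟩ := hk r₀ hr₀
        exact ⟨μ, fun h' => absurd h' h⟩
  choose μ hμ using key
  refine ⟨ν.bind fun r => (μ r).map fun q => (later t q.1, q.2), ?_, ?_, ?_⟩
  · refine (hp.bind (k := k) (ν := fun r => (μ r).map fun q => (q.1.1, q.2)) fun x hx => ?_).congr ?_
    · rw [PMF.mem_support_map_iff] at hx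
      obtain ⟨r, hr, rfl⟩ := hx
      exact (hμ r hr).1
    · simp only [seqLaw, PMF.bind_map, PMF.map_bind, PMF.map_comp, Function.comp_def, later]
  · intro q hq
    simp only [PMF.mem_support_bind_iff, PMF.mem_support_map_iff] at hq
    obtain ⟨r, hr, q, hq, rfl⟩ := hq
    exact (hμ r hr).2.1 q hq
  · rw [PMF.map_bind]
    refine ext_of_expect fun f => ?_
    rw [expect_bind, expect_bind]
    refine expect_congr fun r hr => ?_
    rw [← (hμ r hr).2.2, PMF.map_comp, PMF.map_comp]
    rfl

theorem map_later_extendLaw (A : Multiset (ShortWalk n) → Fin n → ℕ → PMF (Progress n)) (t t' : ℕ)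
    (S : Multiset (ShortWalk n)) (x : Fin n) (w : ℕ) :
    (extendLaw A t S x w).map (later t') = extendLaw A (t' + t) S x w := by
  unfold extendLaw
  split_ifs
  · rw [PMF.pure_map]; rfl
  · rw [PMF.map_bind]
    congr 1; funext e
    rw [PMF.map_comp]
    congr 1; funext r
    simp only [Function.comp_def, later, add_assoc]

/-- What holds at the beginning of a pass of the loop, if `H` bounds all numbers. -/
structure Ready (src lam H : ℕ) (x : Fin n) (w : ℕ) (mem : Fin n → Memory) : Prop where
  holds : Holds src x mem
  walked : ∀ v, (mem v).walked = w
  good : ∀ v, ∀ e ∈ (mem v).stored, GoodWalk n lam e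
  few : ∀ y, (unused y (walks fun v => (mem v).stored)).card ≤ H

theorem Ready.move {src lam H w : ℕ} {x y : Fin n} {mem : Fin n → Memory}
    (h : Ready src lam H x w mem) {c : Sample} (hc : c.owner = y.val) :
    Ready src lam H y (w + c.len) (fun v => (mem v).move src x c v) ∧
    (walks fun v => ((mem v).move src x c v).stored) =
      (walks fun v => (mem v).stored).erase (x.val, c.len, y) := by
  have h1 : ∀ v : Fin n, c.owner = v.val ↔ y = v := fun v => by rw [hc, Fin.ext_iff]
  have h2 : (walks fun v => ((mem v).move src x c v).stored) =
      (walks fun v => (mem v).stored).erase (x.val, c.len, y) := by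
    rw [← walks_erase (fun v => (mem v).stored) (x.val, c.len) y]
    simp only [Memory.move, h1]
  refine ⟨⟨fun v => ?_, fun v => ?_, fun v e he => ?_, fun z => ?_⟩, h2⟩
  · simp only [Memory.move, h1, eq_comm]
  · simp only [Memory.move, h.walked]
  · refine h.good v e ?_
    simp only [Memory.move] at he
    split_ifs at he
    · exact List.mem_of_mem_erase he
    · exact he
  · rw [h2]
    exact (Multiset.card_le_card (Multiset.filter_le_filter _ (Multiset.erase_le _ _))).trans
      (h.few z)

theorem Ready.sample_runs (hG : G.Connected) {s : Fin n} {ℓ src lam H w : ℕ} {x : Fin n}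
    {mem : Fin n → Memory} (h : Ready src lam H x w mem) (hnH : n ≤ H) (hsrc : src < n)
    (hlH : 2 * lam ≤ H) (hH : 8 + 6 * Nat.size H ≤ b) : ∃ ρ : PMF (Option Sample),
      Runs G b (fun v => sampleDestination (input G s ℓ v) (mem v))
        ((ρ.map (sampleResult src x mem)).map fun r => (3 * G.diam, r)) ∧
      (∀ o ∈ ρ.support, (o = none ∧ (unused x (walks fun v => (mem v).stored)).card = 0) ∨
        ∃ c, o = some c ∧ c.owner < n ∧ c.count = (unused x (walks fun v => (mem v).stored)).card ∧
          (unused x (walks fun v => (mem v).stored)).card ≠ 0) ∧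
      ∀ φ : ℕ → ℕ → ℝ≥0∞, expect ρ (fun o => weighted φ o.toList) =
        ((unused x (walks fun v => (mem v).stored)).map fun e => φ e.2.2 e.2.1).sum := by
  obtain ⟨ρ, h1, h2, h3⟩ := sampleDestination_runs (s := s) (ℓ := ℓ) hG h.holds h.good
    (card_unused x fun v => (mem v).stored).symm
    (fun a c d ha hc hd => (msgBits_le (H := H) (by simp) (by
      have := h.few x
      simp only [List.mem_cons, List.not_mem_nil, or_false]
      rintro z (rfl | rfl | rfl) <;> omega)).trans hH)
    (fun a c ha hc => (msgBits_le (H := H) (by simp) (by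
      simp only [List.mem_cons, List.not_mem_nil, or_false]
      rintro z (rfl | rfl | rfl) <;> omega)).trans hH)
    ((msgBits_le (H := H) (by simp) (by
      have := x.2
      simp only [List.mem_cons, List.not_mem_nil, or_false]
      rintro z rfl; omega)).trans hH) (by omega)
  refine ⟨ρ, ?_, fun o ho => ?_, fun φ => ?_⟩
  · rw [PMF.map_comp]; exact h1
  · exact (h2 o ho).imp_right fun ⟨c, h4, h5, _, h6, h7⟩ => ⟨c, h4, h5, h6, h7⟩
  · rw [h3]
    exact (sum_map_unused x (fun v => (mem v).stored) fun e => φ e.2.2 e.2.1).symm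

open scoped Classical in
theorem extend_tracks (hG : G.Connected) {s : Fin n} {ℓ src lam H w : ℕ} {x : Fin n}
    {mem : Fin n → Memory} (h : Ready src lam H x w mem) (hnH : n ≤ H) (hsrc : src < n)
    (hlH : 2 * lam ≤ H) (hH : 8 + 6 * Nat.size H ≤ b)
    (A : Multiset (ShortWalk n) → Fin n → ℕ → PMF (Progress n))
    (k : Fin n → ℕ × Bool × Memory → Prog n Memory)
    (hk : ∀ x' w' mem', Ready src lam H x' w' mem' →
      Tracks G b src (fun v => k v (x.val, true, mem' v)) (A (walks fun v => (mem' v).stored) x' w'))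
    (hS : unused x (walks fun v => (mem v).stored) ≠ 0) :
    Tracks G b src (fun v => sampleDestination (input G s ℓ v) (mem v) >>= k v)
      (extendLaw A (3 * G.diam) (walks fun v => (mem v).stored) x w) := by
  set S := walks fun v => (mem v).stored with hSdef
  obtain ⟨ρ, h1, h2, h3⟩ := h.sample_runs (s := s) (ℓ := ℓ) hG hnH hsrc hlH hH
  rw [← hSdef] at h2 h3
  set N := (unused x S).card with hN
  have hN0 : N ≠ 0 := by rwa [hN, Ne, Multiset.card_eq_zero]
  set B : (Fin n → ℕ × Bool × Memory) → PMF (Progress n) := fun r =>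
    A (walks fun v => (r v).2.2.stored)
      (if h : ∃ y, Holds src y fun v => (r v).2.2 then h.choose else x) (r x).2.2.walked with hB
  have hfound : ∀ o ∈ ρ.support, ∃ c y, o = some c ∧ c.owner = y.val ∧ c.count = N ∧
      Ready src lam H y (w + c.len) (fun v => (mem v).move src x c v) ∧
      B (sampleResult src x mem o) = A (S.erase (x.val, c.len, y)) y (w + c.len) := by
    intro o ho
    rcases h2 o ho with ⟨-, h0⟩ | ⟨c, rfl, hc, hcN, -⟩
    · exact absurd h0 hN0
    · obtain ⟨h4, h5⟩ := h.move (c := c) (y := ⟨c.owner, hc⟩) rfl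
      refine ⟨c, ⟨c.owner, hc⟩, rfl, rfl, hcN, h4, ?_⟩
      have hex : ∃ y, Holds src y fun v => (sampleResult src x mem (some c) v).2.2 := ⟨_, h4.holds⟩
      have hy : hex.choose = ⟨c.owner, hc⟩ := by
        by_contra hne
        have e1 := hex.choose_spec hex.choose
        have e2 := h4.holds hex.choose
        rw [if_pos rfl] at e1
        rw [if_neg hne] at e2
        exact absurd (e1.symm.trans e2) (by simp)
      simp only [hB]
      rw [dif_pos hex, hy]
      exact congrArg₂ (fun S w => A S _ w) h5 (h4.walked x)
  have hT := Tracks.bind (src := src) (k := k) (B := B) h1 fun r hr => by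
    rw [PMF.mem_support_map_iff] at hr
    obtain ⟨o, ho, rfl⟩ := hr
    obtain ⟨c, y, rfl, hcy, -, h4, h5⟩ := hfound o ho
    obtain ⟨-, h6⟩ := h.move (c := c) (y := y) hcy
    have := hk _ _ _ h4
    rw [h5, ← h6]
    exact this
  refine Eq.subst (motive := Tracks G b src _) ?_ hT
  rw [PMF.bind_map]
  refine ext_of_expect fun f => ?_
  set fin : ℕ → Fin n := fun a => if h : a < n then ⟨a, h⟩ else x with hfin
  have hfv : ∀ v : Fin n, fin v = v := fun v => dif_pos v.2
  set φ : ℕ → ℕ → ℝ≥0∞ := fun a l =>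
    expect (A (S.erase (x.val, l, fin a)) (fin a) (w + l)) fun r => f (later (3 * G.diam) r) with hφ
  have h7 : ∀ o ∈ ρ.support, expect ((B (sampleResult src x mem o)).map (later (3 * G.diam))) f =
      (N : ℝ≥0∞)⁻¹ * weighted φ o.toList := by
    intro o ho
    obtain ⟨c, y, rfl, hcy, hcN, -, h5⟩ := hfound o ho
    rw [h5, expect_map, weighted, Option.toList_some, List.map_singleton, List.sum_singleton, hcN,
      ← mul_assoc, ENNReal.inv_mul_cancel (by simpa using hN0) (by simp), one_mul, hcy]
    simp only [hφ, hfv]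
  simp only [Function.comp_def]
  rw [expect_bind, expect_congr h7, expect_mul_left, h3, extendLaw, dif_neg hS, expect_bind,
    expect_ofMultiset, ← hN, div_eq_mul_inv, mul_comm]
  congr 1
  have h8 : ∀ e ∈ unused x S, expect ((A (S.erase e) e.2.2 (w + e.2.1)).map (later (3 * G.diam))) f =
      φ e.2.2 e.2.1 := by
    rintro ⟨a, l, y⟩ he
    have : a = x.val := (Multiset.mem_filter.1 he).2
    subst this
    rw [expect_map]
    simp only [hφ, hfv]
  rw [Multiset.map_congr rfl h8]

theorem Tracks.congr {src : ℕ} {p : Fin n → Prog n Memory} {A A' : PMF (Progress n)}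
    (h : Tracks G b src p A) (hA : A = A') : Tracks G b src p A' := hA ▸ h

theorem stitch_tracks (hG : G.Connected) (hadj : ∀ v, ∃ u, G.Adj v u) {s : Fin n} {P : Params}
    {ℓ src H : ℕ} (hlam : 0 < P.lam) (hnH : n ≤ H) (hsrc : src < n) (hlH : 2 * P.lam ≤ H)
    (hℓH : ℓ ≤ H) (hH : 8 + 6 * Nat.size H ≤ b) (k : ℕ) :
    ∀ x w mem, Ready src P.lam H x w mem →
      Tracks G b src (fun v => stitch (input G s ℓ v) P k (mem v))
        (stitchLaw G P.lam ℓ k (walks fun v => (mem v).stored) x w) := by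
  induction k with
  | zero => exact fun x w mem h => Tracks.ret h.holds h.walked
  | succ k ih =>
    intro x w mem h
    by_cases hw : w + 2 * P.lam ≤ ℓ
    swap
    · have hprog : (fun v => stitch (input G s ℓ v) P (k + 1) (mem v)) = fun v => pure (mem v) := by
        funext v
        rw [stitch, h.walked v]
        exact if_neg hw
      rw [hprog, stitchLaw, if_neg hw]
      exact Tracks.ret h.holds h.walked
    have hprog : (fun v => stitch (input G s ℓ v) P (k + 1) (mem v)) = fun v =>
        sampleDestination (input G s ℓ v) (mem v) >>= fun r =>
          if r.2.1 then stitch (input G s ℓ v) P k r.2.2 else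
            getMoreWalks (input G s ℓ v) P r.1 r.2.2 >>= fun mem =>
              sampleDestination (input G s ℓ v) mem >>= fun r => stitch (input G s ℓ v) P k r.2.2 := by
      funext v
      rw [stitch, h.walked v]
      exact if_pos hw
    rw [hprog, stitchLaw, if_pos hw]
    by_cases hS : unused x (walks fun v => (mem v).stored) = 0
    swap
    · rw [if_neg hS]
      exact extend_tracks hG h hnH hsrc hlH hH _ (fun v r =>
        if r.2.1 then stitch (input G s ℓ v) P k r.2.2 else
            getMoreWalks (input G s ℓ v) P r.1 r.2.2 >>= fun mem =>
              sampleDestination (input G s ℓ v) mem >>= fun r => stitch (input G s ℓ v) P k r.2.2)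
        (fun x' w' mem' h' => ih x' w' mem' h') hS
    rw [if_pos hS]
    obtain ⟨ρ, h1, h2, -⟩ := h.sample_runs (s := s) (ℓ := ℓ) hG hnH hsrc hlH hH
    obtain ⟨ν, h3, h4, h5⟩ := getMoreWalks_runs (b := b) (s := s) (ℓ := ℓ) hadj hlam h.holds
      (fun k hk => (msgBits_le (H := H) (by simp) (by
        have := x.2
        have := Nat.div_le_self ℓ P.lam
        simp only [List.mem_cons, List.not_mem_nil, or_false]
        rintro z (rfl | rfl) <;> omega)).trans hH) h.good
    rw [hS] at h2
    have hcard : ∀ r ∈ ν.support, ∀ y, (unused y (walks r)).card =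
        (unused y (walks fun v => (mem v).stored)).card + if y = x then ℓ / P.lam else 0 := by
      intro r hr y
      have : walks r ∈ (ν.map walks).support := (PMF.mem_support_map_iff _ _ _).2 ⟨r, hr, rfl⟩
      rw [h5, mem_support_conv] at this
      obtain ⟨S, hS', S', hS'', h6⟩ := this
      rw [PMF.support_pure, Set.mem_singleton_iff] at hS'
      rw [← h6, hS', unused, Multiset.filter_add, Multiset.card_add,
        ← unused_of_mem_support_pow (y := y) hS'']
      rfl
    have hq : ℓ / P.lam ≠ 0 := (Nat.div_pos (by omega) hlam).ne'
    have hT := Tracks.bind (src := src) (t := 3 * G.diam) (ν := ρ.map (sampleResult src x mem))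
      (B := fun _ => ν.bind fun r => (extendLaw (stitchLaw G P.lam ℓ k) (3 * G.diam) (walks r) x w).map
        (later (2 * P.lam)))
      (k := fun v r => if r.2.1 then stitch (input G s ℓ v) P k r.2.2 else
            getMoreWalks (input G s ℓ v) P r.1 r.2.2 >>= fun mem =>
              sampleDestination (input G s ℓ v) mem >>= fun r => stitch (input G s ℓ v) P k r.2.2)
      h1 fun r hr => by
        rw [PMF.mem_support_map_iff] at hr
        obtain ⟨o, ho, rfl⟩ := hr
        rcases h2 o ho with ⟨rfl, -⟩ | ⟨c, -, -, -, h0⟩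
        swap
        · exact absurd rfl h0
        have h6 := Tracks.bind (src := src) (t := 2 * P.lam)
          (ν := ν.map fun r v => { mem v with stored := r v })
          (B := fun m => extendLaw (stitchLaw G P.lam ℓ k) (3 * G.diam)
            (walks fun v => (m v).stored) x w)
          (k := fun v mem =>
              sampleDestination (input G s ℓ v) mem >>= fun r => stitch (input G s ℓ v) P k r.2.2)
          (p := fun v => getMoreWalks (input G s ℓ v) P x (mem v)) (by
            rw [PMF.map_comp]; exact h3) fun m hm => by
              rw [PMF.mem_support_map_iff] at hm
              obtain ⟨r, hr, rfl⟩ := hm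
              refine extend_tracks hG (w := w) (x := x) (H := H) (lam := P.lam)
                (mem := fun v => { mem v with stored := r v })
                ⟨h.holds, h.walked, h4 r hr, fun y => ?_⟩ hnH hsrc hlH hH _ (fun v r => stitch (input G s ℓ v) P k r.2.2)
                (fun x' w' mem' h' => ih x' w' mem' h') ?_
              · refine (hcard r hr y).trans_le ?_
                by_cases hy : y = x
                · subst hy
                  rw [hS, if_pos rfl]
                  exact ((zero_add _).trans_le (Nat.div_le_self _ _)).trans hℓH
                · rw [if_neg hy]
                  exact h.few y
              · rw [Ne, ← Multiset.card_eq_zero]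
                rw [hcard r hr x, if_pos rfl]
                exact (Nat.add_pos_right _ (Nat.pos_of_ne_zero hq)).ne'
        rw [PMF.bind_map] at h6
        exact h6
    refine hT.congr ?_
    rw [PMF.bind_const, PMF.map_bind]
    simp only [map_later_extendLaw]
    have h7 : ∀ F : Multiset (ShortWalk n) → PMF (Progress n), (ν.bind fun r => F (walks r)) =
        (((walkLaw G P.lam x).map fun w => {w}) ^ (ℓ / P.lam)).bind fun S' =>
          F ((walks fun v => (mem v).stored) + S') := by
      intro F
      rw [← PMF.pure_bind (walks fun v => (mem v).stored) fun S => PMF.bind _ fun S' => F (S + S'),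
        ← conv_bind, ← h5, PMF.bind_map]
      rfl
    rw [add_assoc]
    exact h7 fun S => extendLaw (stitchLaw G P.lam ℓ k) (3 * G.diam + (2 * P.lam + 3 * G.diam)) S x w

end Stitch

section NaiveWalk

theorem naiveWalk_runs (hadj : ∀ v, ∃ u, G.Adj v u) {s : Fin n} {ℓ src : ℕ} (hb : msgBits [src] ≤ b)
    (k : ℕ) : ∀ (x : Fin n) (token : Fin n → Option ℕ),
      (∀ v, token v = if v = x then some src else none) →
      Runs G b (fun v => naiveWalk (input G s ℓ v) k (token v))
        ((G.srw x k).map fun y => (k, fun v => if v = y then some src else none)) := by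
  induction k with
  | zero =>
    intro x token ht
    rw [SimpleGraph.srw, PMF.pure_map]
    obtain rfl : token = fun v => if v = x then some src else none := funext ht
    exact Runs.ret _
  | succ k ih =>
    intro x token ht
    have hprog : (fun v => naiveWalk (input G s ℓ v) (k + 1) (token v)) = fun v =>
        (if v = x then pick (input G s ℓ v).nbrs else pure none) >>= fun u =>
          exchange (fun w => if u = some w then (token v).map fun s => [s] else none) >>=
            fun inbox => naiveWalk (input G s ℓ v) k
              ((arrivals inbox).head?.bind fun a => a.2.head?) := by
      funext v
      rw [naiveWalk, ht v]
      by_cases hv : v = x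
      · simp only [if_pos hv]; rfl
      · simp only [if_neg hv]; rfl
    set ν : Fin n → PMF (Option (Fin n)) := fun v =>
      if v = x then (G.srwStep v).map some else PMF.pure none with hν
    rw [hprog]
    refine (Runs.bind_local (ν := ν) (μ := fun r =>
      ((r x).elim (PMF.pure x) fun y => G.srw y k).map fun y =>
        (k + 1, fun v => if v = y then some src else none)) (fun v => ?_) fun r hr => ?_).congr ?_
    · simp only [hν]
      split_ifs
      · exact local_pick_nbrs (hadj v)
      · exact Local.pure none
    · have hr' := fun v => mem_support_independent hr v
      obtain ⟨y, hy, hry⟩ : ∃ y, G.Adj x y ∧ r x = some y := by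
        have := hr' x
        simp only [hν, if_true, PMF.mem_support_map_iff] at this
        obtain ⟨y, hy, h⟩ := this
        exact ⟨y, mem_support_srwStep (hadj x) hy, h.symm⟩
      have hrv : ∀ v, v ≠ x → r v = none := fun v hv => by
        have := hr' v
        simpa only [hν, if_neg hv, PMF.support_pure, Set.mem_singleton_iff] using this
      set out : Fin n → Fin n → Option Msg := fun v w =>
        if r v = some w then (token v).map fun s => [s] else none with hout
      have hout' : ∀ v w, out v w = if v = x ∧ w = y then some [src] else none := by
        intro v w
        by_cases hv : v = x
        · subst hv
          simp [hout, hry, ht, eq_comm]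
        · simp [hout, hrv v hv, hv]
      have hex := Runs.exchange (G := G) (b := b) out fun v w m h => by
        rw [hout'] at h
        split_ifs at h
        rw [← Option.some.inj h]
        exact hb
      have htok : ∀ w, ((arrivals (deliver G out w)).head?.bind fun a => a.2.head?) =
          if w = y then some src else none := by
        intro w
        by_cases hw : w = y
        · subst hw
          have h1 : deliver G out w x = some [src] := by
            rw [deliver_of_adj hy, hout']; simp
          obtain ⟨a, ha, ha'⟩ := arrivals_head?_of_some h1
          have h2 := (deliver_eq_some.1 ha').2
          rw [hout'] at h2
          split_ifs at h2
          rw [ha, Option.bind_some, ← Option.some.inj h2]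
          simp
        · rw [arrivals_head?_eq_none fun u => ?_]
          · simp [hw]
          · by_contra hne
            obtain ⟨m, hm⟩ := Option.ne_none_iff_exists'.1 hne
            have h2 := (deliver_eq_some.1 hm).2
            rw [hout', if_neg fun h => hw h.2] at h2
            cases h2
      have := Runs.bind_const (k := fun v (inbox : Fin n → Option Msg) =>
        naiveWalk (input G s ℓ v) k ((arrivals inbox).head?.bind fun a => a.2.head?)) hex
        (ih y _ htok)
      refine this.congr ?_
      rw [hry, PMF.map_comp]
      simp only [Function.comp_def, add_comm 1 k]
      rfl
    · have key : ∀ F : Option (Fin n) → PMF (ℕ × (Fin n → Option ℕ)),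
          (independent n ν).bind (fun r => F (r x)) = (ν x).bind F := fun F => by
        rw [← independent_map_apply ν x, PMF.bind_map]; rfl
      rw [key fun o => (o.elim (PMF.pure x) fun y => G.srw y k).map fun y =>
          (k + 1, fun v => if v = y then some src else none)]
      simp only [hν, if_true, PMF.bind_map, Function.comp_def, Option.elim_some]
      rw [srw_succ', PMF.map_bind]

/-- The output of node `u` if `v` is the destination of the walk from `s`. -/
def correctOutput (s v u : Fin n) : Output where
  source := if u = v then some s.val else none
  destination := if u = s then some v.val else none

theorem dist_le_of_mem_support_srw (hG : G.Connected) (hadj : ∀ v, ∃ u, G.Adj v u) {x : Fin n}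
    {k : ℕ} : ∀ {y}, y ∈ (G.srw x k).support → G.dist x y ≤ k := by
  induction k with
  | zero =>
    intro y h
    rw [SimpleGraph.srw, PMF.support_pure, Set.mem_singleton_iff] at h
    subst h; simp
  | succ k ih =>
    intro y h
    rw [SimpleGraph.srw, PMF.mem_support_bind_iff] at h
    obtain ⟨z, hz, h⟩ := h
    exact (dist_le_add_one hG (mem_support_srwStep (hadj z) h)).trans (Nat.add_le_add_right (ih hz) 1)

/-- The output of node `v`, from its token and what it has heard. -/
def outputOf (s v : Fin n) (token : Option ℕ) (h : Option (Heard n)) : Output where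
  source := token
  destination := if v = s then h.bind fun h => h.msg.head? else none

/-- Completing the walk and reporting the result. -/
def complete (I : Input n) (mem : Memory) : Prog n Output := do
  let token ← naiveWalk I (I.len - mem.walked) mem.token
  let h ← flood (min I.len I.diam) 0 (token.map fun _ => ⟨[I.id.val], 0, none⟩)
  return { source := token
           destination := if I.isSource then h.bind fun h => h.msg.head? else none }

theorem complete_runs (hG : G.Connected) (hadj : ∀ v, ∃ u, G.Adj v u) {s x : Fin n} {ℓ w : ℕ}
    {mem : Fin n → Memory} (hb : ∀ a < n, msgBits [a] ≤ b) (hx : Holds s.val x mem)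
    (hw : ∀ v, (mem v).walked = w) (hwℓ : w ≤ ℓ) (hd : G.dist s x ≤ w) :
    Runs G b (fun v => complete (input G s ℓ v) (mem v))
      ((G.srw x (ℓ - w)).map fun y => (ℓ - w + min ℓ G.diam, correctOutput s y)) := by
  have h1 := naiveWalk_runs (b := b) (s := s) (ℓ := ℓ) hadj (hb s.val s.2) (ℓ - w) x
    (fun v => (mem v).token) hx
  have hprog : (fun v => complete (input G s ℓ v) (mem v)) = fun v =>
      naiveWalk (input G s ℓ v) (ℓ - w) (mem v).token >>= fun token =>
        flood (min ℓ G.diam) 0 (token.map fun _ => (⟨[v.val], 0, none⟩ : Heard n)) >>= fun h =>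
          pure (outputOf s v token h) := by
    funext v
    rw [complete, hw v]
    simp only [input, decide_eq_true_eq, outputOf]
  rw [hprog]
  have h2 : ∀ y ∈ (G.srw x (ℓ - w)).support, Runs G b (fun v =>
        flood (min ℓ G.diam) 0 ((if v = y then some s.val else none).map
          fun _ => (⟨[v.val], 0, none⟩ : Heard n)) >>= fun h =>
          (pure (outputOf s v (if v = y then some s.val else none) h) : Prog n Output))
          (PMF.pure (min ℓ G.diam, correctOutput s y)) := by
    intro y hy
    obtain ⟨h', hr, hs⟩ := flood_root (b := b) hG (root := y) (m := [y.val]) (hb _ y.2) (min ℓ G.diam)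
      (fun v => (if v = y then some s.val else none).map fun _ => (⟨[v.val], 0, none⟩ : Heard n))
      (fun v => by split_ifs with h <;> simp [h])
    have hdist : G.dist y s ≤ min ℓ G.diam := by
      refine le_min ?_ (dist_le_diam' hG _ _)
      have := dist_le_of_mem_support_srw hG hadj hy
      have := hG.dist_triangle (u := s) (v := x) (w := y)
      rw [SimpleGraph.dist_comm]
      omega
    obtain ⟨p, hp, -⟩ := (hs s).1 hdist
    have := Runs.bind_const (k := fun v (h : Option (Heard n)) =>
      (pure (outputOf s v (if v = y then some s.val else none) h) : Prog n Output)) hr (ν := PMF.pure (0, correctOutput s y)) (by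
        have : (fun v => (pure (outputOf s v (if v = y then some s.val else none) (h' v)) :
            Prog n Output)) = fun v => pure (correctOutput s y v) := by
          funext v
          congr 1
          rw [correctOutput, outputOf]
          congr 1
          split_ifs with h
          · rw [h, hp]; rfl
          · rfl
        rw [this]
        exact Runs.ret _)
    rw [PMF.pure_map] at this
    exact this
  have : Nonempty (Fin n) := ⟨s⟩
  set tok : Fin n → Fin n → Option ℕ := fun y v => if v = y then some s.val else none with htok
  have hinj : Function.Injective tok := fun y y' h => by
    have := congrFun h y
    simp only [htok, if_true] at this
    by_contra hne
    rw [if_neg hne] at this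
    cases this
  have h3 := Runs.bind_time (t' := min ℓ G.diam) (ν := (G.srw x (ℓ - w)).map tok)
    (μ := fun r => PMF.pure (correctOutput s (Function.invFun tok r)))
    (k := fun v (token : Option ℕ) =>
      flood (min ℓ G.diam) 0 (token.map fun _ => (⟨[v.val], 0, none⟩ : Heard n)) >>= fun h =>
          (pure (outputOf s v token h) : Prog n Output)) (h1.congr (by rw [PMF.map_comp]; rfl)) fun r hr => by
      rw [PMF.mem_support_map_iff] at hr
      obtain ⟨y, hy, rfl⟩ := hr
      rw [Function.leftInverse_invFun hinj y, PMF.pure_map]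
      exact h2 y hy
  refine h3.congr ?_
  simp only [PMF.bind_map, PMF.map_bind, PMF.pure_map, Function.comp_def,
    Function.leftInverse_invFun hinj _]
  rfl

end NaiveWalk

section Program

theorem Tracks.finish {src : ℕ} {p : Fin n → Prog n Memory} {A : PMF (Progress n)}
    (h : Tracks G b src p A) (k : Fin n → Memory → Prog n α)
    (R : Fin n → ℕ → PMF (ℕ × (Fin n → α)))
    (hk : ∀ r ∈ A.support, ∀ mem, Holds src r.2.1 mem → (∀ v, (mem v).walked = r.2.2) →
      Runs G b (fun v => k v (mem v)) (R r.2.1 r.2.2)) :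
    Runs G b (fun v => p v >>= k v)
      (A.bind fun r => (R r.2.1 r.2.2).map fun y => (r.1 + y.1, y.2)) := by
  classical
  obtain ⟨μ, h1, h2, rfl⟩ := h
  obtain ⟨r₀, -⟩ := μ.support_nonempty
  set x₀ := r₀.1.2.1
  set R' : (Fin n → Memory) → PMF (ℕ × (Fin n → α)) := fun mem =>
    R (if h : ∃ y, Holds src y mem then h.choose else x₀) (mem x₀).walked with hR'
  have h3 : ∀ r ∈ μ.support, R' r.2 = R r.1.2.1 r.1.2.2 := by
    intro r hr
    obtain ⟨h4, h5⟩ := h2 r hr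
    have hex : ∃ y, Holds src y r.2 := ⟨_, h4⟩
    have hy : hex.choose = r.1.2.1 := by
      by_contra hne
      have e1 := hex.choose_spec hex.choose
      have e2 := h4 hex.choose
      rw [if_pos rfl] at e1
      rw [if_neg hne] at e2
      exact absurd (e1.symm.trans e2) (by simp)
    rw [hR']
    dsimp only
    rw [dif_pos hex, hy, h5]
  refine (h1.bind (k := k) (ν := R') fun x hx => ?_).congr ?_
  · rw [PMF.mem_support_map_iff] at hx
    obtain ⟨r, hr, rfl⟩ := hx
    rw [h3 r hr]
    exact hk r.1 ((PMF.mem_support_map_iff _ _ _).2 ⟨r, hr, rfl⟩) r.2 (h2 r hr).1 (h2 r hr).2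
  · simp only [seqLaw, PMF.bind_map, Function.comp_def]
    refine ext_of_expect fun f => ?_
    rw [expect_bind, expect_bind]
    exact expect_congr fun r hr => by rw [h3 r hr]

theorem chainLaw_support (hG : G.Connected) (hadj : ∀ v, ∃ u, G.Adj v u) {lam ℓ : ℕ} (hlam : 0 < lam)
    (k : ℕ) : ∀ (c : Fin n → ℕ) (x : Fin n) (w : ℕ), w ≤ ℓ →
      ∀ r ∈ (chainLaw G lam ℓ k c x w).support, r.2.2 ≤ ℓ ∧ w ≤ r.2.2 ∧
        G.dist x r.2.1 ≤ r.2.2 - w ∧ r.1 ≤ k * (6 * G.diam + 2 * lam) ∧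
        (ℓ ≤ w + k → ℓ < r.2.2 + 2 * lam) := by
  induction k with
  | zero =>
    intro c x w hw r hr
    rw [chainLaw, PMF.support_pure, Set.mem_singleton_iff] at hr
    subst hr
    simp only [SimpleGraph.dist_self]
    omega
  | succ k ih =>
    intro c x w hw r hr
    rw [chainLaw] at hr
    by_cases h : w + 2 * lam ≤ ℓ
    swap
    · rw [if_neg h, PMF.support_pure, Set.mem_singleton_iff] at hr
      subst hr
      simp only [SimpleGraph.dist_self]
      omega
    rw [if_pos h] at hr
    simp only [PMF.mem_support_bind_iff, PMF.mem_support_map_iff] at hr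
    obtain ⟨e, he, r, hr, rfl⟩ := hr
    obtain ⟨h1, h2⟩ := walkLaw_length hlam he
    have h3 : G.dist x e.2.2 ≤ e.2.1 := by
      simp only [walkLaw, PMF.mem_support_bind_iff, PMF.mem_support_map_iff] at he
      obtain ⟨i, -, y, hy, rfl⟩ := he
      exact dist_le_of_mem_support_srw hG hadj hy
    obtain ⟨h4, h5, h6, h7, h8⟩ := ih _ _ _ (by omega) r hr
    have h9 := hG.dist_triangle (u := x) (v := e.2.2) (w := r.2.1)
    refine ⟨h4, by simp only [later]; omega, by simp only [later]; omega, ?_, fun h' => h8 (by omega)⟩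
    have h10 := Nat.succ_mul k (6 * G.diam + 2 * lam)
    rw [Nat.succ_eq_add_one] at h10
    simp only [later]
    split_ifs <;> omega

theorem chainLaw_bind_srw {lam ℓ : ℕ} (hlam : 0 < lam) (k : ℕ) : ∀ (c : Fin n → ℕ) (x : Fin n) (w : ℕ),
    w ≤ ℓ → ((chainLaw G lam ℓ k c x w).bind fun r => G.srw r.2.1 (ℓ - r.2.2)) = G.srw x (ℓ - w) := by
  induction k with
  | zero =>
    intro c x w _
    rw [chainLaw, PMF.pure_bind]
  | succ k ih =>
    intro c x w _
    rw [chainLaw]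
    by_cases h : w + 2 * lam ≤ ℓ
    swap
    · rw [if_neg h, PMF.pure_bind]
    rw [if_pos h, PMF.bind_bind]
    have h1 : ∀ e ∈ (walkLaw G lam x).support, ((chainLaw G lam ℓ k
          (Function.update c x ((if c x = 0 then ℓ / lam else c x) - 1)) e.2.2 (w + e.2.1)).map
        (later (if c x = 0 then 3 * G.diam + 2 * lam + 3 * G.diam else 3 * G.diam))).bind
          (fun r => G.srw r.2.1 (ℓ - r.2.2)) = G.srw e.2.2 (ℓ - (w + e.2.1)) := by
      intro e he
      obtain ⟨h1, h2⟩ := walkLaw_length hlam he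
      rw [PMF.bind_map]
      exact ih _ _ _ (by omega)
    refine ext_of_expect fun f => ?_
    rw [expect_bind, expect_congr fun e he => by rw [h1 e he], walkLaw, expect_bind]
    simp only [expect_map]
    rw [← expect_const (PMF.uniformOfFintype (Fin (lam - 1 + 1))) (expect (G.srw x (ℓ - w)) f)]
    refine expect_congr fun i _ => ?_
    have := i.2
    rw [show ℓ - w = lam + i + (ℓ - (w + (lam + i))) by omega, srw_add x (lam + i),
      expect_bind]

/-- The running time and the outputs of the whole algorithm after Phase 1, given the progress. -/
noncomputable def finalLaw (G : SimpleGraph (Fin n)) (s : Fin n) (ℓ : ℕ) (A : PMF (Progress n)) :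
    PMF (ℕ × (Fin n → Output)) :=
  A.bind fun r => (G.srw r.2.1 (ℓ - r.2.2)).map fun y =>
    (r.1 + (ℓ - r.2.2 + min ℓ G.diam), correctOutput s y)

/-- Phase 2 of the algorithm. -/
def phaseTwo (P : Params) (I : Input n) (stored : List (ℕ × ℕ)) : Prog n Output :=
  stitch I P I.len ⟨stored, if I.isSource then some I.id.val else none, 0⟩ >>= complete I

theorem singleRandomWalk_eq (P : Params) (I : Input n) : singleRandomWalk P I =
    (if I.len < 2 * P.lam then pure [] else phaseOne I P) >>= phaseTwo P I := by
  unfold singleRandomWalk phaseTwo complete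
  split_ifs <;> rfl

theorem phaseTwo_runs (hG : G.Connected) (hadj : ∀ v, ∃ u, G.Adj v u) {s : Fin n} {P : Params}
    {ℓ H : ℕ} (hlam : 0 < P.lam) (hnH : n ≤ H) (hlH : 2 * P.lam ≤ H)
    (hℓH : ℓ ≤ H) (hH : 8 + 6 * Nat.size H ≤ b) {c : Fin n → ℕ} (hc : ∀ y, c y ≤ H)
    {st : Fin n → List (ℕ × ℕ)} (hst : walks st ∈ (fresh G P.lam c).support)
    (hgood : ∀ v, ∀ e ∈ st v, GoodWalk n P.lam e) :
    Runs G b (fun v => phaseTwo P (input G s ℓ v) (st v))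
      (finalLaw G s ℓ (stitchLaw G P.lam ℓ ℓ (walks st) s 0)) := by
  set mem : Fin n → Memory := fun v => ⟨st v, if v = s then some s.val else none, 0⟩ with hmem
  have hready : Ready s.val P.lam H s 0 mem :=
    ⟨fun v => rfl, fun v => rfl, hgood, fun y => (unused_of_mem_support_fresh hst).trans_le (hc y)⟩
  have h1 := stitch_tracks (s := s) hG hadj hlam hnH s.2 hlH hℓH hH ℓ s 0 mem hready
  have h2 := h1.finish (fun v => complete (input G s ℓ v)) (fun x w => (G.srw x (ℓ - w)).map fun y =>
    (ℓ - w + min ℓ G.diam, correctOutput s y)) fun r hr m hm hm' => by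
      have hr' : r ∈ (chainLaw G P.lam ℓ ℓ c s 0).support := by
        rw [← fresh_stitchLaw hlam, PMF.mem_support_bind_iff]
        exact ⟨_, hst, hr⟩
      obtain ⟨h3, -, h5, -⟩ := chainLaw_support hG hadj hlam _ _ _ _ (Nat.zero_le _) r hr'
      exact complete_runs hG hadj (fun a ha => (msgBits_le (H := H) (by simp) (by
        simp only [List.mem_cons, List.not_mem_nil, or_false]
        rintro z rfl; omega)).trans hH) hm hm' h3 h5
  have hprog : (fun v => phaseTwo P (input G s ℓ v) (st v)) = fun v =>
      stitch (input G s ℓ v) P ℓ (mem v) >>= complete (input G s ℓ v) := by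
    funext v
    rw [phaseTwo, hmem]
    by_cases h : v = s
    · subst h; simp [input]
    · simp [input, h]
  rw [hprog]
  refine h2.congr ?_
  simp only [finalLaw, PMF.map_comp]
  rfl

theorem finalLaw_fresh {lam ℓ : ℕ} (hlam : 0 < lam) {s : Fin n} {c : Fin n → ℕ}
    {μ : PMF (ℕ × (Fin n → List (ℕ × ℕ)))} (hμ : (μ.map fun x => walks x.2) = fresh G lam c) :
    (μ.bind fun x => finalLaw G s ℓ (stitchLaw G lam ℓ ℓ (walks x.2) s 0)) =
      finalLaw G s ℓ (chainLaw G lam ℓ ℓ c s 0) := by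
  rw [← fresh_stitchLaw hlam, ← hμ]
  simp only [finalLaw, PMF.bind_map, PMF.bind_bind, Function.comp_def]

/-- The law of time and outputs of the whole algorithm. -/
theorem program_runs (hG : G.Connected) (hadj : ∀ v, ∃ u, G.Adj v u) {s : Fin n} {P : Params}
    {ℓ H : ℕ} (hlam : 0 < P.lam) (hnH : n ≤ H) (hlH : 2 * P.lam ≤ H)
    (hℓH : ℓ ≤ H) (hH : 8 + 6 * Nat.size H ≤ b) {c : Fin n → ℕ} (hc : ∀ y, c y ≤ H)
    {first : Fin n → Prog n (List (ℕ × ℕ))} {μ₁ : PMF (ℕ × (Fin n → List (ℕ × ℕ)))}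
    (h1 : Runs G b first μ₁) (hgood : ∀ x ∈ μ₁.support, ∀ v, ∀ e ∈ x.2 v, GoodWalk n P.lam e)
    (hfresh : (μ₁.map fun x => walks x.2) = fresh G P.lam c) :
    ∃ μ : PMF (ℕ × (Fin n → Output)),
      Runs G b (fun v => first v >>= phaseTwo P (input G s ℓ v)) μ ∧
      μ.map Prod.snd = (G.srw s ℓ).map (correctOutput s) ∧
      (∀ x ∈ μ.support, ∃ y ∈ μ₁.support, ∃ r ∈ (chainLaw G P.lam ℓ ℓ c s 0).support,
        x.1 = y.1 + (r.1 + (ℓ - r.2.2 + min ℓ G.diam))) ∧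
      ∀ t₁ t₂, μ.toOuterMeasure {x | t₁ + t₂ < x.1} ≤ μ₁.toOuterMeasure {x | t₁ < x.1} +
        (chainLaw G P.lam ℓ ℓ c s 0).toOuterMeasure {r | t₂ < r.1 + (ℓ - r.2.2 + min ℓ G.diam)} := by
  set A : (Fin n → List (ℕ × ℕ)) → PMF (ℕ × (Fin n → Output)) := fun st =>
    finalLaw G s ℓ (stitchLaw G P.lam ℓ ℓ (walks st) s 0) with hA
  have hst : ∀ x ∈ μ₁.support, walks x.2 ∈ (fresh G P.lam c).support := fun x hx => by
    rw [← hfresh, PMF.mem_support_map_iff]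
    exact ⟨x, hx, rfl⟩
  have hAC : (μ₁.bind fun x => A x.2) = finalLaw G s ℓ (chainLaw G P.lam ℓ ℓ c s 0) :=
    finalLaw_fresh hlam hfresh
  refine ⟨seqLaw μ₁ A, h1.bind (ν := A) fun x hx => phaseTwo_runs hG hadj hlam hnH hlH hℓH hH hc
    (hst x hx) (hgood x hx), ?_, ?_, ?_⟩
  · have : (seqLaw μ₁ A).map Prod.snd = (μ₁.bind fun x => A x.2).map Prod.snd := by
      simp only [seqLaw, PMF.map_bind, PMF.map_comp]
      rfl
    rw [this, hAC, finalLaw, PMF.map_bind]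
    simp only [PMF.map_comp]
    have hex := chainLaw_bind_srw (G := G) (ℓ := ℓ) hlam ℓ c s 0 (Nat.zero_le _)
    rw [Nat.sub_zero] at hex
    rw [← hex, PMF.map_bind]
    rfl
  · intro x hx
    simp only [seqLaw, PMF.mem_support_bind_iff, PMF.mem_support_map_iff] at hx
    obtain ⟨y, hy, z, hz, rfl⟩ := hx
    have hz' : z ∈ (finalLaw G s ℓ (chainLaw G P.lam ℓ ℓ c s 0)).support := by
      rw [← hAC, PMF.mem_support_bind_iff]
      exact ⟨y, hy, hz⟩
    simp only [finalLaw, PMF.mem_support_bind_iff, PMF.mem_support_map_iff] at hz'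
    obtain ⟨r, hr, _, -, rfl⟩ := hz'
    exact ⟨y, hy, r, hr, rfl⟩
  · intro t₁ t₂
    have h2 : (chainLaw G P.lam ℓ ℓ c s 0).toOuterMeasure
        {r | t₂ < r.1 + (ℓ - r.2.2 + min ℓ G.diam)} =
        expect μ₁ fun x => (A x.2).toOuterMeasure {y | t₂ < y.1} := by
      simp only [toOuterMeasure_eq_expect, Set.mem_ofPred_eq]
      rw [← expect_bind, hAC, finalLaw, expect_bind]
      simp only [expect_map]
      exact expect_congr fun r _ => (expect_const _ _).symm
    rw [h2]
    simp only [toOuterMeasure_eq_expect, Set.mem_ofPred_eq]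
    rw [← expect_add, seqLaw, expect_bind]
    simp only [expect_map]
    refine expect_mono fun x _ => ?_
    by_cases h : t₁ < x.1
    · rw [if_pos h]
      refine le_trans ?_ (self_le_add_right _ _)
      refine (expect_mono (g := fun _ => 1) fun y _ => ?_).trans (expect_const (A x.2) 1).le
      split_ifs
      · exact le_rfl
      · exact zero_le_one
    · rw [if_neg h, zero_add]
      refine expect_mono fun y _ => ?_
      split_ifs <;> first | exact le_rfl | exact zero_le_one | (exfalso; omega)

end Program

section Green

/-- Transition probabilities as real numbers. -/
noncomputable def prob (G : SimpleGraph (Fin n)) (t : ℕ) (x y : Fin n) : ℝ := (G.srw x t y).toReal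

theorem prob_nonneg (t : ℕ) (x y : Fin n) : 0 ≤ prob G t x y := ENNReal.toReal_nonneg

theorem sum_prob (t : ℕ) (x : Fin n) : ∑ y, prob G t x y = 1 := by
  simp only [prob]
  rw [← ENNReal.toReal_sum fun y _ => PMF.apply_ne_top _ _, ← tsum_fintype (L := .unconditional _), PMF.tsum_coe,
    ENNReal.toReal_one]

theorem deg_mul_prob_comm (t : ℕ) (x y : Fin n) :
    (deg G x : ℝ) * prob G t x y = deg G y * prob G t y x := by
  have := congrArg ENNReal.toReal (deg_mul_srw_comm (G := G) t x y)
  simpa [prob, ENNReal.toReal_mul] using this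

open scoped Classical in
theorem deg_mul_prob_succ (t : ℕ) (x y : Fin n) :
    (deg G x : ℝ) * prob G (t + 1) x y = ∑ z, if G.Adj x z then prob G t z y else 0 := by
  have h : (deg G x : ℝ≥0∞) * G.srw x (t + 1) y = ∑ z, if G.Adj x z then G.srw z t y else 0 := by
    rw [srw_succ', PMF.bind_apply, tsum_fintype, Finset.mul_sum]
    refine Finset.sum_congr rfl fun z _ => ?_
    rw [← mul_assoc, deg_mul_srwStep]
    split_ifs <;> simp
  have := congrArg ENNReal.toReal h
  rw [ENNReal.toReal_mul, ENNReal.toReal_natCast, ENNReal.toReal_sum] at this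
  · rw [prob, this]
    refine Finset.sum_congr rfl fun z _ => ?_
    split_ifs <;> rfl
  · intro z _
    split_ifs
    · exact PMF.apply_ne_top _ _
    · simp

/-- The expected number of visits to `y` in the first `L` steps from `x`, divided by the degree. -/
noncomputable def green (G : SimpleGraph (Fin n)) (L : ℕ) (y x : Fin n) : ℝ :=
  (∑ t ∈ Finset.range L, prob G t x y) / deg G y

theorem green_nonneg (L : ℕ) (y x : Fin n) : 0 ≤ green G L y x :=
  div_nonneg (Finset.sum_nonneg fun _ _ => prob_nonneg _ _ _) (Nat.cast_nonneg _)

theorem sum_deg_mul_green (L : ℕ) (y : Fin n) (hy : deg G y ≠ 0) :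
    ∑ x, (deg G x : ℝ) * green G L y x = L := by
  have hy' : (deg G y : ℝ) ≠ 0 := by exact_mod_cast hy
  simp only [green, mul_div_assoc', Finset.mul_sum, ← Finset.sum_div, deg_mul_prob_comm _ _ y]
  rw [Finset.sum_comm]
  simp only [← Finset.mul_sum, sum_prob]
  rw [Finset.sum_const, Finset.card_range, nsmul_eq_mul, mul_one, mul_div_cancel_left₀ _ hy']

open scoped Classical in
theorem sum_sub_green (L : ℕ) (y x : Fin n) (hy : deg G y ≠ 0) :
    (∑ z, if G.Adj x z then green G L y x - green G L y z else 0) =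
      prob G 0 y x - prob G L y x := by
  have hy' : (deg G y : ℝ) ≠ 0 := by exact_mod_cast hy
  have hdeg : ∀ a : ℝ, (∑ z, if G.Adj x z then a else 0) = deg G x * a := by
    intro a
    rw [← Finset.sum_filter, Finset.sum_const, nsmul_eq_mul, deg]
    congr 3
    ext z; simp
  have h1 : ∀ t, (∑ z, if G.Adj x z then prob G t x y - prob G t z y else 0) =
      deg G y * (prob G t y x - prob G (t + 1) y x) := by
    intro t
    rw [mul_sub, ← deg_mul_prob_comm t x y, ← deg_mul_prob_comm (t + 1) x y, deg_mul_prob_succ,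
      ← hdeg,
      ← Finset.sum_sub_distrib]
    refine Finset.sum_congr rfl fun z _ => ?_
    split_ifs <;> simp
  have h2 : (∑ z, if G.Adj x z then green G L y x - green G L y z else 0) =
      (∑ t ∈ Finset.range L, ∑ z, if G.Adj x z then prob G t x y - prob G t z y else 0) /
        deg G y := by
    rw [Finset.sum_comm, Finset.sum_div]
    refine Finset.sum_congr rfl fun z _ => ?_
    split_ifs
    · rw [green, green, ← sub_div, Finset.sum_sub_distrib]
    · simp
  rw [h2]
  simp only [h1]
  rw [← Finset.mul_sum, mul_div_cancel_left₀ _ hy', Finset.sum_range_sub']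

theorem green_le_add_one (L : ℕ) (y : Fin n) (hy : deg G y ≠ 0) {u v : Fin n} (h : G.Adj u v) :
    green G L y u ≤ green G L y v + 1 := by
  classical
  by_contra hlt
  push Not at hlt
  set g := green G L y with hg
  set S : Finset (Fin n) := Finset.univ.filter fun x => g u ≤ g x with hS
  set F : Fin n → Fin n → ℝ := fun x z => if G.Adj x z then g x - g z else 0 with hF
  have h1 : ∑ x ∈ S, ∑ z, F x z ≤ 1 := by
    simp only [hF, hg, sum_sub_green L y _ hy]
    calc ∑ x ∈ S, (prob G 0 y x - prob G L y x) ≤ ∑ x ∈ S, prob G 0 y x :=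
          Finset.sum_le_sum fun x _ => sub_le_self _ (prob_nonneg _ _ _)
      _ ≤ ∑ x, prob G 0 y x := Finset.sum_le_univ_sum_of_nonneg fun x => prob_nonneg _ _ _
      _ = 1 := sum_prob _ _
  have h2 : ∑ x ∈ S, ∑ z ∈ S, F x z = 0 := by
    have h3 : ∑ x ∈ S, ∑ z ∈ S, F x z = - ∑ x ∈ S, ∑ z ∈ S, F x z := by
      conv_lhs => rw [Finset.sum_comm]
      simp only [← Finset.sum_neg_distrib]
      refine Finset.sum_congr rfl fun x _ => Finset.sum_congr rfl fun z _ => ?_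
      simp only [hF, G.adj_comm z x]
      split_ifs <;> ring
    linarith
  have h3 : ∑ x ∈ S, ∑ z, F x z = ∑ x ∈ S, ∑ z ∈ Sᶜ, F x z := by
    rw [← zero_add (∑ x ∈ S, ∑ z ∈ Sᶜ, F x z), ← h2, ← Finset.sum_add_distrib]
    exact Finset.sum_congr rfl fun x _ => (Finset.sum_add_sum_compl S _).symm
  have h4 : ∀ x ∈ S, ∀ z ∈ Sᶜ, 0 ≤ F x z := by
    intro x hx z hz
    simp only [hS, Finset.mem_filter, Finset.mem_univ, true_and, Finset.mem_compl, not_le] at hx hz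
    simp only [hF]
    split_ifs
    · linarith
    · exact le_rfl
  have hu : u ∈ S := by simp [hS]
  have hv : v ∈ Sᶜ := by
    simp only [hS, Finset.mem_compl, Finset.mem_filter, Finset.mem_univ, true_and, not_le]; linarith
  have h5 : F u v ≤ ∑ x ∈ S, ∑ z ∈ Sᶜ, F x z :=
    (Finset.single_le_sum (f := fun z => F u z) (fun z hz => h4 u hu z hz) hv).trans
      (Finset.single_le_sum (f := fun x => ∑ z ∈ Sᶜ, F x z)
        (fun x hx => Finset.sum_nonneg fun z hz => h4 x hx z hz) hu)
  have h6 : F u v = g u - g v := if_pos h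
  linarith

theorem exists_dist_eq (hG : G.Connected) {u : Fin n} {k : ℕ} {v : Fin n} (h : k ≤ G.dist u v) :
    ∃ w, G.dist u w = k := by
  obtain ⟨p, hp⟩ := (hG u v).exists_walk_length_eq_dist
  refine ⟨p.getVert k, le_antisymm ?_ ?_⟩
  · refine (SimpleGraph.dist_le (p.take k)).trans ?_
    rw [SimpleGraph.Walk.take_length]
    exact min_le_left _ _
  · have h1 := SimpleGraph.dist_le (p.drop k)
    have h2 := hG.dist_triangle (u := u) (v := p.getVert k) (w := v)
    rw [SimpleGraph.Walk.drop_length] at h1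
    omega

theorem green_le_add_dist (hG : G.Connected) (L : ℕ) (y : Fin n) (hy : deg G y ≠ 0) (k : ℕ) :
    ∀ u v : Fin n, G.dist u v = k → green G L y u ≤ green G L y v + k := by
  induction k with
  | zero =>
    intro u v h
    rw [hG.dist_eq_zero_iff] at h
    subst h; simp
  | succ k ih =>
    intro u v h
    obtain ⟨p, hp⟩ := (hG u v).exists_walk_length_eq_dist
    cases p with
    | nil => simp at h
    | @cons _ w _ hadj p =>
      rw [SimpleGraph.Walk.length_cons] at hp
      have h1 := SimpleGraph.dist_le p
      have h2 : G.dist u v ≤ G.dist w v + 1 := by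
        have := hG.dist_triangle (u := u) (v := w) (w := v)
        rw [SimpleGraph.dist_eq_one_iff_adj.2 hadj] at this
        omega
      have h3 := ih w v (by omega)
      have h4 := green_le_add_one L y hy hadj
      push_cast
      linarith

/-- The Green function is at most of order `√L`, as long as the walk does not see the whole
network. -/
theorem green_le (hG : G.Connected) (hadj : ∀ v, ∃ u, G.Adj v u) (L : ℕ) (y x : Fin n) :
    green G L y x ^ 2 ≤ 4 * L ∨ green G L y x * ∑ v, (deg G v : ℝ) ≤ 2 * L := by
  classical
  have hdeg : ∀ v, 1 ≤ deg G v := fun v => by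
    obtain ⟨u, hu⟩ := hadj v
    exact Finset.card_pos.2 ⟨u, by simpa using hu⟩
  have hdeg' : ∀ v, (1 : ℝ) ≤ deg G v := fun v => by exact_mod_cast hdeg v
  have hy : deg G y ≠ 0 := Nat.one_le_iff_ne_zero.1 (hdeg y)
  set M := green G L y x with hM
  have hM0 : 0 ≤ M := green_nonneg _ _ _
  set k := ⌊M / 2⌋₊ with hk
  have hk1 : (k : ℝ) ≤ M / 2 := Nat.floor_le (by positivity)
  have hk2 : M / 2 < k + 1 := Nat.lt_floor_add_one _
  have hsum := sum_deg_mul_green (G := G) L y hy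
  by_cases hfar : ∃ v, k ≤ G.dist x v
  · left
    obtain ⟨v, hv⟩ := hfar
    have : Nonempty (Fin n) := ⟨x⟩
    choose! w hw using fun i (hi : i ≤ k) => exists_dist_eq hG (hi.trans hv)
    have hinj : Set.InjOn w (Finset.range (k + 1) : Finset ℕ) := by
      intro i hi j hj hij
      simp only [Finset.coe_range, Set.mem_Iio] at hi hj
      rw [← hw i (by omega), ← hw j (by omega), hij]
    have h1 : ∑ i ∈ Finset.range (k + 1), (M / 2) ≤ L := by
      calc ∑ i ∈ Finset.range (k + 1), (M / 2)
          ≤ ∑ i ∈ Finset.range (k + 1), (deg G (w i) : ℝ) * green G L y (w i) := by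
            refine Finset.sum_le_sum fun i hi => ?_
            rw [Finset.mem_range] at hi
            have h2 := green_le_add_dist hG L y hy i x (w i) (hw i (by omega))
            have h3 : (i : ℝ) ≤ k := by exact_mod_cast Nat.lt_succ_iff.1 hi
            have h4 := hdeg' (w i)
            nlinarith [green_nonneg (G := G) L y (w i)]
        _ = ∑ v ∈ (Finset.range (k + 1)).image w, (deg G v : ℝ) * green G L y v :=
            (Finset.sum_image (f := fun v => (deg G v : ℝ) * green G L y v) hinj).symm
        _ ≤ ∑ v, (deg G v : ℝ) * green G L y v := Finset.sum_le_univ_sum_of_nonneg fun v =>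
            mul_nonneg (Nat.cast_nonneg _) (green_nonneg _ _ _)
        _ = L := hsum
    rw [Finset.sum_const, Finset.card_range, nsmul_eq_mul] at h1
    push_cast at h1
    nlinarith
  · right
    push Not at hfar
    have h1 : ∀ v, M / 2 ≤ green G L y v := fun v => by
      have h2 := green_le_add_dist hG L y hy _ x v rfl
      have h3 : (G.dist x v : ℝ) ≤ k := by exact_mod_cast (hfar v).le
      linarith
    have h2 : ∑ v, (deg G v : ℝ) * (M / 2) ≤ L := by
      rw [← hsum]
      exact Finset.sum_le_sum fun v _ => mul_le_mul_of_nonneg_left (h1 v) (Nat.cast_nonneg _)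
    rw [← Finset.sum_mul] at h2
    linarith

end Green

section Failure

/-- A bound on the expected number of short walks that will be needed from `y`, if the walk is at
`x` and has made `w` steps. -/
noncomputable def demand (G : SimpleGraph (Fin n)) (lam ℓ : ℕ) (y x : Fin n) (w : ℕ) : ℝ≥0∞ :=
  (if x = y then 1 else 0) + (lam : ℝ≥0∞)⁻¹ * ∑ t ∈ Finset.Ico lam (ℓ - w + 1), G.srw x t y

theorem expect_srw_apply (x y : Fin n) (j t : ℕ) :
    expect (G.srw x j) (fun z => G.srw z t y) = G.srw x (j + t) y := by
  rw [srw_add, PMF.bind_apply]; rfl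

theorem expect_demand_add_le {lam ℓ : ℕ} (hlam : 0 < lam) (y x : Fin n) {w : ℕ}
    (hw : w + 2 * lam ≤ ℓ) :
    expect (walkLaw G lam x) (fun e => demand G lam ℓ y e.2.2 (w + e.2.1)) +
      (if x = y then 1 else 0) ≤ demand G lam ℓ y x w := by
  have hlam0 : (lam : ℝ≥0∞) ≠ 0 := by exact_mod_cast hlam.ne'
  have hcast : ((lam - 1 + 1 : ℕ) : ℝ≥0∞) = lam := by rw [Nat.sub_add_cancel hlam]
  set X := ∑ t ∈ Finset.Ico (2 * lam) (ℓ - w + 1), G.srw x t y with hX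
  have h1 : ∀ i : Fin (lam - 1 + 1), expect ((G.srw x (lam + i)).map fun z => ((x.val, lam + i, z) :
      ShortWalk n)) (fun e => demand G lam ℓ y e.2.2 (w + e.2.1)) ≤
        G.srw x (lam + i) y + (lam : ℝ≥0∞)⁻¹ * X := by
    intro i
    have hi := i.2
    rw [expect_map]
    simp only [demand]
    rw [expect_add, expect_mul_left, expect_sum]
    refine add_le_add (le_of_eq ?_) (mul_le_mul_right ?_ _)
    · rw [expect, tsum_fintype]
      simp
    · simp only [expect_srw_apply]
      rw [Finset.sum_Ico_add (fun t => G.srw x t y) lam _ (lam + i)]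
      refine Finset.sum_le_sum_of_subset (Finset.Ico_subset_Ico ?_ ?_) <;> omega
  have h2 : expect (walkLaw G lam x) (fun e => demand G lam ℓ y e.2.2 (w + e.2.1)) ≤
      (lam : ℝ≥0∞)⁻¹ * ∑ t ∈ Finset.Ico lam (ℓ - w + 1), G.srw x t y := by
    rw [walkLaw, expect_bind, expect_uniformOfFintype, Fintype.card_fin, hcast, div_eq_mul_inv,
      mul_comm]
    refine mul_le_mul_right ((Finset.sum_le_sum fun i _ => h1 i).trans (le_of_eq ?_)) _
    rw [Finset.sum_add_distrib, Finset.sum_const, Finset.card_univ, Fintype.card_fin, nsmul_eq_mul,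
      hcast, ← mul_assoc, ENNReal.mul_inv_cancel hlam0 (by simp), one_mul, hX,
      ← Finset.sum_Ico_consecutive _ (show lam ≤ 2 * lam by omega) (show 2 * lam ≤ ℓ - w + 1 by omega)]
    congr 1
    rw [Finset.sum_Ico_eq_sum_range, show 2 * lam - lam = lam - 1 + 1 by omega,
      Finset.sum_range]
  rw [demand, add_comm]
  exact add_le_add le_rfl h2

/-- Weight of the event that the `c` short walks of a node of degree `d` do not suffice. -/
noncomputable def scarcity (d c : ℕ) : ℝ≥0∞ := ((1 + (4 * d : ℝ≥0∞)⁻¹)⁻¹) ^ c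

noncomputable def potential (G : SimpleGraph (Fin n)) (lam ℓ : ℕ) (c : Fin n → ℕ) (x : Fin n)
    (w : ℕ) : ℝ≥0∞ :=
  ∑ y, scarcity (deg G y) (c y) * (1 + 2 * (4 * deg G y : ℝ≥0∞)⁻¹ * demand G lam ℓ y x w)

theorem two_mul_inv_mul_le {d : ℕ} (hd : d ≠ 0) {u : ℝ≥0∞} (hu : u ≤ 2 * d) :
    2 * (4 * d : ℝ≥0∞)⁻¹ * u ≤ 1 := by
  have hd' : (4 * d : ℝ≥0∞) ≠ 0 := by
    simp [hd]
  calc 2 * (4 * d : ℝ≥0∞)⁻¹ * u ≤ 2 * (4 * d : ℝ≥0∞)⁻¹ * (2 * d) := mul_le_mul_right hu _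
    _ = (4 * d : ℝ≥0∞)⁻¹ * (4 * d) := by ring
    _ = 1 := ENNReal.inv_mul_cancel hd' (ENNReal.mul_ne_top (by simp) (by simp))

theorem scarcity_le (d : ℕ) (hd : d ≠ 0) (k : ℕ) : scarcity d (4 * k * d) ≤ (2 ^ k)⁻¹ := by
  have hd' : (4 * d : ℝ≥0∞) ≠ 0 := by simp [hd]
  set e : ℝ≥0∞ := (4 * d : ℝ≥0∞)⁻¹ with he
  have h1 : ∀ N : ℕ, 1 + N * e ≤ (1 + e) ^ N := by
    intro N
    induction N with
    | zero => simp
    | succ N ih =>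
      rw [pow_succ]
      refine le_trans ?_ (mul_le_mul_left ih (1 + e))
      push_cast
      calc 1 + ((N : ℝ≥0∞) + 1) * e ≤ 1 + (N + 1) * e + N * e * e := self_le_add_right _ _
        _ = (1 + N * e) * (1 + e) := by ring
  have h2 : (2 : ℝ≥0∞) ≤ (1 + e) ^ (4 * d) := by
    refine le_trans (le_of_eq ?_) (h1 (4 * d))
    push_cast
    rw [ENNReal.mul_inv_cancel hd' (ENNReal.mul_ne_top (by simp) (by simp))]
    norm_num
  rw [scarcity, ← ENNReal.inv_pow, ENNReal.inv_le_inv, show 4 * k * d = 4 * d * k by ring, pow_mul]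
  exact pow_le_pow_left₀ (zero_le) h2 k

theorem potential_initial_le {lam ℓ : ℕ} (hdeg : ∀ v, deg G v ≠ 0)
    (hdem : ∀ y x w, demand G lam ℓ y x w ≤ 2 * deg G y) (k : ℕ) (x : Fin n) :
    potential G lam ℓ (fun v => 4 * k * deg G v) x 0 ≤ n * (2 * (2 ^ k)⁻¹) := by
  refine (Finset.sum_le_sum (g := fun _ => 2 * (2 ^ k)⁻¹) fun y _ => ?_).trans (le_of_eq ?_)
  · rw [mul_comm]
    refine mul_le_mul' ?_ (scarcity_le _ (hdeg y) k)
    exact (add_le_add le_rfl (two_mul_inv_mul_le (hdeg y) (hdem y x 0))).trans (by norm_num)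
  · rw [Finset.sum_const, Finset.card_univ, Fintype.card_fin, nsmul_eq_mul]

theorem expect_potential_le {lam ℓ : ℕ} (hlam : 0 < lam) (hdeg : ∀ v, deg G v ≠ 0)
    (hdem : ∀ y x w, demand G lam ℓ y x w ≤ 2 * deg G y) {c : Fin n → ℕ} {x : Fin n} {w : ℕ}
    (hw : w + 2 * lam ≤ ℓ) (hc : c x ≠ 0) :
    expect (walkLaw G lam x) (fun e =>
      potential G lam ℓ (Function.update c x (c x - 1)) e.2.2 (w + e.2.1)) ≤
      potential G lam ℓ c x w := by
  simp only [potential]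
  rw [expect_sum]
  refine Finset.sum_le_sum fun y _ => ?_
  rw [expect_mul_left, expect_add, expect_const, expect_mul_left]
  have h1 := expect_demand_add_le (G := G) hlam y x hw
  set E := expect (walkLaw G lam x) fun e => demand G lam ℓ y e.2.2 (w + e.2.1) with hE
  set e : ℝ≥0∞ := (4 * deg G y : ℝ≥0∞)⁻¹ with he
  by_cases hy : x = y
  swap
  · rw [Function.update_of_ne (Ne.symm hy)]
    rw [if_neg hy, add_zero] at h1
    exact mul_le_mul_right (add_le_add le_rfl (mul_le_mul_right h1 _)) _
  subst hy
  rw [if_pos rfl] at h1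
  rw [Function.update_self]
  obtain ⟨k, hk⟩ := Nat.exists_eq_succ_of_ne_zero hc
  have h2 : scarcity (deg G x) (c x - 1) = scarcity (deg G x) (c x) * (1 + e) := by
    rw [hk, Nat.succ_sub_one, scarcity, scarcity, pow_succ, mul_assoc, ENNReal.inv_mul_cancel,
      mul_one]
    · simp
    · exact ENNReal.add_ne_top.2 ⟨by simp, ENNReal.inv_ne_top.2 (by simp [hdeg x])⟩
  rw [h2, mul_assoc]
  refine mul_le_mul_right ?_ _
  have h3 : 2 * e * E ≤ 1 := two_mul_inv_mul_le (hdeg x) ((self_le_add_right _ _).trans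
    (h1.trans (hdem x x w)))
  calc (1 + e) * (1 + 2 * e * E) = 1 + 2 * e * E + e + e * (2 * e * E) := by ring
    _ ≤ 1 + 2 * e * E + e + e * 1 := add_le_add le_rfl (mul_le_mul_right h3 _)
    _ = 1 + 2 * e * (E + 1) := by ring
    _ ≤ 1 + 2 * e * demand G lam ℓ x x w := add_le_add le_rfl (mul_le_mul_right h1 _)

theorem one_le_potential {lam ℓ : ℕ} {c : Fin n → ℕ} {x : Fin n} {w : ℕ} (hc : c x = 0) :
    1 ≤ potential G lam ℓ c x w := by
  refine le_trans ?_ (Finset.single_le_sum (fun y _ => zero_le) (Finset.mem_univ x))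
  rw [hc, scarcity, pow_zero, one_mul]
  exact self_le_add_right _ _

theorem ite_one_le_ite_one {p q : Prop} {_ : Decidable p} {_ : Decidable q} (h : p → q) :
    (if p then (1 : ℝ≥0∞) else 0) ≤ if q then 1 else 0 := by
  by_cases hp : p
  · rw [if_pos hp, if_pos (h hp)]
  · rw [if_neg hp]; exact zero_le

/-- The probability that Get-More-Walks is ever called. -/
theorem chainLaw_late_le {lam ℓ : ℕ} (hlam : 0 < lam) (hdeg : ∀ v, deg G v ≠ 0)
    (hdem : ∀ y x w, demand G lam ℓ y x w ≤ 2 * deg G y) (k : ℕ) :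
    ∀ (c : Fin n → ℕ) (x : Fin n) (w : ℕ), w ≤ ℓ →
      (chainLaw G lam ℓ k c x w).toOuterMeasure {r | 3 * G.diam * ((ℓ - w) / lam) < r.1} ≤
        potential G lam ℓ c x w := by
  induction k with
  | zero =>
    intro c x w _
    rw [chainLaw, toOuterMeasure_eq_expect, expect_pure, if_neg (by simp)]
    exact zero_le
  | succ k ih =>
    intro c x w _
    by_cases hw : w + 2 * lam ≤ ℓ
    swap
    · rw [chainLaw, if_neg hw, toOuterMeasure_eq_expect, expect_pure, if_neg (by simp)]
      exact zero_le
    by_cases hc : c x = 0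
    · refine le_trans ?_ (one_le_potential hc)
      rw [toOuterMeasure_eq_expect]
      refine (expect_mono (g := fun _ => 1) fun y _ => ?_).trans (expect_const _ 1).le
      split_ifs
      · exact le_rfl
      · exact zero_le_one
    refine le_trans ?_ (expect_potential_le hlam hdeg hdem hw hc)
    simp only [chainLaw, if_pos hw, if_neg hc]
    rw [toOuterMeasure_eq_expect, expect_bind]
    refine expect_mono fun e he => ?_
    obtain ⟨h1, h2⟩ := walkLaw_length hlam he
    refine le_trans ?_ (ih _ _ _ (show w + e.2.1 ≤ ℓ by omega))
    rw [expect_map, toOuterMeasure_eq_expect]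
    refine expect_mono fun r _ => ?_
    have h3 : (ℓ - (w + e.2.1)) / lam + 1 ≤ (ℓ - w) / lam := by
      rw [← Nat.add_div_right _ hlam]
      exact Nat.div_le_div_right (by omega)
    have h4 := Nat.mul_le_mul_left (3 * G.diam) h3
    rw [mul_add, mul_one] at h4
    refine ite_one_le_ite_one fun h => ?_
    simp only [Set.mem_ofPred_eq, later] at h ⊢
    omega

end Failure

section Whole

/-- A bound on all numbers that occur in messages. -/
def numberBound (n ℓ : ℕ) (P : Params) : ℕ := n + 2 * P.lam + ℓ + P.eta * n

theorem deg_le (v : Fin n) : deg G v ≤ n := by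
  classical
  exact (Finset.card_le_univ _).trans_eq (Fintype.card_fin n)

theorem short_runs (hG : G.Connected) (hadj : ∀ v, ∃ u, G.Adj v u) {s : Fin n} {P : Params} {ℓ : ℕ}
    (hlam : 0 < P.lam) (hℓ : ℓ < 2 * P.lam) (hb : 8 + 6 * Nat.size (numberBound n ℓ P) ≤ b) :
    ∃ μ : PMF (ℕ × (Fin n → Output)),
      Runs G b (fun v => singleRandomWalk P (input G s ℓ v)) μ ∧
      μ.map Prod.snd = (G.srw s ℓ).map (correctOutput s) ∧
      ∀ x ∈ μ.support, x.1 ≤ ℓ + min ℓ G.diam := by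
  have hchain : chainLaw G P.lam ℓ ℓ (fun _ => 0) s 0 = PMF.pure (0, s, 0) := by
    rcases ℓ with _ | ℓ
    · rfl
    · rw [chainLaw, if_neg (by omega)]
  obtain ⟨μ, h1, h2, h3, -⟩ := program_runs (b := b) (s := s) (ℓ := ℓ) (P := P)
    (H := numberBound n ℓ P) (c := fun _ => 0) (first := fun _ => pure [])
    (μ₁ := PMF.pure (0, fun _ => [])) hG hadj hlam
    (by rw [numberBound]; omega) (by rw [numberBound]; omega) (by rw [numberBound]; omega) hb
    (fun _ => Nat.zero_le _) (Runs.ret _) (by simp) (by simp [PMF.pure_map, fresh, walks, ← conv_one])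
  refine ⟨μ, ?_, h2, fun x hx => ?_⟩
  · have hprog : (fun v => singleRandomWalk P (input G s ℓ v)) = fun v =>
        (pure [] : Prog n (List (ℕ × ℕ))) >>= phaseTwo P (input G s ℓ v) := by
      funext v
      rw [singleRandomWalk_eq]
      congr 1
      exact if_pos hℓ
    rw [hprog]
    exact h1
  · obtain ⟨y, hy, r, hr, h⟩ := h3 x hx
    rw [PMF.support_pure, Set.mem_singleton_iff] at hy
    rw [hchain, PMF.support_pure, Set.mem_singleton_iff] at hr
    subst hy hr
    simp only at h
    omega

/-- The time after which all nodes have halted for sure. -/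
def haltTime (n ℓ D : ℕ) (P : Params) : ℕ :=
  2 * P.lam * P.eta * n ^ 2 * (2 * P.lam * P.slots + D) + (ℓ * (6 * D + 2 * P.lam) + (ℓ + D))

/-- The usual running time. -/
def usualTime (ℓ D : ℕ) (P : Params) : ℕ :=
  (2 * P.lam * P.slots + D) + (3 * D * (ℓ / P.lam) + 2 * P.lam + D)

theorem long_runs (hG : G.Connected) (hadj : ∀ v, ∃ u, G.Adj v u) {s : Fin n} {P : Params} {ℓ : ℕ}
    (hlam : 0 < P.lam) (hslots : 0 < P.slots) (hℓ : 2 * P.lam ≤ ℓ)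
    (hb : 8 + 6 * Nat.size (numberBound n ℓ P) ≤ b) :
    ∃ μ : PMF (ℕ × (Fin n → Output)),
      Runs G b (fun v => singleRandomWalk P (input G s ℓ v)) μ ∧
      μ.map Prod.snd = (G.srw s ℓ).map (correctOutput s) ∧
      (∀ x ∈ μ.support, x.1 ≤ haltTime n ℓ G.diam P) ∧
      μ.toOuterMeasure {x | usualTime ℓ G.diam P < x.1} ≤
        (2 * P.lam : ℕ) * (n ^ 2 : ℕ) * (4 ^ P.eta / 2 ^ P.slots) +
        (chainLaw G P.lam ℓ ℓ (fun v => P.eta * deg G v) s 0).toOuterMeasure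
          {r | 3 * G.diam * ((ℓ - 0) / P.lam) < r.1} := by
  have hH : n ≤ numberBound n ℓ P ∧ 2 * P.lam ≤ numberBound n ℓ P ∧ ℓ ≤ numberBound n ℓ P ∧
      P.eta * n ≤ numberBound n ℓ P := by
    rw [numberBound]; omega
  obtain ⟨μ₁, h1, h2, h3, h4⟩ := phaseOne_runs (b := b) (s := s) (ℓ := ℓ) hG hadj hslots hlam
    (fun t ht hc => (msgBits_le (H := numberBound n ℓ P) (by simp [Token.msg]) (by
      obtain ⟨h1, h2, h3⟩ := ht
      simp only at h1 h2 h3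
      simp only [Token.msg, List.mem_cons, List.not_mem_nil, or_false]
      rintro z (rfl | rfl | rfl) <;> omega)).trans hb) (by omega)
  obtain ⟨μ, h5, h6, h7, h8⟩ := program_runs (b := b) (s := s) (ℓ := ℓ) (P := P)
    (H := numberBound n ℓ P) (c := fun v => P.eta * deg G v)
    (first := fun v => phaseOne (input G s ℓ v) P) hG hadj hlam hH.1 hH.2.1 hH.2.2.1 hb
    (fun y => (Nat.mul_le_mul_left _ (deg_le y)).trans hH.2.2.2) h1 (fun x hx => (h2 x hx).1) h3
  refine ⟨μ, ?_, h6, fun x hx => ?_, ?_⟩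
  · have hprog : (fun v => singleRandomWalk P (input G s ℓ v)) = fun v =>
        phaseOne (input G s ℓ v) P >>= phaseTwo P (input G s ℓ v) := by
      funext v
      rw [singleRandomWalk_eq]
      congr 1
      exact if_neg (not_lt.2 hℓ)
    rw [hprog]
    exact h5
  · obtain ⟨y, hy, r, hr, h⟩ := h7 x hx
    obtain ⟨h9, -, -, h10, -⟩ := chainLaw_support hG hadj hlam _ _ _ _ (Nat.zero_le _) r hr
    have h11 := (h2 y hy).2
    have h12 : ℓ - r.2.2 + min ℓ G.diam ≤ ℓ + G.diam :=
      add_le_add (Nat.sub_le _ _) (min_le_right _ _)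
    rw [h, haltTime]
    exact add_le_add h11 (add_le_add h10 h12)
  · refine (h8 _ _).trans (add_le_add h4 ?_)
    rw [toOuterMeasure_eq_expect, toOuterMeasure_eq_expect]
    refine expect_mono fun r hr => ite_one_le_ite_one fun h => ?_
    obtain ⟨-, -, -, -, h10⟩ := chainLaw_support hG hadj hlam _ _ _ _ (Nat.zero_le _) r hr
    have h11 := h10 (by omega)
    have h12 := min_le_right ℓ G.diam
    simp only [Set.mem_ofPred_eq] at h ⊢
    rw [Nat.sub_zero]
    omega

/-- Without steps all nodes halt at once. -/
theorem zero_runs {s : Fin n} {P : Params} (hlam : 0 < P.lam) (hn : ∀ v : Fin n, v = s) :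
    Runs G b (fun v => singleRandomWalk P (input G s 0 v))
      (PMF.pure (0, correctOutput s s)) := by
  have hprog : (fun v => singleRandomWalk P (input G s 0 v)) = fun v =>
      pure (correctOutput s s v) := by
    funext v
    obtain rfl := hn v
    have h : ((input G v 0 v).len < 2 * P.lam) := by simp [input]; omega
    rw [singleRandomWalk_eq, if_pos h]
    simp only [input]
    change Prog.ret _ = Prog.ret _
    simp [correctOutput]
  rw [hprog]
  exact Runs.ret _

theorem demand_le (hG : G.Connected) (hadj : ∀ v, ∃ u, G.Adj v u) {lam ℓ : ℕ} (hlam : 0 < lam)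
    (h1 : 4 * (ℓ + 1) ≤ lam ^ 2) (h2 : 2 * (ℓ + 1) ≤ lam * ∑ v, deg G v) (y x : Fin n) (w : ℕ) :
    demand G lam ℓ y x w ≤ 2 * deg G y := by
  have hdeg : ∀ v, 1 ≤ deg G v := fun v => by
    classical
    obtain ⟨u, hu⟩ := hadj v
    exact Finset.card_pos.2 ⟨u, by simpa using hu⟩
  have hg : green G (ℓ + 1) y x ≤ lam := by
    rcases green_le hG hadj (ℓ + 1) y x with h | h
    · have h1' : 4 * ((ℓ : ℝ) + 1) ≤ (lam : ℝ) ^ 2 := by exact_mod_cast h1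
      push_cast at h
      exact le_of_sq_le_sq (h.trans h1') (Nat.cast_nonneg _)
    · have h2' : 2 * ((ℓ : ℝ) + 1) ≤ lam * ∑ v, (deg G v : ℝ) := by exact_mod_cast h2
      push_cast at h
      refine le_of_mul_le_mul_right (h.trans h2') (Finset.sum_pos (fun v _ => ?_) ⟨x, Finset.mem_univ x⟩)
      exact_mod_cast hdeg v
  have hsum : ∑ t ∈ Finset.range (ℓ + 1), G.srw x t y ≤ lam * deg G y := by
    have hd : (0 : ℝ) < deg G y := by exact_mod_cast hdeg y
    rw [green, div_le_iff₀ hd] at hg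
    have := ENNReal.ofReal_le_ofReal hg
    rw [ENNReal.ofReal_sum_of_nonneg fun _ _ => prob_nonneg _ _ _] at this
    simpa [prob, ENNReal.ofReal_toReal (PMF.apply_ne_top _ _), ENNReal.ofReal_mul] using this
  rw [demand, two_mul]
  refine add_le_add ?_ ?_
  · refine le_trans ?_ (show (1 : ℝ≥0∞) ≤ deg G y by exact_mod_cast hdeg y)
    split_ifs
    · exact le_rfl
    · exact zero_le_one
  · have h3 : ∑ t ∈ Finset.Ico lam (ℓ - w + 1), G.srw x t y ≤
        ∑ t ∈ Finset.range (ℓ + 1), G.srw x t y := by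
      refine Finset.sum_le_sum_of_subset fun t ht => ?_
      rw [Finset.mem_Ico] at ht
      rw [Finset.mem_range]; omega
    refine (mul_le_mul_right (h3.trans hsum) _).trans (le_of_eq ?_)
    rw [← mul_assoc, ENNReal.inv_mul_cancel (by exact_mod_cast hlam.ne') (by simp), one_mul]

theorem exists_adj_of_connected (hG : G.Connected) (hn : 2 ≤ n) (v : Fin n) : ∃ u, G.Adj v u := by
  have : Nontrivial (Fin n) := Fin.nontrivial_iff_two_le.2 hn
  obtain ⟨w, hw⟩ := exists_ne v
  obtain ⟨p⟩ := hG v w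
  cases p with
  | nil => exact absurd rfl hw
  | cons h _ => exact ⟨_, h⟩

end Whole

section Parameters

/-- The parameters of the algorithm. -/
def params (n ℓ D : ℕ) : Params where
  eta := 4 * (2 * Nat.size n + 1)
  lam := (Nat.size n + 1) * (Nat.sqrt (ℓ * D) + 1)
  slots := 2 * (4 * (2 * Nat.size n + 1)) +
    Nat.size (2 * ((Nat.size n + 1) * (Nat.sqrt (ℓ * D) + 1))) + 3 * Nat.size n

theorem size_mul_le (a c : ℕ) : Nat.size (a * c) ≤ Nat.size a + Nat.size c := by
  rw [Nat.size_le, pow_add]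
  exact Nat.mul_lt_mul'' (Nat.lt_size_self a) (Nat.lt_size_self c)

theorem size_pow_le (a p : ℕ) : Nat.size (a ^ p) ≤ p * Nat.size a + 1 := by
  induction p with
  | zero => simp
  | succ p ih =>
    rw [pow_succ, Nat.succ_mul]
    exact (size_mul_le _ _).trans (by omega)

theorem size_le_log {n : ℕ} (hn : 2 ≤ n) : (Nat.size n : ℝ) ≤ 3 * Real.log n := by
  have hn' : (2 : ℝ) ≤ n := by exact_mod_cast hn
  have h0 : 0 < Nat.size n := Nat.size_pos.2 (by omega)
  have h1 : 2 ^ (Nat.size n - 1) ≤ n := by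
    rw [← not_lt, ← Nat.size_le]
    omega
  have h2 : ((Nat.size n - 1 : ℕ) : ℝ) * Real.log 2 ≤ Real.log n := by
    rw [← Real.log_pow]
    refine Real.log_le_log (by positivity) ?_
    exact_mod_cast h1
  rw [Nat.cast_sub h0, Nat.cast_one] at h2
  have h3 : Real.log 2 ≤ Real.log n := Real.log_le_log (by norm_num) hn'
  have h4 := Real.log_two_gt_d9
  nlinarith

theorem numberBound_le {n ℓ D q : ℕ} (hn : 2 ≤ n) (hD : D ≤ n) (hℓ : ℓ ≤ q * n ^ 4) :
    numberBound n ℓ (params n ℓ D) ≤ n ^ 8 * (50 * (q + 1)) := by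
  have h1 : Nat.size n ≤ n := by rw [Nat.size_le]; exact Nat.lt_two_pow_self
  have h2 : Nat.sqrt (ℓ * D) ≤ ℓ * D := Nat.sqrt_le_self _
  have h3 : ℓ * D ≤ q * n ^ 5 := (Nat.mul_le_mul hℓ hD).trans_eq (by ring)
  have hpow : ∀ i j : ℕ, i ≤ j → n ^ i ≤ n ^ j := fun i j h => Nat.pow_le_pow_right (by omega) h
  have h4 : (Nat.size n + 1) * (Nat.sqrt (ℓ * D) + 1) ≤ 2 * n * ((q + 1) * n ^ 5) := by
    refine Nat.mul_le_mul (by omega) ((Nat.add_le_add_right (h2.trans h3) 1).trans ?_)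
    have := hpow 0 5 (by omega)
    rw [add_mul, pow_zero] at *
    omega
  have h5 : 4 * (2 * Nat.size n + 1) * n ≤ 12 * n * n := Nat.mul_le_mul_right _ (by omega)
  have h6 : n ≤ n ^ 8 := by simpa using hpow 1 8 (by omega)
  have h7 := Nat.mul_le_mul_left (q + 1) (hpow 6 8 (by omega))
  have h8 := Nat.mul_le_mul_left q (hpow 4 8 (by omega))
  have h9 := hpow 2 8 (by omega)
  have h10 := Nat.zero_le (q * n ^ 8)
  simp only [numberBound, params]
  calc n + 2 * ((Nat.size n + 1) * (Nat.sqrt (ℓ * D) + 1)) + ℓ + 4 * (2 * Nat.size n + 1) * n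
      ≤ n ^ 8 + 2 * (2 * n * ((q + 1) * n ^ 5)) + q * n ^ 8 + 12 * n ^ 8 := by
        have : 12 * n * n = 12 * n ^ 2 := by ring
        omega
    _ = n ^ 8 + 4 * ((q + 1) * n ^ 6) + q * n ^ 8 + 12 * n ^ 8 := by ring
    _ ≤ n ^ 8 + 4 * ((q + 1) * n ^ 8) + q * n ^ 8 + 12 * n ^ 8 := by omega
    _ ≤ n ^ 8 * (50 * (q + 1)) := by nlinarith

theorem size_numberBound_le {n ℓ D q : ℕ} (hn : 2 ≤ n) (hD : D ≤ n) (hℓ : ℓ ≤ q * n ^ 4) :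
    Nat.size (numberBound n ℓ (params n ℓ D)) ≤ 8 * Nat.size n + 1 + Nat.size (50 * (q + 1)) :=
  (Nat.size_le_size (numberBound_le hn hD hℓ)).trans
    ((size_mul_le _ _).trans (Nat.add_le_add_right (size_pow_le _ _) _))

theorem size_two_le {n : ℕ} (hn : 2 ≤ n) : 2 ≤ Nat.size n := by
  by_contra h
  have := Nat.size_le.1 (show Nat.size n ≤ 1 by omega)
  omega

theorem slots_le {n ℓ D q : ℕ} (hn : 2 ≤ n) (hD : D ≤ n) (hℓ : ℓ ≤ q * n ^ 4) :
    (params n ℓ D).slots ≤ (32 + Nat.size (50 * (q + 1))) * Nat.size n := by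
  have h1 : Nat.size (2 * (params n ℓ D).lam) ≤ _ := (Nat.size_le_size (by
    rw [numberBound]; omega)).trans (size_numberBound_le hn hD hℓ)
  have h2 := size_two_le hn
  have h3 : Nat.size (50 * (q + 1)) ≤ Nat.size (50 * (q + 1)) * Nat.size n :=
    Nat.le_mul_of_pos_right _ (by omega)
  have h4 : (params n ℓ D).slots = 2 * (4 * (2 * Nat.size n + 1)) +
    Nat.size (2 * (params n ℓ D).lam) + 3 * Nat.size n := rfl
  rw [h4, add_mul]
  omega

theorem lam_le {n ℓ D : ℕ} (hn : 2 ≤ n) (hs : 1 ≤ √((ℓ : ℝ) * D)) :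
    ((params n ℓ D).lam : ℝ) ≤ 3 * Nat.size n * √((ℓ : ℝ) * D) := by
  have h1 : (2 : ℝ) ≤ Nat.size n := by exact_mod_cast size_two_le hn
  have h2 : (Nat.sqrt (ℓ * D) : ℝ) ≤ √((ℓ : ℝ) * D) := by
    have := Real.nat_sqrt_le_real_sqrt (a := ℓ * D)
    push_cast at this
    exact this
  simp only [params]
  push_cast
  calc ((Nat.size n : ℝ) + 1) * (Nat.sqrt (ℓ * D) + 1)
      ≤ (3 / 2 * Nat.size n) * (2 * √((ℓ : ℝ) * D)) :=
        mul_le_mul (by linarith) (by linarith) (by positivity) (by positivity)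
    _ = 3 * Nat.size n * √((ℓ : ℝ) * D) := by ring

theorem sqrt_le_lam (n ℓ D : ℕ) : √((ℓ : ℝ) * D) ≤ (params n ℓ D).lam := by
  have h2 : √((ℓ : ℝ) * D) ≤ Nat.sqrt (ℓ * D) + 1 := by
    have := Real.real_sqrt_le_nat_sqrt_succ (a := ℓ * D)
    push_cast at this
    exact this
  simp only [params]
  push_cast
  have h3 : (0 : ℝ) ≤ Nat.size n := Nat.cast_nonneg _
  have h4 : (0 : ℝ) ≤ Nat.sqrt (ℓ * D) := Nat.cast_nonneg _
  nlinarith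

theorem one_le_sqrt {ℓ D : ℕ} (hℓ : 1 ≤ ℓ) (hD : 1 ≤ D) : 1 ≤ √((ℓ : ℝ) * D) := by
  rw [Real.one_le_sqrt]
  exact_mod_cast Nat.mul_le_mul hℓ hD

/-- The running time, if `ℓ` is not very small. -/
theorem usualTime_le {n ℓ D q : ℕ} (hn : 2 ≤ n) (hD0 : 1 ≤ D) (hD : D ≤ n) (hℓ : ℓ ≤ q * n ^ 4)
    (hℓ0 : 1 ≤ ℓ) (hℓ' : 2 * (params n ℓ D).lam ≤ ℓ) :
    (usualTime ℓ D (params n ℓ D) : ℝ) ≤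
      (200 + 6 * Nat.size (50 * (q + 1))) * (Nat.size n : ℝ) ^ 2 * √((ℓ : ℝ) * D) := by
  set r := √((ℓ : ℝ) * D) with hr
  set S : ℝ := ((Nat.size n : ℕ) : ℝ) with hS
  set σ : ℝ := ((Nat.size (50 * (q + 1)) : ℕ) : ℝ) with hσ
  set lam := (params n ℓ D).lam with hlam
  have hr1 : 1 ≤ r := one_le_sqrt hℓ0 hD0
  have hrr : r * r = ℓ * D := Real.mul_self_sqrt (by positivity)
  have hS2 : 2 ≤ S := by rw [hS]; exact_mod_cast size_two_le hn
  have hσ0 : 0 ≤ σ := Nat.cast_nonneg _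
  have h1 : (lam : ℝ) ≤ 3 * S * r := lam_le hn hr1
  have h2 : r ≤ lam := sqrt_le_lam n ℓ D
  have h3 : ((params n ℓ D).slots : ℝ) ≤ (32 + σ) * S := by
    rw [hS, hσ]; exact_mod_cast slots_le hn hD hℓ
  have h4 : (2 : ℝ) * lam ≤ ℓ := by exact_mod_cast hℓ'
  have h5 : (D : ℝ) ≤ r := by
    have h6 : r ≤ ℓ := by linarith
    have h7 : (0 : ℝ) ≤ D := Nat.cast_nonneg _
    by_contra h
    push Not at h
    nlinarith
  have h6 : (D : ℝ) * (ℓ / lam : ℕ) ≤ r := by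
    have h7 : ((ℓ / lam : ℕ) : ℝ) * lam ≤ ℓ := by exact_mod_cast Nat.div_mul_le_self ℓ lam
    have h8 : (0 : ℝ) ≤ (ℓ / lam : ℕ) := Nat.cast_nonneg _
    have h9 : (0 : ℝ) ≤ D := Nat.cast_nonneg _
    have h10 : (D : ℝ) * (ℓ / lam : ℕ) * r ≤ r * r := by
      calc (D : ℝ) * (ℓ / lam : ℕ) * r ≤ D * (ℓ / lam : ℕ) * lam :=
            mul_le_mul_of_nonneg_left h2 (by positivity)
        _ = D * ((ℓ / lam : ℕ) * lam) := by ring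
        _ ≤ D * ℓ := mul_le_mul_of_nonneg_left h7 h9
        _ = r * r := by rw [hrr]; ring
    exact le_of_mul_le_mul_right h10 (by linarith)
  have h7 : (lam : ℝ) * (params n ℓ D).slots ≤ 3 * S * r * ((32 + σ) * S) :=
    mul_le_mul h1 h3 (Nat.cast_nonneg _) (by positivity)
  have h8 : r ≤ S ^ 2 * r / 4 := by nlinarith
  have h9 : S * r ≤ S ^ 2 * r / 2 := by
    have : S * r * 2 ≤ S * r * S := mul_le_mul_of_nonneg_left hS2 (by positivity)
    nlinarith
  rw [usualTime]
  push_cast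
  rw [← hlam]
  nlinarith

theorem shortTime_le {n ℓ D : ℕ} (hn : 2 ≤ n) (hD0 : 1 ≤ D) (hℓ' : ℓ < 2 * (params n ℓ D).lam) :
    ((ℓ + min ℓ D : ℕ) : ℝ) ≤ 6 * (Nat.size n : ℝ) ^ 2 * √((ℓ : ℝ) * D) := by
  rcases Nat.eq_zero_or_pos ℓ with rfl | hℓ
  · simp
  have hr1 := one_le_sqrt hℓ hD0
  have h1 := lam_le hn hr1
  have hS2 : (2 : ℝ) ≤ Nat.size n := by exact_mod_cast size_two_le hn
  have h2 : ((ℓ + min ℓ D : ℕ) : ℝ) ≤ 4 * (params n ℓ D).lam := by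
    exact_mod_cast (show ℓ + min ℓ D ≤ 4 * (params n ℓ D).lam by omega)
  have h3 : (Nat.size n : ℝ) * √((ℓ : ℝ) * D) * 2 ≤ Nat.size n * √((ℓ : ℝ) * D) * Nat.size n :=
    mul_le_mul_of_nonneg_left hS2 (by positivity)
  nlinarith

theorem congestion_failure_le {n ℓ D : ℕ} (hn : 2 ≤ n) :
    ((2 * (params n ℓ D).lam : ℕ) : ℝ≥0∞) * (n ^ 2 : ℕ) *
      (4 ^ (params n ℓ D).eta / 2 ^ (params n ℓ D).slots) ≤ (n : ℝ≥0∞)⁻¹ := by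
  set lam := (params n ℓ D).lam with hlam
  set η := (params n ℓ D).eta with hη
  have h1 : (params n ℓ D).slots = 2 * η + Nat.size (2 * lam) + 3 * Nat.size n := rfl
  have h2 : n * (2 * lam * n ^ 2 * 4 ^ η) ≤ 2 ^ (params n ℓ D).slots := by
    rw [h1, pow_add, pow_add, pow_mul 2 2, mul_comm 3, pow_mul 2 _ 3]
    calc n * (2 * lam * n ^ 2 * 4 ^ η) = 4 ^ η * (2 * lam) * n ^ 3 := by ring
      _ ≤ (2 ^ 2) ^ η * 2 ^ Nat.size (2 * lam) * (2 ^ Nat.size n) ^ 3 := by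
        gcongr
        · norm_num
        · exact (Nat.lt_size_self _).le
        · exact (Nat.lt_size_self _).le
  have h3 : (n : ℝ≥0∞) * ((2 * lam : ℕ) * (n ^ 2 : ℕ) * 4 ^ η) ≤ 2 ^ (params n ℓ D).slots := by
    exact_mod_cast h2
  have hn0 : (n : ℝ≥0∞) ≠ 0 := by exact_mod_cast (show n ≠ 0 by omega)
  rw [← mul_div_assoc]
  refine ENNReal.div_le_of_le_mul ?_
  calc ((2 * lam : ℕ) : ℝ≥0∞) * (n ^ 2 : ℕ) * 4 ^ η
      = (n : ℝ≥0∞)⁻¹ * (n * ((2 * lam : ℕ) * (n ^ 2 : ℕ) * 4 ^ η)) := by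
        rw [← mul_assoc, ENNReal.inv_mul_cancel hn0 (by simp), one_mul]
    _ ≤ (n : ℝ≥0∞)⁻¹ * 2 ^ (params n ℓ D).slots := mul_le_mul_right h3 _

theorem scarcity_failure_le {n : ℕ} (hn : 2 ≤ n) :
    (n : ℝ≥0∞) * (2 * (2 ^ (2 * Nat.size n + 1))⁻¹) ≤ (n : ℝ≥0∞)⁻¹ := by
  have h2 : n * (n * 2) ≤ 2 ^ (2 * Nat.size n + 1) := by
    rw [pow_succ, mul_comm 2, pow_mul]
    calc n * (n * 2) = n ^ 2 * 2 := by ring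
      _ ≤ (2 ^ Nat.size n) ^ 2 * 2 := by
        gcongr
        exact (Nat.lt_size_self _).le
  have h3 : (n : ℝ≥0∞) * (n * 2) ≤ 2 ^ (2 * Nat.size n + 1) := by exact_mod_cast h2
  have hn0 : (n : ℝ≥0∞) ≠ 0 := by exact_mod_cast (show n ≠ 0 by omega)
  rw [← mul_assoc, ← div_eq_mul_inv]
  refine ENNReal.div_le_of_le_mul ?_
  calc (n : ℝ≥0∞) * 2 = (n : ℝ≥0∞)⁻¹ * (n * (n * 2)) := by
        rw [← mul_assoc, ENNReal.inv_mul_cancel hn0 (by simp), one_mul]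
    _ ≤ _ := mul_le_mul_right h3 _

theorem demand_params_le (hG : G.Connected) (hn : 2 ≤ n) {ℓ m q : ℕ} (hD : 1 ≤ G.diam)
    (hm : ∑ v, deg G v = 2 * m) (hℓ : ℓ ≤ q * m ^ 2) (hq : q + 1 ≤ (Nat.size n + 1) ^ 2)
    (y x : Fin n) (w : ℕ) : demand G (params n ℓ G.diam).lam ℓ y x w ≤ 2 * deg G y := by
  have hadj := exists_adj_of_connected hG hn
  set lam := (params n ℓ G.diam).lam with hlam
  have h1 : (Nat.size n + 1) ^ 2 * (ℓ + 1) ≤ lam ^ 2 := by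
    have h2 : lam = (Nat.size n + 1) * (Nat.sqrt (ℓ * G.diam) + 1) := rfl
    rw [h2, mul_pow]
    refine Nat.mul_le_mul_left _ ?_
    have h3 := Nat.lt_succ_sqrt' (ℓ * G.diam)
    have h4 : ℓ ≤ ℓ * G.diam := Nat.le_mul_of_pos_right _ hD
    rw [Nat.succ_eq_add_one] at h3
    omega
  have hm0 : 1 ≤ m := by
    have : deg G x ≤ ∑ v, deg G v := Finset.single_le_sum (fun _ _ => Nat.zero_le _) (Finset.mem_univ x)
    have h2 : 1 ≤ deg G x := by
      classical
      obtain ⟨u, hu⟩ := hadj x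
      exact Finset.card_pos.2 ⟨u, by simpa using hu⟩
    omega
  refine demand_le hG hadj (by simp [hlam, params]) ?_ ?_ y x w
  · refine le_trans (Nat.mul_le_mul_right _ ?_) h1
    have h5 := size_two_le hn
    nlinarith
  · rw [hm]
    suffices h : ℓ + 1 ≤ lam * m by nlinarith
    rw [← Nat.pow_le_pow_iff_left (n := 2) (by norm_num), mul_pow]
    have h6 : ℓ + 1 ≤ (q + 1) * m ^ 2 := by nlinarith [Nat.pow_le_pow_left hm0 2]
    calc (ℓ + 1) ^ 2 = (ℓ + 1) * (ℓ + 1) := sq _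
      _ ≤ (q + 1) * m ^ 2 * (ℓ + 1) := Nat.mul_le_mul_right _ h6
      _ ≤ (Nat.size n + 1) ^ 2 * m ^ 2 * (ℓ + 1) := by gcongr
      _ = (Nat.size n + 1) ^ 2 * (ℓ + 1) * m ^ 2 := by ring
      _ ≤ lam ^ 2 * m ^ 2 := Nat.mul_le_mul_right _ h1

end Parameters

section Conclusion

theorem Runs.one_sub_le_halted {p : Fin n → Prog n α} {μ : PMF (ℕ × (Fin n → α))}
    (h : Runs G b p μ) {t : ℕ} {ε : ℝ} (hε : 0 ≤ ε)
    (hμ : μ.toOuterMeasure {x | t < x.1} ≤ ENNReal.ofReal ε) :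
    1 - ε ≤ ((exec G p t).toOuterMeasure {c | c.Halted}).toReal := by
  have h1 : (1 : ℝ≥0∞) ≤ μ.toOuterMeasure {x | x.1 ≤ t} + μ.toOuterMeasure {x | t < x.1} := by
    rw [toOuterMeasure_eq_expect, toOuterMeasure_eq_expect, ← expect_add]
    refine (expect_const μ 1).symm.le.trans (expect_mono fun x _ => ?_)
    by_cases hx : x.1 ≤ t
    · rw [if_pos (show x ∈ {x : ℕ × (Fin n → α) | x.1 ≤ t} from hx)]
      exact self_le_add_right _ _
    · rw [if_pos (show x ∈ {x : ℕ × (Fin n → α) | t < x.1} from not_le.1 hx)]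
      exact self_le_add_left _ _
  have h2 := h.halted_le 0 (Nat.zero_le _) t
  rw [← exec_eq_execFrom] at h2
  have h3 : (1 : ℝ≥0∞) ≤ (exec G p t).toOuterMeasure {c | c.Halted} + ENNReal.ofReal ε :=
    h1.trans (add_le_add h2 hμ)
  have h4 : (exec G p t).toOuterMeasure {c | c.Halted} ≠ ∞ := by
    rw [toOuterMeasure_eq_expect]
    refine ne_top_of_le_ne_top ENNReal.one_ne_top
      ((expect_mono (g := fun _ => 1) fun c _ => ?_).trans (expect_const _ 1).le)
    split_ifs
    · exact le_rfl
    · exact zero_le_one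
  have h5 := ENNReal.toReal_mono (ENNReal.add_ne_top.2 ⟨h4, ENNReal.ofReal_ne_top⟩) h3
  rw [ENNReal.toReal_add h4 ENNReal.ofReal_ne_top, ENNReal.toReal_ofReal hε, ENNReal.toReal_one] at h5
  linarith

theorem toOuterMeasure_eq_zero_of_le {μ : PMF (ℕ × (Fin n → α))} {t : ℕ}
    (h : ∀ x ∈ μ.support, x.1 ≤ t) : μ.toOuterMeasure {x | t < x.1} = 0 := by
  rw [toOuterMeasure_eq_expect]
  exact expect_eq_zero fun x hx => if_neg (not_lt.2 (h x hx))

theorem sum_deg (G : SimpleGraph (Fin n)) : ∑ v, deg G v = 2 * G.edgeSet.ncard := by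
  classical
  rw [← SimpleGraph.coe_edgeFinset, Set.ncard_coe_finset, ← G.sum_degrees_eq_twice_card_edges]
  refine Finset.sum_congr rfl fun v _ => ?_
  rw [deg, ← SimpleGraph.card_neighborFinset_eq_degree]

theorem ncard_edgeSet_le (G : SimpleGraph (Fin n)) : G.edgeSet.ncard ≤ n ^ 2 := by
  have h1 : ∑ v, deg G v ≤ ∑ _v : Fin n, n := Finset.sum_le_sum fun v _ => deg_le v
  rw [sum_deg, Finset.sum_const, Finset.card_univ, Fintype.card_fin, smul_eq_mul, ← sq] at h1
  omega

theorem diam_le (hG : G.Connected) (hn : 2 ≤ n) : 1 ≤ G.diam ∧ G.diam ≤ n := by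
  have : Nontrivial (Fin n) := Fin.nontrivial_iff_two_le.2 hn
  obtain ⟨u, v, huv⟩ := exists_pair_ne (Fin n)
  refine ⟨((hG.pos_dist_of_ne huv).trans_le (dist_le_diam' hG u v)), ?_⟩
  obtain ⟨u, v, h⟩ := G.exists_dist_eq_diam
  obtain ⟨p, hp, hp'⟩ := hG.exists_path_of_dist u v
  rw [← h, ← hp']
  exact (hp.length_lt.trans_eq (Fintype.card_fin n)).le

/-- A time that suffices for all small networks. -/
def smallTime (q : ℕ) : ℕ :=
  (Finset.range (2 ^ q + 1)).sup fun n => (Finset.range (q * (2 ^ q) ^ 4 + 1)).sup fun ℓ =>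
    (Finset.range (2 ^ q + 1)).sup fun D => haltTime n ℓ D (params n ℓ D)

theorem haltTime_le {n ℓ D q : ℕ} (hn : n ≤ 2 ^ q) (hD : D ≤ n) (hℓ : ℓ ≤ q * n ^ 4) :
    haltTime n ℓ D (params n ℓ D) ≤ smallTime q := by
  have h1 : ℓ ≤ q * (2 ^ q) ^ 4 := hℓ.trans (Nat.mul_le_mul_left _ (Nat.pow_le_pow_left hn 4))
  refine le_trans ?_ (Finset.le_sup (Finset.mem_range.2 (Nat.lt_succ_of_le hn)))
  refine le_trans ?_ (Finset.le_sup (Finset.mem_range.2 (Nat.lt_succ_of_le h1)))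
  exact Finset.le_sup (f := fun D => haltTime n ℓ D (params n ℓ D))
    (Finset.mem_range.2 (Nat.lt_succ_of_le (hD.trans hn)))

/-- The constant in the bounds on message length and running time. -/
noncomputable def constant (q : ℕ) : ℝ :=
  2000 + 60 * Nat.size (50 * (q + 1)) + 4 * smallTime q

theorem quarter_le_log_sq {n : ℕ} (hn : 2 ≤ n) : 1 / 4 ≤ Real.log n ^ 2 := by
  have h1 : Real.log 2 ≤ Real.log n := Real.log_le_log (by norm_num) (by exact_mod_cast hn)
  have h2 := Real.log_two_gt_d9
  nlinarith

/-- With high probability the algorithm finishes in time. -/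
theorem singleRandomWalk_runs (hG : G.Connected) (hn : 2 ≤ n) {s : Fin n} {ℓ q : ℕ}
    (hℓ : ℓ ≤ q * G.edgeSet.ncard ^ 2)
    (hb : 8 + 6 * Nat.size (numberBound n ℓ (params n ℓ G.diam)) ≤ b) :
    ∃ μ : PMF (ℕ × (Fin n → Output)),
      Runs G b (fun v => singleRandomWalk (params n ℓ G.diam) (input G s ℓ v)) μ ∧
      μ.map Prod.snd = (G.srw s ℓ).map (correctOutput s) ∧
      (∃ T, ∀ x ∈ μ.support, x.1 ≤ T) ∧
      μ.toOuterMeasure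
        {x | ⌊constant q * Real.log n ^ 2 * √((ℓ : ℝ) * G.diam)⌋₊ < x.1} ≤
          ENNReal.ofReal (2 / n) := by
  have hadj := exists_adj_of_connected hG hn
  obtain ⟨hD1, hDn⟩ := diam_le hG hn
  have hlam : 0 < (params n ℓ G.diam).lam := by simp [params]
  have hslots : 0 < (params n ℓ G.diam).slots := by simp only [params]; omega
  have hℓn : ℓ ≤ q * n ^ 4 := hℓ.trans (Nat.mul_le_mul_left _
    ((Nat.pow_le_pow_left (ncard_edgeSet_le G) 2).trans_eq (by ring)))
  have hlog : 0 ≤ Real.log n := Real.log_natCast_nonneg n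
  have hsize : (Nat.size n : ℝ) ^ 2 ≤ 9 * Real.log n ^ 2 := by
    have := pow_le_pow_left₀ (Nat.cast_nonneg _) (size_le_log hn) 2
    linarith
  set r := √((ℓ : ℝ) * G.diam) with hr
  have hr0 : 0 ≤ r := Real.sqrt_nonneg _
  have hfloor : ∀ T : ℕ, (T : ℝ) ≤ (200 + 6 * Nat.size (50 * (q + 1))) * (Nat.size n : ℝ) ^ 2 * r →
      T ≤ ⌊constant q * Real.log n ^ 2 * r⌋₊ := by
    intro T hT
    refine Nat.le_floor (hT.trans (mul_le_mul_of_nonneg_right ?_ hr0))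
    refine (mul_le_mul_of_nonneg_left hsize (by positivity)).trans ?_
    rw [← mul_assoc]
    refine mul_le_mul_of_nonneg_right ?_ (sq_nonneg _)
    rw [constant]
    have : (0 : ℝ) ≤ smallTime q := Nat.cast_nonneg _
    have : (0 : ℝ) ≤ Nat.size (50 * (q + 1)) := Nat.cast_nonneg _
    linarith
  by_cases hshort : ℓ < 2 * (params n ℓ G.diam).lam
  · obtain ⟨μ, h1, h2, h3⟩ := short_runs (s := s) hG hadj hlam hshort hb
    refine ⟨μ, h1, h2, ⟨_, h3⟩, ?_⟩
    rw [toOuterMeasure_eq_zero_of_le fun x hx => (h3 x hx).trans (hfloor _ ?_)]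
    · exact zero_le
    · refine (shortTime_le hn hD1 hshort).trans ?_
      refine mul_le_mul_of_nonneg_right (mul_le_mul_of_nonneg_right ?_ (sq_nonneg _)) hr0
      have : (0 : ℝ) ≤ Nat.size (50 * (q + 1)) := Nat.cast_nonneg _
      linarith
  push Not at hshort
  obtain ⟨μ, h1, h2, h3, h4⟩ := long_runs (s := s) hG hadj hlam hslots hshort hb
  refine ⟨μ, h1, h2, ⟨_, h3⟩, ?_⟩
  by_cases hq : q + 1 ≤ (Nat.size n + 1) ^ 2
  swap
  · have hsmall : n ≤ 2 ^ q := by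
      push Not at hq
      have h5 : Nat.size n ≤ q := by nlinarith
      exact (Nat.lt_size_self n).le.trans (Nat.pow_le_pow_right (by norm_num) h5)
    rw [toOuterMeasure_eq_zero_of_le fun x hx => ((h3 x hx).trans (haltTime_le hsmall hDn hℓn)).trans ?_]
    · exact zero_le
    refine Nat.le_floor ?_
    have h5 := quarter_le_log_sq hn
    have h6 : 1 ≤ r := one_le_sqrt (by omega) hD1
    have h7 : (0 : ℝ) ≤ smallTime q := Nat.cast_nonneg _
    have h8 : 4 * (smallTime q : ℝ) ≤ constant q := by
      rw [constant]
      have : (0 : ℝ) ≤ Nat.size (50 * (q + 1)) := Nat.cast_nonneg _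
      linarith
    have h9 : 0 ≤ constant q := h8.trans' (by positivity)
    calc (smallTime q : ℝ) = 4 * smallTime q * (1 / 4) * 1 := by ring
      _ ≤ constant q * Real.log n ^ 2 * r := by gcongr
  · have hdeg : ∀ v, deg G v ≠ 0 := fun v => by
      classical
      obtain ⟨u, hu⟩ := hadj v
      exact Finset.card_ne_zero.2 ⟨u, by simpa using hu⟩
    have hdem := demand_params_le hG hn hD1 (sum_deg G) hℓ hq
    have h5 := (chainLaw_late_le (ℓ := ℓ) hlam hdeg hdem ℓ
      (fun v => (params n ℓ G.diam).eta * deg G v) s 0 (Nat.zero_le _)).trans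
      ((potential_initial_le hdeg hdem (2 * Nat.size n + 1) s).trans (scarcity_failure_le hn))
    have h6 : (n : ℝ≥0∞)⁻¹ + (n : ℝ≥0∞)⁻¹ = ENNReal.ofReal (2 / n) := by
      rw [ENNReal.ofReal_div_of_pos (by exact_mod_cast (show 0 < n by omega)), ENNReal.ofReal_natCast,
        ← two_mul, div_eq_mul_inv]
      norm_num
    rw [← h6]
    refine le_trans ?_ (h4.trans (add_le_add (congestion_failure_le hn) h5))
    refine MeasureTheory.measure_mono fun x hx => ?_
    exact (hfloor _ (usualTime_le hn hD1 hDn hℓn (by omega) hshort)).trans_lt hx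

theorem bits_le_log {ℓ D q : ℕ} (hn : 2 ≤ n) (hD : D ≤ n) (hℓ : ℓ ≤ q * n ^ 4) :
    ((8 + 6 * Nat.size (numberBound n ℓ (params n ℓ D)) : ℕ) : ℝ) ≤ constant q * Real.log n := by
  have h1 : (Nat.size (numberBound n ℓ (params n ℓ D)) : ℝ) ≤
      8 * Nat.size n + 1 + Nat.size (50 * (q + 1)) := by exact_mod_cast size_numberBound_le hn hD hℓ
  have h2 := size_le_log hn
  have h3 : 1 / 2 ≤ Real.log n := by
    have h4 : Real.log 2 ≤ Real.log n := Real.log_le_log (by norm_num) (by exact_mod_cast hn)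
    have h5 := Real.log_two_gt_d9
    linarith
  have h4 : (0 : ℝ) ≤ smallTime q := Nat.cast_nonneg _
  have h5 : (0 : ℝ) ≤ Nat.size (50 * (q + 1)) := Nat.cast_nonneg _
  rw [constant]
  push_cast
  nlinarith [mul_nonneg h4 (h3.trans' (by norm_num : (0 : ℝ) ≤ 1 / 2)),
    mul_nonneg h5 (sub_nonneg.2 h3)]

end Conclusion

end Congest

/-- There are a choice `par` of the (positive) parameters of Single-Random-Walk, depending only on the number
of nodes `n`, the length `ℓ` and the diameter `D`, and an exponent `a` such that the following holds
whenever `ℓ = O(m ^ 2)`, for every connected network with `m` edges and every source `s`: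
the algorithm always halts, and the destination it produces has exactly the law of the endpoint of
the `ℓ`-step simple random walk; all messages have `O(log n)` bits; and with probability at least
`1 - 2 / n` all nodes have halted after `O((log n) ^ a * √(ℓ D))` rounds. -/
theorem mainTheorem1 :
    ∃ (par : ℕ → ℕ → ℕ → Congest.Params) (a : ℕ),
    (∀ n ℓ D, 0 < (par n ℓ D).eta ∧ 0 < (par n ℓ D).lam ∧ 0 < (par n ℓ D).slots) ∧
    ∀ K : ℝ, ∃ C : ℝ,
      ∀ (n : ℕ) (G : SimpleGraph (Fin n)) (s : Fin n) (ℓ : ℕ), G.Connected →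
        (ℓ : ℝ) ≤ K * (G.edgeSet.ncard : ℝ) ^ 2 →
        (∃ T : ℕ, (Congest.runSingleRandomWalk par G s ℓ T).map Congest.Config.results =
          (G.srw s ℓ).map (Congest.correctResults s)) ∧
        (∀ t : ℕ, ∀ c ∈ (Congest.runSingleRandomWalk par G s ℓ t).support,
          (c.bits : ℝ) ≤ C * Real.log n) ∧
        1 - 2 / (n : ℝ) ≤
          ((Congest.runSingleRandomWalk par G s ℓ
            ⌊C * Real.log n ^ a * √((ℓ : ℝ) * G.diam)⌋₊).toOuterMeasure
              {c | c.Halted}).toReal := by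
  refine ⟨Congest.params, 2, fun n ℓ D => ⟨?_, ?_, ?_⟩, fun K => ⟨Congest.constant ⌈K⌉₊, ?_⟩⟩
  · simp [Congest.params]
  · simp [Congest.params]
  · simp only [Congest.params]; omega
  intro n G s ℓ hG hK
  have hℓ : ℓ ≤ ⌈K⌉₊ * G.edgeSet.ncard ^ 2 := by
    have : (ℓ : ℝ) ≤ ⌈K⌉₊ * (G.edgeSet.ncard : ℝ) ^ 2 :=
      hK.trans (mul_le_mul_of_nonneg_right (Nat.le_ceil K) (sq_nonneg _))
    exact_mod_cast this
  have key : ∃ (b : ℕ) (μ : PMF (ℕ × (Fin n → Congest.Output))), (b : ℝ) ≤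
        Congest.constant ⌈K⌉₊ * Real.log n ∧
      Congest.Runs G b (fun v => Congest.singleRandomWalk (Congest.params n ℓ G.diam)
        (Congest.input G s ℓ v)) μ ∧
      μ.map Prod.snd = (G.srw s ℓ).map (Congest.correctOutput s) ∧
      (∃ T, ∀ x ∈ μ.support, x.1 ≤ T) ∧
      μ.toOuterMeasure {x | ⌊Congest.constant ⌈K⌉₊ * Real.log n ^ 2 * √((ℓ : ℝ) * G.diam)⌋₊ <
        x.1} ≤ ENNReal.ofReal (2 / n) := by
    rcases Nat.lt_or_ge n 2 with hn | hn
    · have hs : ∀ v : Fin n, v = s := fun v => Fin.ext (by omega)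
      have hE : G.edgeSet.ncard = 0 := by
        have := Congest.sum_deg G
        have h0 : ∀ v, Congest.deg G v = 0 := fun v => by
          rw [Congest.deg, Finset.card_eq_zero, Finset.eq_empty_iff_forall_notMem]
          intro u hu
          rw [SimpleGraph.mem_neighborFinset, hs u, hs v] at hu
          exact G.loopless.irrefl _ hu
        simp only [h0, Finset.sum_const_zero] at this
        omega
      have hℓ0 : ℓ = 0 := by simpa [hE] using hℓ
      subst hℓ0
      have hn1 : n = 1 := by have := s.2; omega
      refine ⟨0, PMF.pure (0, Congest.correctOutput s s), by simp [hn1], Congest.zero_runs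
        (by simp [Congest.params]) hs, ?_, ⟨0, by simp⟩, ?_⟩
      · rw [PMF.pure_map, SimpleGraph.srw, PMF.pure_map]
      · rw [Congest.toOuterMeasure_eq_zero_of_le (by simp)]
        exact zero_le
    · obtain ⟨μ, hμ⟩ := Congest.singleRandomWalk_runs (s := s) hG hn hℓ le_rfl
      have hℓn : ℓ ≤ ⌈K⌉₊ * n ^ 4 := hℓ.trans (Nat.mul_le_mul_left _
        ((Nat.pow_le_pow_left (Congest.ncard_edgeSet_le G) 2).trans_eq (by ring)))
      exact ⟨_, μ, Congest.bits_le_log hn (Congest.diam_le hG hn).2 hℓn, hμ⟩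
  obtain ⟨b, μ, hb, h1, h2, ⟨T, h3⟩, h4⟩ := key
  refine ⟨⟨T, ?_⟩, fun t c hc => ?_, h1.one_sub_le_halted (by positivity) h4⟩
  · rw [Congest.runSingleRandomWalk, Congest.exec_eq_execFrom, h1.map_results 0 (Nat.zero_le _) T h3]
    have h5 := congrArg (PMF.map fun (o : Fin n → Congest.Output) v => some (o v)) h2
    rw [PMF.map_comp, PMF.map_comp] at h5
    exact h5
  · rw [Congest.runSingleRandomWalk, Congest.exec_eq_execFrom] at hc
    exact le_trans (by exact_mod_cast h1.bits_le 0 (Nat.zero_le _) t c hc) hb
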